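/- For real $R$ and integers $n\ge 1$ let $$\lambda_R(n)=\sum_{r\le R}\frac{\mu^2(r)}{\phi(r)}\sum_{d\mid (r,n)}d\,\mu(d),$$ and let $\lambda_R(n)=0$ for $n\le 0$. For distinct integers $j_1,\dots,j_r$, write $\boldsymbol{j}=(j_1,\dots,j_r)$ and let $$\mathfrak S(\boldsymbol{j})=\prod_p\Big(1-\frac1p\Big)^{-r}\Big(1-\frac{\nu_p(\boldsymbol{j})}{p}\Big)$$ be the Hardy–Littlewood singular series, where $\nu_p(\boldsymbol{j})$ is the number of distinct residue classes modulo $p$ occupied by the $j_i$. **Theorem 1.** Let $1\le k\le 3$ and $\epsilon>0$. Let $j_1,\dots,j_r$ be distinct integers and let $a_1,\dots,a_r\ge 1$ be integers with $\sum_{i=1}^r a_i=k$. Assume that $\max_i|j_i|\le N^{1-\epsilon}$ and $R\gg N^{\epsilon}$. Then, as $N\to\infty$, $$\sum_{n=1}^N\prod_{i=1}^r\lambda_R(n+j_i)^{a_i}=\big(\mathcal C_k(\boldsymbol{a})\,\mathfrak S(\boldsymbol{j})+o(1)\big)\,N(\log R)^{k-r}+O(R^k),$$ where $\mathcal C_k(\boldsymbol{a})$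 does not depend on the order of the entries of $\boldsymbol{a}=(a_1,\dots,a_r)$ and $$\mathcal C_1(1)=\mathcal C_2(2)=\mathcal C_2(1,1)=\mathcal C_3(2,1)=\mathcal C_3(1,1,1)=1,\qquad \mathcal C_3(3)=\tfrac34 .$$ The estimate is uniform in $\boldsymbol{j}$, $\boldsymbol{a}$ and $R$: the implied constant in $O(R^k)$ depends only on $\epsilon$, and $o(1)$ tends to $0$ as $N\to\infty$ at a rate that depends only on $\epsilon$ and the implied constant in $R\gg N^\epsilon$. -/

import Mathlib

/-- The short divisor sum `λ_R(n) = ∑_{r ≤ R} (μ(r)² / φ(r)) ∑_{d ∣ gcd(r, n)} d μ(d)` for `n ≥ 1`,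
and `λ_R(n) = 0` for `n ≤ 0`. Here `R` is real and `r` runs over the positive integers up to `R`. -/
noncomputable def lambdaR (R : ℝ) (n : ℤ) : ℝ :=
  if n ≤ 0 then 0
  else ∑ r ∈ Finset.Icc 1 ⌊R⌋₊, ((ArithmeticFunction.moebius r : ℝ) ^ 2 / (Nat.totient r : ℝ)) *
    ∑ d ∈ (Nat.gcd r n.toNat).divisors, (d : ℝ) * (ArithmeticFunction.moebius d : ℝ)

/-- The correlation `∑_{n = 1}^{N} ∏_i λ_R(n + j_i)^{a_i}`. -/
noncomputable def correlation (N : ℕ) (R : ℝ) {r : ℕ} (j : Fin r → ℤ) (a : Fin r → ℕ) : ℝ :=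
  ∑ n ∈ Finset.Icc 1 N, ∏ i, lambdaR R ((n : ℤ) + j i) ^ a i

/-- The number `ν_p(j)` of distinct residue classes modulo `p` occupied by the integers `j_i`. -/
def residueCount {r : ℕ} (j : Fin r → ℤ) (p : ℕ) : ℕ :=
  (Finset.univ.image fun i => (j i : ZMod p)).card

/-- The Euler factor `(1 - 1/p)^{-r} (1 - ν_p(j)/p)`. -/
noncomputable def singularFactor {r : ℕ} (j : Fin r → ℤ) (p : ℕ) : ℝ :=
  ((1 - 1 / (p : ℝ)) ^ r)⁻¹ * (1 - (residueCount j p : ℝ) / (p : ℝ))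

/-- The Hardy–Littlewood singular series `𝔖(j) = ∏_p (1 - 1/p)^{-r} (1 - ν_p(j)/p)`, the product
being over all primes (it converges for distinct `j_i`, see `multipliable_singularFactor`). -/
noncomputable def singularSeries {r : ℕ} (j : Fin r → ℤ) : ℝ :=
  ∏' p : Nat.Primes, singularFactor j (p : ℕ)

/-- The constants `C_k(a)`, `k = a_1 + ⋯ + a_r ≤ 3`; the value `0` at other lists is never used. -/
noncomputable def corrConst : List ℕ → ℝ
  | [1] => 1
  | [2] => 1
  | [1, 1] => 1
  | [3] => 3 / 4
  | [2, 1] => 1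
  | [1, 2] => 1
  | [1, 1, 1] => 1
  | _ => 0

theorem residueCount_eq_of_lt {r : ℕ} (j : Fin r → ℤ) (hj : Function.Injective j) (p : ℕ)
    (hp : ∑ i, ∑ l, (j i - j l).natAbs < p) : residueCount j p = r := by
  unfold residueCount
  rw [Finset.card_image_of_injective]
  · simp
  · intro x y hxy
    haveI : NeZero p := ⟨by omega⟩
    have h1 : (p : ℤ) ∣ j x - j y :=
      (ZMod.intCast_zmod_eq_zero_iff_dvd _ p).mp (by simpa [sub_eq_zero] using hxy)
    by_contra hne
    have h2 : j x - j y ≠ 0 := sub_ne_zero.mpr (fun h => hne (hj h))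
    have h3 : p ≤ (j x - j y).natAbs :=
      Nat.le_of_dvd (Int.natAbs_pos.mpr h2) (Int.natCast_dvd.mp h1)
    have h4 : (j x - j y).natAbs ≤ ∑ l, (j x - j l).natAbs :=
      Finset.single_le_sum (f := fun l => (j x - j l).natAbs) (fun _ _ => Nat.zero_le _)
        (Finset.mem_univ y)
    have h5 : ∑ l, (j x - j l).natAbs ≤ ∑ i, ∑ l, (j i - j l).natAbs :=
      Finset.single_le_sum (f := fun i => ∑ l, (j i - j l).natAbs) (fun _ _ => Nat.zero_le _)
        (Finset.mem_univ x)
    omega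

theorem one_sub_pow_bounds (x : ℝ) (h0 : 0 ≤ x) (h1 : x ≤ 1) (r : ℕ) :
    0 ≤ (1 - x) ^ r - (1 - r * x) ∧ (1 - x) ^ r - (1 - r * x) ≤ (r : ℝ) ^ 2 * x ^ 2 := by
  induction r with
  | zero => simp
  | succ r ih =>
    obtain ⟨ha, hb⟩ := ih
    have hr : (0 : ℝ) ≤ r := Nat.cast_nonneg r
    have hx2 : 0 ≤ (r : ℝ) * x ^ 2 := by positivity
    have e : (1 - x) ^ (r + 1) - (1 - ((r + 1 : ℕ) : ℝ) * x)
        = (1 - x) * ((1 - x) ^ r - (1 - r * x)) + r * x ^ 2 := by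
      push_cast; ring
    rw [e]
    constructor
    · have := mul_nonneg (sub_nonneg.mpr h1) ha
      linarith
    · have h2 : (1 - x) * ((1 - x) ^ r - (1 - r * x)) ≤ 1 * ((1 - x) ^ r - (1 - r * x)) :=
        mul_le_mul_of_nonneg_right (by linarith) ha
      push_cast
      nlinarith [sq_nonneg x]

/-- The product defining the singular series converges when the `j_i` are distinct. -/
theorem multipliable_singularFactor {r : ℕ} (j : Fin r → ℤ) (hj : Function.Injective j) :
    Multipliable fun p : Nat.Primes => singularFactor j (p : ℕ) := by
  have hs : Summable fun p : Nat.Primes => singularFactor j (p : ℕ) - 1 := by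
    have hsum : Summable fun p : Nat.Primes => (2 : ℝ) ^ r * (r : ℝ) ^ 2 * (1 / ((p : ℕ) : ℝ) ^ 2) :=
      ((Real.summable_one_div_nat_pow.mpr (by norm_num : 1 < 2)).comp_injective
        Nat.Primes.coe_nat_injective).mul_left _
    refine Summable.of_norm_bounded_eventually hsum ?_
    have hfin : {p : Nat.Primes | (p : ℕ) ≤ ∑ i, ∑ l, (j i - j l).natAbs}.Finite :=
      (Set.finite_Iic (∑ i, ∑ l, (j i - j l).natAbs)).preimage
        Nat.Primes.coe_nat_injective.injOn
    filter_upwards [hfin.compl_mem_cofinite] with p hp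
    have hlt : ∑ i, ∑ l, (j i - j l).natAbs < (p : ℕ) := by simpa using hp
    have hp2 : (2 : ℝ) ≤ ((p : ℕ) : ℝ) := by exact_mod_cast p.2.two_le
    unfold singularFactor
    rw [residueCount_eq_of_lt j hj p hlt]
    have hx0 : 0 ≤ 1 / ((p : ℕ) : ℝ) := by positivity
    have hx1 : 1 / ((p : ℕ) : ℝ) ≤ 1 / 2 := one_div_le_one_div_of_le (by norm_num) hp2
    have hsq : 1 / ((p : ℕ) : ℝ) ^ 2 = (1 / ((p : ℕ) : ℝ)) ^ 2 := by rw [one_div_pow]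
    rw [hsq, div_eq_mul_one_div (r : ℝ)]
    generalize 1 / ((p : ℕ) : ℝ) = x at hx0 hx1
    obtain ⟨ha, hb⟩ := one_sub_pow_bounds x hx0 (by linarith) r
    have hhalf : ((1 : ℝ) / 2) ^ r ≤ (1 - x) ^ r :=
      pow_le_pow_left₀ (by norm_num) (by linarith) r
    have hpos : 0 < (1 - x) ^ r := lt_of_lt_of_le (by positivity) hhalf
    have hinv : ((1 - x) ^ r)⁻¹ ≤ 2 ^ r := by
      calc ((1 - x) ^ r)⁻¹ ≤ (((1 : ℝ) / 2) ^ r)⁻¹ := inv_anti₀ (by positivity) hhalf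
        _ = 2 ^ r := by simp
    have e : ((1 - x) ^ r)⁻¹ * (1 - r * x) - 1
        = -(((1 - x) ^ r)⁻¹ * ((1 - x) ^ r - (1 - r * x))) := by
      field_simp; ring
    rw [e, norm_neg, Real.norm_of_nonneg (mul_nonneg (inv_nonneg.mpr hpos.le) ha), mul_assoc]
    exact mul_le_mul hinv hb ha (by positivity)
  simpa using Real.multipliable_one_add_of_summable hs

/-!
The truncated sum is an operator product over primes. With `g(p, n) = -1` if `p ∣ n` and
`g(p, n) = 1 / (p - 1)` otherwise, `λ_R(n)` is the sum of `∏_{p ∣ r} g(p, n)` over squarefree `r ≤ R`,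
that is, `∏_p (1 + g(p, n) S_p)` applied to the indicator of `[1, ∞)`, where `(S_p f)(X) = f(X / p)`
(`lambdaR_eq_primeIter`). Since `g(p, ·)` has mean zero modulo `p` and residues modulo different
primes are independent, the mean over `n` of a product of three such sums with the shifts
`j₁, j₂, j₃` is the product over `p` of the operators
`1 + c₁₂ S₁₂ + c₁₃ S₁₃ + c₂₃ S₂₃ + c₁₂₃ S₁₂₃`, applied to the indicator of `[1, ∞)³` (`corrIter`).
Shorter correlations are the case in which some factors are inactive. Because
`λ_R(n) = ∑_{d ≤ R} c(d) [d ∣ n]` with `∑ |c(d)| = O(R)`, replacing the sum over an interval by this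
mean costs `O(R^k)` (`exists_abs_sum_activeLambda_sub_le`). It remains to evaluate the mean.

* Distinct shifts (`k = r`): the coefficients are `O(1 / p²)` for all primes not dividing the
  differences of the shifts, so the truncation can be removed with a loss of `O(D^η R^{-1/2})`, `D`
  being the product of these differences. What is left is the Euler product
  (`exists_abs_corrIter_sub_singularSeries_le`).
* One repeated shift: `c₁₂ = 1 / (p - 1)` is not summable and produces the divisor sum
  `∑_{r ≤ X, (r, q) = 1} μ(r)² / φ(r) = (φ(q) / q) (log X + ⋯)`. Pulling it out changes the remaining
  coefficients by the factor `1 - 1 / p`, which turns the Euler product into the singular series of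
  the two shifts (`exists_abs_corrIter_sub_singularSeries_mul_log_le`).
* Three equal shifts: the operator is compared with
  `(1 - S₁₂₃ / p) ∏_{i < l} (1 - S_{il} / p)⁻¹`, from which it differs by `O(1 / p²)` without a change
  of the main term. The product of the model operators is a sum over all integers,
  `∑ μ(d) / (d e₁ e₂ e₃)` over `d e₁ e₂, d e₁ e₃, d e₂ e₃ ≤ R`. The sum over the `e_i` without `d` is
  `(1/4) log³ R` to leading order, the volume of a polytope, and the Möbius sum over `d` acts as a
  derivative in `log R`, whence the constant `3 / 4` (`exists_abs_corrIter_equalShifts_sub_le`).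

Finally, the terms of the correlation that vanish because an argument is not positive are at most
`max |j_i| ≤ N^{1-ε}` in number, and `𝔖(j) = O(N^{ε/2})` shows that they do not matter
(`HasLambdaMean.abs_correlation_sub_le`).
-/

/-! ### Sums over squarefree integers, one prime at a time -/

/-- The product of the primes below `Z`. -/
def primeProd (Z : ℕ) : ℕ := ∏ p ∈ (Finset.range Z).filter Nat.Prime, p

theorem primeProd_succ_of_prime {p : ℕ} (hp : p.Prime) : primeProd (p + 1) = p * primeProd p := by
  unfold primeProd
  rw [Finset.range_add_one, Finset.filter_insert, if_pos hp, Finset.prod_insert (by simp)]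

theorem primeProd_succ_of_not_prime {n : ℕ} (hn : ¬ n.Prime) :
    primeProd (n + 1) = primeProd n := by
  unfold primeProd
  rw [Finset.range_add_one, Finset.filter_insert, if_neg hn]

theorem primeProd_zero : primeProd 0 = 1 := by simp [primeProd]

theorem primeProd_pos (Z : ℕ) : 0 < primeProd Z :=
  Finset.prod_pos fun _ hp => (Finset.mem_filter.mp hp).2.pos

theorem dvd_primeProd {p Z : ℕ} (hp : p.Prime) (hpZ : p < Z) : p ∣ primeProd Z :=
  Finset.dvd_prod_of_mem (fun p => p) (Finset.mem_filter.mpr ⟨Finset.mem_range.mpr hpZ, hp⟩)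

theorem coprime_primeProd {p Z : ℕ} (hp : p.Prime) (hpZ : Z ≤ p) : Nat.Coprime p (primeProd Z) := by
  unfold primeProd
  refine Nat.Coprime.prod_right fun q hq => ?_
  obtain ⟨h1, h2⟩ := Finset.mem_filter.mp hq
  exact (Nat.coprime_primes hp h2).mpr (by have := Finset.mem_range.mp h1; omega)

theorem eq_one_of_coprime_primeProd {n Z : ℕ} (hn : 0 < n) (hnZ : n < Z)
    (h : Nat.Coprime n (primeProd Z)) : n = 1 := by
  by_contra hne
  have hp := Nat.minFac_prime hne
  have h1 : n.minFac ∣ primeProd Z :=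
    dvd_primeProd hp (lt_of_le_of_lt (Nat.minFac_le hn) hnZ)
  exact Nat.Prime.not_dvd_one hp (h ▸ Nat.dvd_gcd (Nat.minFac_dvd n) h1)

/-- The indicator function of `[1, ∞)`. -/
noncomputable def geOne (X : ℝ) : ℝ := if 1 ≤ X then 1 else 0

/-- The sum of the multiplicative function with value `h p` at primes `p`, over the squarefree
integers up to `X` that are coprime to `q`. -/
noncomputable def sqfreeSum (h : ℕ → ℝ) (q : ℕ) (X : ℝ) : ℝ :=
  ∑ m ∈ (Finset.Icc 1 ⌊X⌋₊).filter (fun m => Squarefree m ∧ Nat.Coprime m q),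
    ∏ p ∈ m.primeFactors, h p

/-- The sum of `b n` over the integers `n ≤ X` coprime to `q`. -/
noncomputable def coprimeSum (b : ℕ → ℝ) (q : ℕ) (X : ℝ) : ℝ :=
  ∑ n ∈ (Finset.Icc 1 ⌊X⌋₊).filter (fun n => Nat.Coprime n q), b n

theorem sqfreeSum_split (h : ℕ → ℝ) {p q : ℕ} (hp : p.Prime) (hpq : Nat.Coprime p q) (X : ℝ) :
    sqfreeSum h q X = sqfreeSum h (p * q) X + h p * sqfreeSum h (p * q) (X / p) := by
  unfold sqfreeSum
  rw [← Finset.sum_filter_not_add_sum_filter _ (fun m => p ∣ m), Finset.filter_filter,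
    Finset.filter_filter, Finset.mul_sum]
  congr 1
  · refine Finset.sum_congr (Finset.filter_congr fun m _ => ?_) fun _ _ => rfl
    rw [Nat.coprime_mul_iff_right, Nat.coprime_comm (n := m) (m := p), hp.coprime_iff_not_dvd]
    tauto
  · symm
    refine Finset.sum_nbij' (fun m => p * m) (fun m => m / p) ?_ ?_ ?_ ?_ ?_
    · intro m hm
      simp only [Finset.mem_filter, Finset.mem_Icc] at hm ⊢
      obtain ⟨⟨h1, h2⟩, h3, h4⟩ := hm
      rw [Nat.coprime_mul_iff_right] at h4
      rw [Nat.floor_div_natCast, Nat.le_div_iff_mul_le hp.pos] at h2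
      refine ⟨⟨Nat.mul_pos hp.pos h1, by linarith⟩, ⟨?_, ?_⟩, dvd_mul_right _ _⟩
      · exact (Nat.squarefree_mul h4.1.symm).mpr ⟨hp.squarefree, h3⟩
      · exact Nat.Coprime.mul_left hpq h4.2
    · intro m hm
      simp only [Finset.mem_filter, Finset.mem_Icc] at hm ⊢
      obtain ⟨⟨h1, h2⟩, ⟨h3, h4⟩, k, rfl⟩ := hm
      rw [Nat.mul_div_cancel_left _ hp.pos]
      have hk : Nat.Coprime p k := Nat.coprime_of_squarefree_mul h3
      refine ⟨⟨Nat.pos_of_ne_zero (by rintro rfl; simp at h1), ?_⟩, ?_, ?_⟩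
      · rw [Nat.floor_div_natCast, Nat.le_div_iff_mul_le hp.pos]; linarith
      · exact h3.of_mul_right
      · exact Nat.Coprime.mul_right hk.symm (Nat.Coprime.coprime_mul_left h4)
    · intro m _
      exact Nat.mul_div_cancel_left _ hp.pos
    · intro m hm
      exact Nat.mul_div_cancel' (Finset.mem_filter.mp hm).2.2
    · intro m hm
      simp only [Finset.mem_filter, Finset.mem_Icc] at hm
      obtain ⟨⟨h1, h2⟩, h3, h4⟩ := hm
      rw [Nat.coprime_mul_iff_right] at h4
      rw [Nat.Coprime.primeFactors_mul h4.1.symm, hp.primeFactors, Finset.prod_union,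
        Finset.prod_singleton]
      rw [Finset.disjoint_singleton_left]
      intro hmem
      exact (hp.coprime_iff_not_dvd.mp h4.1.symm) (Nat.dvd_of_mem_primeFactors hmem)

theorem sum_coprime_split (F : ℕ → ℝ) {p q : ℕ} (hp : p.Prime) (hpq : Nat.Coprime p q) (N : ℕ) :
    ∑ n ∈ (Finset.Icc 1 N).filter (fun n => Nat.Coprime n q), F n
      = ∑ n ∈ (Finset.Icc 1 N).filter (fun n => Nat.Coprime n (p * q)), F n
        + ∑ m ∈ (Finset.Icc 1 (N / p)).filter (fun m => Nat.Coprime m q), F (p * m) := by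
  rw [← Finset.sum_filter_not_add_sum_filter _ (fun m => p ∣ m), Finset.filter_filter,
    Finset.filter_filter]
  congr 1
  · refine Finset.sum_congr (Finset.filter_congr fun m _ => ?_) fun _ _ => rfl
    rw [Nat.coprime_mul_iff_right, Nat.coprime_comm (n := m) (m := p), hp.coprime_iff_not_dvd]
    tauto
  · symm
    refine Finset.sum_nbij' (fun m => p * m) (fun m => m / p) ?_ ?_ ?_ ?_ ?_
    · intro m hm
      simp only [Finset.mem_filter, Finset.mem_Icc] at hm ⊢
      obtain ⟨⟨h1, h2⟩, h4⟩ := hm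
      rw [Nat.le_div_iff_mul_le hp.pos] at h2
      exact ⟨⟨Nat.mul_pos hp.pos h1, by linarith⟩, Nat.Coprime.mul_left hpq h4, dvd_mul_right _ _⟩
    · intro m hm
      simp only [Finset.mem_filter, Finset.mem_Icc] at hm ⊢
      obtain ⟨⟨h1, h2⟩, h4, k, rfl⟩ := hm
      rw [Nat.mul_div_cancel_left _ hp.pos]
      refine ⟨⟨Nat.pos_of_ne_zero (by rintro rfl; simp at h1), ?_⟩,
        Nat.Coprime.coprime_mul_left h4⟩
      rw [Nat.le_div_iff_mul_le hp.pos]; linarith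
    · intro m _
      exact Nat.mul_div_cancel_left _ hp.pos
    · intro m hm
      exact Nat.mul_div_cancel' (Finset.mem_filter.mp hm).2.2
    · intro m hm
      rfl

theorem coprimeSum_split {b : ℕ → ℝ} (hb : ∀ m n, b (m * n) = b m * b n) {p q : ℕ}
    (hp : p.Prime) (hpq : Nat.Coprime p q) (X : ℝ) :
    coprimeSum b q X = coprimeSum b (p * q) X + b p * coprimeSum b q (X / p) := by
  unfold coprimeSum
  rw [sum_coprime_split b hp hpq, Finset.mul_sum, Nat.floor_div_natCast]
  simp only [hb]

theorem sqfreeSum_primeProd (h : ℕ → ℝ) (Z q : ℕ) {X : ℝ} (hX : X < Z) :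
    sqfreeSum h (primeProd Z * q) X = geOne X := by
  unfold sqfreeSum geOne
  split_ifs with h1
  · rw [Finset.sum_eq_single 1]
    · simp
    · intro m hm hne
      simp only [Finset.mem_filter, Finset.mem_Icc] at hm
      refine absurd (eq_one_of_coprime_primeProd (Z := Z) (by omega) ?_
        (Nat.Coprime.coprime_mul_right_right hm.2.2)) hne
      exact lt_of_le_of_lt hm.1.2 ((Nat.floor_lt (by linarith)).mpr hX)
    · intro hnot
      exact absurd (by simpa using h1) hnot
  · rw [Nat.floor_eq_zero.mpr (not_le.mp h1)]
    simp

theorem coprimeSum_primeProd {b : ℕ → ℝ} (hb : b 1 = 1) (Z : ℕ) {X : ℝ} (hX : X < Z) :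
    coprimeSum b (primeProd Z) X = geOne X := by
  unfold coprimeSum geOne
  split_ifs with h1
  · rw [Finset.sum_eq_single 1]
    · simpa using hb
    · intro m hm hne
      simp only [Finset.mem_filter, Finset.mem_Icc] at hm
      refine absurd (eq_one_of_coprime_primeProd (Z := Z) (by omega) ?_ hm.2) hne
      exact lt_of_le_of_lt hm.1.2 ((Nat.floor_lt (by linarith)).mpr hX)
    · intro hnot
      exact absurd (by simpa using h1) hnot
  · rw [Nat.floor_eq_zero.mpr (not_le.mp h1)]
    simp

/-- The operator `∏_{p < Z} (1 + h(p) S_p)` applied to `f`, where `(S_p f)(X) = f(X / p)`. The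
product runs over all integers below `Z`; in the applications `h` vanishes off the primes. -/
noncomputable def primeIter (h : ℕ → ℝ) : ℕ → (ℝ → ℝ) → ℝ → ℝ
  | 0, f => f
  | Z + 1, f => fun X => primeIter h Z f X + h Z * primeIter h Z f (X / Z)

theorem primeIter_shift (h : ℕ → ℝ) (Z : ℕ) (f : ℝ → ℝ) (u X : ℝ) :
    primeIter h Z (fun Y => f (Y / u)) X = primeIter h Z f (X / u) := by
  induction Z generalizing X with
  | zero => rfl
  | succ Z ih => simp only [primeIter, ih, div_right_comm]

theorem primeIter_add (h : ℕ → ℝ) (Z : ℕ) (f g : ℝ → ℝ) (c X : ℝ) :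
    primeIter h Z (fun Y => f Y + c * g Y) X
      = primeIter h Z f X + c * primeIter h Z g X := by
  induction Z generalizing X with
  | zero => rfl
  | succ Z ih => simp only [primeIter, ih]; ring

theorem primeIter_congr {h : ℕ → ℝ} (h0 : h 0 = 0) (Z : ℕ) {f g : ℝ → ℝ} {X : ℝ} (hX : 0 ≤ X)
    (hfg : ∀ Y, 0 ≤ Y → Y ≤ X → f Y = g Y) : primeIter h Z f X = primeIter h Z g X := by
  induction Z generalizing X with
  | zero => exact hfg X hX le_rfl
  | succ Z ih =>
    simp only [primeIter]
    rw [ih hX hfg]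
    rcases Nat.eq_zero_or_pos Z with rfl | hZ
    · simp [h0]
    · have h1 : X / Z ≤ X := div_le_self hX (by exact_mod_cast hZ)
      rw [ih (by positivity) fun Y h2 h3 => hfg Y h2 (h3.trans h1)]

/-- Adjoining the primes below `Z` to a sum over squarefree integers coprime to them. -/
theorem primeIter_sqfreeSum {h : ℕ → ℝ} (hh : ∀ n, ¬ n.Prime → h n = 0) (Z : ℕ) (q : ℕ)
    (hq : Nat.Coprime (primeProd Z) q) (X : ℝ) :
    primeIter h Z (sqfreeSum h (primeProd Z * q)) X = sqfreeSum h q X := by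
  induction Z generalizing X q with
  | zero => simp [primeIter, primeProd_zero]
  | succ Z ih =>
    simp only [primeIter]
    by_cases hZ : Z.Prime
    · rw [primeProd_succ_of_prime hZ] at hq ⊢
      have e : Z * primeProd Z * q = primeProd Z * (Z * q) := by ring
      rw [Nat.coprime_mul_iff_left] at hq
      rw [e, ih _ (Nat.Coprime.mul_right (coprime_primeProd hZ le_rfl).symm hq.2),
        ih _ (Nat.Coprime.mul_right (coprime_primeProd hZ le_rfl).symm hq.2),
        ← sqfreeSum_split h hZ hq.1]
    · rw [primeProd_succ_of_not_prime hZ] at hq ⊢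
      rw [hh Z hZ, ih q hq]
      ring

theorem primeIter_geOne {h : ℕ → ℝ} (hh : ∀ n, ¬ n.Prime → h n = 0) {Z : ℕ} {X : ℝ} (hX : 0 ≤ X)
    (hXZ : X < Z) : primeIter h Z geOne X = sqfreeSum h 1 X := by
  rw [← primeIter_sqfreeSum hh Z 1 (Nat.coprime_one_right _)]
  exact primeIter_congr (hh 0 Nat.not_prime_zero) Z hX fun Y _ h2 =>
    (sqfreeSum_primeProd h Z 1 (lt_of_le_of_lt h2 hXZ)).symm

/-- The function interpolating between the sum of a completely multiplicative function `b` (at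
`Z = 0`) and the sum of a multiplicative function over squarefree integers (for `Z > X`): the primes
below `Z` carry the weight `h`, the others the weight `b`. -/
noncomputable def hybridSum (h b : ℕ → ℝ) (Z : ℕ) (X : ℝ) : ℝ :=
  primeIter h Z (coprimeSum b (primeProd Z)) X

theorem hybridSum_succ {h b : ℕ → ℝ} (hb : ∀ m n, b (m * n) = b m * b n) {p : ℕ}
    (hp : p.Prime) (X : ℝ) :
    hybridSum h b (p + 1) X = hybridSum h b p X + (h p - b p) * hybridSum h b p (X / p)
      - h p * b p * hybridSum h b p (X / p / p) := by
  have key : ∀ Y, primeIter h p (coprimeSum b (p * primeProd p)) Y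
      = hybridSum h b p Y - b p * hybridSum h b p (Y / p) := by
    intro Y
    have e : coprimeSum b (p * primeProd p) = fun Y => coprimeSum b (primeProd p) Y
        + (-b p) * (fun W => coprimeSum b (primeProd p) (W / p)) Y := by
      funext W
      rw [coprimeSum_split hb hp (coprime_primeProd hp le_rfl) W]
      ring
    rw [e, primeIter_add, primeIter_shift]
    unfold hybridSum
    ring
  have : hybridSum h b (p + 1) X = primeIter h p (coprimeSum b (p * primeProd p)) X
      + h p * primeIter h p (coprimeSum b (p * primeProd p)) (X / p) := by
    unfold hybridSum
    rw [primeProd_succ_of_prime hp]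
    rfl
  rw [this, key, key]
  ring

theorem hybridSum_succ_of_not_prime {h b : ℕ → ℝ} (hh : ∀ n, ¬ n.Prime → h n = 0) {n : ℕ}
    (hn : ¬ n.Prime) (X : ℝ) : hybridSum h b (n + 1) X = hybridSum h b n X := by
  unfold hybridSum
  rw [primeProd_succ_of_not_prime hn]
  simp [primeIter, hh n hn]

theorem hybridSum_eq_sqfreeSum {h b : ℕ → ℝ} (hh : ∀ n, ¬ n.Prime → h n = 0) (hb : b 1 = 1)
    {Z : ℕ} {X : ℝ} (hX : 0 ≤ X) (hXZ : X < Z) : hybridSum h b Z X = sqfreeSum h 1 X := by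
  rw [← primeIter_geOne hh hX hXZ]
  exact primeIter_congr (hh 0 Nat.not_prime_zero) Z hX fun Y _ h2 =>
    coprimeSum_primeProd hb Z (lt_of_le_of_lt h2 hXZ)

/-! ### Sums of multiplicative functions over squarefree integers -/

/-- The summable majorant `n^{-3/2}` for the Euler factors that occur below. -/
noncomputable def threeHalves (n : ℕ) : ℝ := (n : ℝ) ^ (-(3 / 2) : ℝ)

theorem threeHalves_nonneg (n : ℕ) : 0 ≤ threeHalves n := Real.rpow_nonneg (Nat.cast_nonneg n) _

theorem summable_threeHalves : Summable threeHalves :=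
  Real.summable_nat_rpow.mpr (by norm_num)

theorem prod_one_add_le_exp_sum {ι : Type*} (s : Finset ι) (f : ι → ℝ) (hf : ∀ i ∈ s, 0 ≤ f i) :
    ∏ i ∈ s, (1 + f i) ≤ Real.exp (∑ i ∈ s, f i) := by
  rw [Real.exp_sum]
  refine Finset.prod_le_prod (fun i hi => by linarith [hf i hi]) fun i _ => ?_
  linarith [Real.add_one_le_exp (f i)]

/-- The partial products of `∏ (1 + C n^{-3/2})` are bounded. -/
theorem exists_prod_threeHalves_le {C : ℝ} (hC : 0 ≤ C) :
    ∃ K : ℝ, 1 ≤ K ∧ ∀ Z : ℕ, ∏ n ∈ Finset.range Z, (1 + C * threeHalves n) ≤ K := by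
  have hn : ∀ n, 0 ≤ C * threeHalves n := fun n => mul_nonneg hC (threeHalves_nonneg n)
  refine ⟨Real.exp (∑' n, C * threeHalves n), Real.one_le_exp (tsum_nonneg hn), fun Z => ?_⟩
  refine (prod_one_add_le_exp_sum _ _ fun n _ => hn n).trans (Real.exp_le_exp.mpr ?_)
  exact (summable_threeHalves.mul_left C).sum_le_tsum _ fun n _ => hn n

theorem one_div_sq_le_threeHalves {p : ℝ} (hp : 1 ≤ p) {δ : ℝ} (hδ : δ ≤ 1 / 2) :
    p ^ δ / p ^ 2 ≤ p ^ (-(3 / 2) : ℝ) := by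
  have h0 : 0 < p := by linarith
  rw [← Real.rpow_natCast p 2, ← Real.rpow_sub h0]
  exact Real.rpow_le_rpow_of_exponent_le hp (by push_cast; linarith)

/-- The function `p ↦ 1 / (p - 1) = 1 / φ(p)` on the primes, extended by zero. -/
noncomputable def phiInv (p : ℕ) : ℝ := if p.Prime then 1 / ((p : ℝ) - 1) else 0

/-- The function `p ↦ (p + 1) / (p - 1) = σ(p) / φ(p)` on the primes, extended by zero. -/
noncomputable def sigmaPhi (p : ℕ) : ℝ := if p.Prime then ((p : ℝ) + 1) / ((p : ℝ) - 1) else 0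

theorem phiInv_of_not_prime (n : ℕ) (hn : ¬ n.Prime) : phiInv n = 0 := if_neg hn

theorem sigmaPhi_of_not_prime (n : ℕ) (hn : ¬ n.Prime) : sigmaPhi n = 0 := if_neg hn

theorem phiInv_nonneg (n : ℕ) : 0 ≤ phiInv n := by
  unfold phiInv
  split_ifs with h
  · have : (1 : ℝ) ≤ n := by exact_mod_cast h.one_le
    exact div_nonneg zero_le_one (by linarith)
  · exact le_rfl

theorem coprimeSum_one_le (X : ℝ) (hX : 0 ≤ X) : |coprimeSum (fun _ => 1) 1 X| ≤ X := by
  unfold coprimeSum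
  simp only [Nat.coprime_one_right_eq_true, Finset.filter_true, Finset.sum_const, Nat.card_Icc,
    Nat.add_sub_cancel, nsmul_eq_mul, mul_one]
  rw [abs_of_nonneg (Nat.cast_nonneg _)]
  exact Nat.floor_le hX

/-- The mean value of `σ(r) / φ(r)` over squarefree `r` is bounded. -/
theorem exists_sqfreeSum_sigmaPhi_le :
    ∃ K : ℝ, 1 ≤ K ∧ ∀ X : ℝ, 0 ≤ X → |sqfreeSum sigmaPhi 1 X| ≤ K * X := by
  obtain ⟨K, hK1, hK⟩ := exists_prod_threeHalves_le (C := 10) (by norm_num)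
  refine ⟨K, hK1, fun X hX => ?_⟩
  -- Changing the weight of the prime `p` from `1` to `sigmaPhi p = 1 + O(1/p)`, while also removing
  -- its higher powers, multiplies the bound by `1 + O(1/p²)`.
  have main : ∀ Z : ℕ, ∀ X : ℝ, 0 ≤ X → |hybridSum sigmaPhi (fun _ => 1) Z X|
      ≤ (∏ n ∈ Finset.range Z, (1 + 10 * threeHalves n)) * X := by
    intro Z
    induction Z with
    | zero =>
      intro X hX
      simpa [hybridSum, primeIter, primeProd_zero] using coprimeSum_one_le X hX
    | succ Z ih =>
      intro X hX
      set B := ∏ n ∈ Finset.range Z, (1 + 10 * threeHalves n) with hB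
      have hB0 : 0 ≤ B := Finset.prod_nonneg fun n _ => by
        have := threeHalves_nonneg n; positivity
      rw [Finset.prod_range_succ, ← hB]
      by_cases hZ : Z.Prime
      · rw [hybridSum_succ (by simp) hZ]
        have hp2 : (2 : ℝ) ≤ Z := by exact_mod_cast hZ.two_le
        have hp0 : (0 : ℝ) < Z := by linarith
        have h1 := ih X hX
        have h2 := ih (X / Z) (by positivity)
        have h3 := ih (X / Z / Z) (by positivity)
        have hs : sigmaPhi Z = ((Z : ℝ) + 1) / ((Z : ℝ) - 1) := if_pos hZ
        have hd : sigmaPhi Z - 1 = 2 / ((Z : ℝ) - 1) := by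
          rw [hs]; field_simp [show (Z : ℝ) - 1 ≠ 0 by linarith]; ring
        have hq : (0 : ℝ) < (Z : ℝ) - 1 := by linarith
        have hs0 : 0 ≤ sigmaPhi Z := by rw [hs]; positivity
        have hd0 : 0 ≤ sigmaPhi Z - 1 := by rw [hd]; positivity
        have e1 : |(sigmaPhi Z - 1) * hybridSum sigmaPhi (fun _ => 1) Z (X / Z)|
            ≤ (4 / (Z : ℝ) ^ 2) * (B * X) := by
          rw [abs_mul, abs_of_nonneg hd0, hd]
          calc 2 / ((Z : ℝ) - 1) * |hybridSum sigmaPhi (fun _ => 1) Z (X / Z)|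
              ≤ 4 / (Z : ℝ) * (B * (X / Z)) := by
                refine mul_le_mul ?_ h2 (abs_nonneg _) (by positivity)
                rw [div_le_div_iff₀ hq hp0]; linarith
            _ = _ := by field_simp
        have e2 : |sigmaPhi Z * 1 * hybridSum sigmaPhi (fun _ => 1) Z (X / Z / Z)|
            ≤ (6 / (Z : ℝ) ^ 2) * (B * X) := by
          rw [mul_one, abs_mul, abs_of_nonneg hs0, hs]
          calc ((Z : ℝ) + 1) / ((Z : ℝ) - 1) * |hybridSum sigmaPhi (fun _ => 1) Z (X / Z / Z)|
              ≤ 6 * (B * (X / Z / Z)) := by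
                refine mul_le_mul ?_ h3 (abs_nonneg _) (by positivity)
                rw [div_le_iff₀ hq]; linarith
            _ = _ := by field_simp
        have e3 := one_div_sq_le_threeHalves (p := Z) (by linarith) (δ := 0) (by norm_num)
        rw [Real.rpow_zero] at e3
        have e4 : (4 / (Z : ℝ) ^ 2) * (B * X) + (6 / (Z : ℝ) ^ 2) * (B * X)
            ≤ 10 * threeHalves Z * (B * X) := by
          rw [← add_mul]
          refine mul_le_mul_of_nonneg_right ?_ (by positivity)
          unfold threeHalves
          have : 4 / (Z : ℝ) ^ 2 + 6 / (Z : ℝ) ^ 2 = 10 * (1 / (Z : ℝ) ^ 2) := by ring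
          rw [this]
          linarith
        refine (abs_sub _ _).trans ?_
        have e5 := abs_add_le (hybridSum sigmaPhi (fun _ => 1) Z X)
          ((sigmaPhi Z - 1) * hybridSum sigmaPhi (fun _ => 1) Z (X / Z))
        have e6 : B * (1 + 10 * threeHalves Z) * X = B * X + 10 * threeHalves Z * (B * X) := by
          ring
        linarith
      · rw [hybridSum_succ_of_not_prime sigmaPhi_of_not_prime hZ]
        have h1 := ih X hX
        have h2 : 0 ≤ B * (10 * threeHalves Z) * X := by
          have := threeHalves_nonneg Z; positivity
        linarith [h2]
  have h1 := main (⌊X⌋₊ + 1) X hX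
  rw [hybridSum_eq_sqfreeSum sigmaPhi_of_not_prime rfl hX
    (by push_cast; exact Nat.lt_floor_add_one X)] at h1
  exact h1.trans (mul_le_mul_of_nonneg_right (hK _) hX)

/-- The harmonic sum `∑_{n ≤ X} 1 / n` with a real cutoff. -/
noncomputable def harmonicSum (X : ℝ) : ℝ := ∑ n ∈ Finset.Icc 1 ⌊X⌋₊, (1 / (n : ℝ))

theorem harmonicSum_eq (X : ℝ) : harmonicSum X = (harmonic ⌊X⌋₊ : ℝ) := by
  rw [harmonic_eq_sum_Icc]
  unfold harmonicSum
  push_cast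
  simp

theorem log_le_harmonicSum {X : ℝ} (hX : 0 ≤ X) : Real.log X ≤ harmonicSum X := by
  rw [harmonicSum_eq]; exact log_le_harmonic_floor X hX

theorem harmonicSum_le {X : ℝ} (hX : 1 ≤ X) : harmonicSum X ≤ 1 + Real.log X := by
  rw [harmonicSum_eq]; exact harmonic_floor_le_one_add_log X hX

theorem harmonicSum_of_lt_one {X : ℝ} (hX : X < 1) : harmonicSum X = 0 := by
  unfold harmonicSum
  rw [Nat.floor_eq_zero.mpr hX]; simp

theorem harmonicSum_nonneg (X : ℝ) : 0 ≤ harmonicSum X :=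
  Finset.sum_nonneg fun _ _ => by positivity

theorem coprimeSum_one_div (X : ℝ) :
    coprimeSum (fun n => 1 / (n : ℝ)) 1 X = harmonicSum X := by
  simp [coprimeSum, harmonicSum]

theorem abs_harmonicSum_sub_log_le {R x : ℝ} (hR : 1 ≤ R) (hx : 1 ≤ x) :
    |harmonicSum (R / x) - Real.log R| ≤ 1 + Real.log x := by
  have hlx := Real.log_nonneg hx
  have hlR := Real.log_nonneg hR
  have hlog : Real.log (R / x) = Real.log R - Real.log x :=
    Real.log_div (by linarith) (by linarith)
  rcases lt_or_ge (R / x) 1 with h | h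
  · rw [harmonicSum_of_lt_one h, zero_sub, abs_neg, abs_of_nonneg hlR]
    have : R ≤ x := by
      rw [div_lt_one (by linarith)] at h; exact h.le
    linarith [Real.log_le_log (by linarith) this]
  · have h1 := log_le_harmonicSum (X := R / x) (by linarith)
    have h2 := harmonicSum_le h
    rw [abs_le]; constructor <;> linarith

theorem one_add_log_le_rpow {x : ℝ} (hx : 1 ≤ x) {δ : ℝ} (hδ : 0 < δ) :
    1 + Real.log x ≤ (1 + 1 / δ) * x ^ δ := by
  have h1 : 1 ≤ x ^ δ := Real.one_le_rpow hx hδ.le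
  have h2 := Real.log_le_rpow_div (by linarith : 0 ≤ x) hδ
  have h3 : (1 + 1 / δ) * x ^ δ = x ^ δ + x ^ δ / δ := by ring
  linarith

/-- `∑_{r ≤ x} μ²(r) / φ(r) = log x + O(1)`. -/
theorem exists_sqfreeSum_phiInv_sub_log_le :
    ∃ C : ℝ, 0 ≤ C ∧ ∀ x : ℝ, 1 ≤ x → |sqfreeSum phiInv 1 x - Real.log x| ≤ C := by
  obtain ⟨K, hK1, hK⟩ := exists_prod_threeHalves_le (C := 4) (by norm_num)
  refine ⟨K * 5, by linarith, fun R hR => ?_⟩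
  -- The step at `p` appeals to the bound at `p x` and `p² x`. The growth `x ^ (1/4)` is affordable,
  -- because `p ^ (1/2) / p²` is summable.
  have main : ∀ Z : ℕ, ∀ x : ℝ, 1 ≤ x →
      |hybridSum phiInv (fun n => 1 / (n : ℝ)) Z (R / x) - Real.log R|
      ≤ (∏ n ∈ Finset.range Z, (1 + 4 * threeHalves n)) * (5 * x ^ (1 / 4 : ℝ)) := by
    intro Z
    induction Z with
    | zero =>
      intro x hx
      simp only [hybridSum, primeIter, primeProd_zero, Finset.range_zero, Finset.prod_empty,
        one_mul, coprimeSum_one_div]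
      refine (abs_harmonicSum_sub_log_le hR hx).trans ?_
      have := one_add_log_le_rpow hx (δ := 1 / 4) (by norm_num)
      norm_num at this ⊢
      exact this
    | succ Z ih =>
      intro x hx
      set B := ∏ n ∈ Finset.range Z, (1 + 4 * threeHalves n) with hB
      have hB0 : 0 ≤ B := Finset.prod_nonneg fun n _ => by
        have := threeHalves_nonneg n; positivity
      have hx0 : 0 ≤ x := by linarith
      rw [Finset.prod_range_succ, ← hB]
      by_cases hZ : Z.Prime
      · rw [hybridSum_succ (fun m n => by push_cast; field_simp) hZ]
        have hp2 : (2 : ℝ) ≤ Z := by exact_mod_cast hZ.two_le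
        have hp0 : (0 : ℝ) < Z := by linarith
        have hq : (0 : ℝ) < (Z : ℝ) - 1 := by linarith
        set T := hybridSum phiInv (fun n => 1 / (n : ℝ)) Z
        set ℓ := Real.log R
        have h1 := ih x hx
        have h2 := ih (Z * x) (by nlinarith)
        have h3 := ih (Z * (Z * x)) (by nlinarith [mul_le_mul hp2 hx zero_le_one hp0.le])
        have e0 : R / x / Z = R / (Z * x) := by rw [div_div, mul_comm]
        have e0' : R / (Z * x) / Z = R / (Z * (Z * x)) := by
          rw [div_div, mul_comm ((Z : ℝ) * x)]
        rw [e0, e0']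
        have hs : phiInv Z = 1 / ((Z : ℝ) - 1) := if_pos hZ
        have hc : phiInv Z - 1 / (Z : ℝ) = 1 / ((Z : ℝ) * ((Z : ℝ) - 1)) := by
          rw [hs]; field_simp; ring
        have hc' : phiInv Z * (1 / (Z : ℝ)) = 1 / ((Z : ℝ) * ((Z : ℝ) - 1)) := by
          rw [hs]; field_simp
        rw [hc, hc']
        set κ := 1 / ((Z : ℝ) * ((Z : ℝ) - 1)) with hκ
        have hκ0 : 0 ≤ κ := by positivity
        have hκ2 : κ ≤ 2 / (Z : ℝ) ^ 2 := by
          rw [hκ, div_le_div_iff₀ (by positivity) (by positivity)]; nlinarith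
        have hid : T (R / x) + κ * T (R / (Z * x)) - κ * T (R / (Z * (Z * x))) - ℓ
            = (T (R / x) - ℓ) + (κ * (T (R / (Z * x)) - ℓ)
              - κ * (T (R / (Z * (Z * x))) - ℓ)) := by ring
        rw [hid]
        rw [Real.mul_rpow hp0.le hx0] at h2
        rw [Real.mul_rpow hp0.le (by positivity), Real.mul_rpow hp0.le hx0] at h3
        have hz1 : (1 : ℝ) ≤ (Z : ℝ) ^ (1 / 4 : ℝ) := Real.one_le_rpow (by linarith) (by norm_num)
        have hzz : (Z : ℝ) ^ (1 / 4 : ℝ) * (Z : ℝ) ^ (1 / 4 : ℝ) = (Z : ℝ) ^ (1 / 2 : ℝ) := by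
          rw [← Real.rpow_add hp0]; norm_num
        have hx1 : (0 : ℝ) ≤ x ^ (1 / 4 : ℝ) := by positivity
        have h4 : κ * (Z : ℝ) ^ (1 / 2 : ℝ) ≤ 2 * threeHalves Z := by
          have := one_div_sq_le_threeHalves (p := Z) (by linarith) (δ := 1 / 2) (by norm_num)
          calc κ * (Z : ℝ) ^ (1 / 2 : ℝ) ≤ 2 / (Z : ℝ) ^ 2 * (Z : ℝ) ^ (1 / 2 : ℝ) :=
                mul_le_mul_of_nonneg_right hκ2 (by positivity)
            _ = 2 * ((Z : ℝ) ^ (1 / 2 : ℝ) / (Z : ℝ) ^ 2) := by ring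
            _ ≤ _ := by unfold threeHalves; linarith
        set W := B * (5 * x ^ (1 / 4 : ℝ)) with hW
        have hW0 : 0 ≤ W := by positivity
        have h5 : |κ * (T (R / (Z * (Z * x))) - ℓ)| ≤ 2 * threeHalves Z * W := by
          rw [abs_mul, abs_of_nonneg hκ0]
          calc κ * |T (R / (Z * (Z * x))) - ℓ|
              ≤ κ * (B * (5 * ((Z : ℝ) ^ (1 / 4 : ℝ) * ((Z : ℝ) ^ (1 / 4 : ℝ)
                * x ^ (1 / 4 : ℝ))))) := mul_le_mul_of_nonneg_left h3 hκ0
            _ = κ * ((Z : ℝ) ^ (1 / 4 : ℝ) * (Z : ℝ) ^ (1 / 4 : ℝ)) * W := by rw [hW]; ring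
            _ ≤ _ := by rw [hzz]; exact mul_le_mul_of_nonneg_right h4 hW0
        have h6 : |κ * (T (R / (Z * x)) - ℓ)| ≤ 2 * threeHalves Z * W := by
          rw [abs_mul, abs_of_nonneg hκ0]
          calc κ * |T (R / (Z * x)) - ℓ|
              ≤ κ * (B * (5 * ((Z : ℝ) ^ (1 / 4 : ℝ) * x ^ (1 / 4 : ℝ)))) :=
                mul_le_mul_of_nonneg_left h2 hκ0
            _ = κ * ((Z : ℝ) ^ (1 / 4 : ℝ) * 1) * W := by rw [hW]; ring
            _ ≤ κ * ((Z : ℝ) ^ (1 / 4 : ℝ) * (Z : ℝ) ^ (1 / 4 : ℝ)) * W := by gcongr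
            _ ≤ _ := by rw [hzz]; exact mul_le_mul_of_nonneg_right h4 hW0
        have h7 := abs_add_le (T (R / x) - ℓ) (κ * (T (R / (Z * x)) - ℓ)
              - κ * (T (R / (Z * (Z * x))) - ℓ))
        have h8 := abs_sub (κ * (T (R / (Z * x)) - ℓ)) (κ * (T (R / (Z * (Z * x))) - ℓ))
        have h9 : B * (1 + 4 * threeHalves Z) * (5 * x ^ (1 / 4 : ℝ))
            = W + 4 * threeHalves Z * W := by rw [hW]; ring
        rw [h9]
        linarith
      · rw [hybridSum_succ_of_not_prime phiInv_of_not_prime hZ]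
        have h1 := ih x hx
        have h2 : 0 ≤ B * (4 * threeHalves Z) * (5 * x ^ (1 / 4 : ℝ)) := by
          have := threeHalves_nonneg Z; positivity
        linarith [h2]
  have h1 := main (⌊R⌋₊ + 1) 1 le_rfl
  rw [div_one, hybridSum_eq_sqfreeSum phiInv_of_not_prime (by simp) (by linarith)
    (by push_cast; exact Nat.lt_floor_add_one R), Real.one_rpow, mul_one] at h1
  exact h1.trans (mul_le_mul_of_nonneg_right (hK _) (by norm_num))

theorem sqfreeSum_mono {h : ℕ → ℝ} (hh : ∀ n, 0 ≤ h n) (q : ℕ) : Monotone (sqfreeSum h q) := by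
  intro X Y hXY
  unfold sqfreeSum
  refine Finset.sum_le_sum_of_subset_of_nonneg (Finset.filter_subset_filter _
    (Finset.Icc_subset_Icc_right (Nat.floor_mono hXY))) fun m _ _ => ?_
  exact Finset.prod_nonneg fun p _ => hh p

/-- The density `φ(q) / q`. -/
noncomputable def phiRatio (q : ℕ) : ℝ := (Nat.totient q : ℝ) / q

theorem phiRatio_pos {q : ℕ} (hq : 0 < q) : 0 < phiRatio q := by
  unfold phiRatio
  have := Nat.totient_pos.mpr hq
  positivity

theorem phiRatio_prime_mul {p q : ℕ} (hp : p.Prime) (hpq : Nat.Coprime p q) :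
    phiRatio (p * q) = (1 - 1 / (p : ℝ)) * phiRatio q := by
  unfold phiRatio
  have hp0 : (p : ℝ) ≠ 0 := by exact_mod_cast hp.ne_zero
  rw [Nat.totient_mul hpq, Nat.totient_prime hp]
  push_cast [hp.one_le]
  rcases eq_or_ne (q : ℝ) 0 with h | h
  · simp [h]
  · field_simp

/-- The elementary inequalities
`(φ(q)/q) L(x) ≤ L_q(x) ≤ (φ(q)/q) L(q x)`, where `L_q(x) = ∑_{r ≤ x, (r, q) = 1} μ²(r) / φ(r)`. -/
theorem sqfreeSum_phiInv_coprime_bounds (q : ℕ) (hq : Squarefree q) (x : ℝ) (hx : 0 ≤ x) :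
    phiRatio q * sqfreeSum phiInv 1 x ≤ sqfreeSum phiInv q x ∧
      sqfreeSum phiInv q x ≤ phiRatio q * sqfreeSum phiInv 1 (q * x) := by
  induction q using Nat.strong_induction_on generalizing x with
  | _ q ih =>
    rcases eq_or_ne q 1 with rfl | hq1
    · simp [phiRatio]
    · have hp := Nat.minFac_prime hq1
      set p := q.minFac with hpdef
      obtain ⟨q', hq'⟩ := Nat.minFac_dvd q
      rw [← hpdef] at hq'
      have hq0 : q ≠ 0 := hq.ne_zero
      have hq'0 : 0 < q' := Nat.pos_of_ne_zero (by rintro rfl; simp at hq'; omega)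
      rw [hq'] at hq
      have hcop : Nat.Coprime p q' := Nat.coprime_of_squarefree_mul hq
      have hlt : q' < q := by
        rw [hq']; nlinarith [hp.two_le]
      rw [hq', phiRatio_prime_mul hp hcop]
      have hp2 : (2 : ℝ) ≤ p := by exact_mod_cast hp.two_le
      have hp0 : (0 : ℝ) < p := by linarith
      have hpm : (0 : ℝ) < (p : ℝ) - 1 := by linarith
      have hphi : phiInv p = 1 / ((p : ℝ) - 1) := if_pos hp
      have hnn : ∀ y, 0 ≤ sqfreeSum phiInv (p * q') y := fun y =>
        Finset.sum_nonneg fun m _ => Finset.prod_nonneg fun r _ => phiInv_nonneg r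
      constructor
      · have h1 := (ih q' hlt hq.of_mul_right x hx).1
        have h2 := sqfreeSum_split phiInv hp hcop x
        have h3 : sqfreeSum phiInv (p * q') (x / p) ≤ sqfreeSum phiInv (p * q') x :=
          sqfreeSum_mono phiInv_nonneg _ (div_le_self hx (by linarith))
        rw [hphi] at h2
        have h4 : phiRatio q' * sqfreeSum phiInv 1 x
            ≤ (p / ((p : ℝ) - 1)) * sqfreeSum phiInv (p * q') x := by
          calc phiRatio q' * sqfreeSum phiInv 1 x ≤ _ := h1
            _ = _ := h2
            _ ≤ sqfreeSum phiInv (p * q') x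
                + 1 / ((p : ℝ) - 1) * sqfreeSum phiInv (p * q') x := by gcongr
            _ = _ := by field_simp; ring
        calc (1 - 1 / (p : ℝ)) * phiRatio q' * sqfreeSum phiInv 1 x
            = (1 - 1 / (p : ℝ)) * (phiRatio q' * sqfreeSum phiInv 1 x) := by ring
          _ ≤ (1 - 1 / (p : ℝ)) * ((p / ((p : ℝ) - 1)) * sqfreeSum phiInv (p * q') x) := by
              refine mul_le_mul_of_nonneg_left h4 ?_
              rw [sub_nonneg, div_le_one hp0]; linarith
          _ = _ := by field_simp
      · have h1 := (ih q' hlt hq.of_mul_right (p * x) (by positivity)).2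
        have h2 := sqfreeSum_split phiInv hp hcop (p * x)
        rw [mul_div_cancel_left₀ _ hp0.ne', hphi] at h2
        have h3 : sqfreeSum phiInv (p * q') x ≤ sqfreeSum phiInv (p * q') (p * x) :=
          sqfreeSum_mono phiInv_nonneg _ (by nlinarith)
        have h4 : (p / ((p : ℝ) - 1)) * sqfreeSum phiInv (p * q') x
            ≤ phiRatio q' * sqfreeSum phiInv 1 (q' * (p * x)) := by
          calc (p / ((p : ℝ) - 1)) * sqfreeSum phiInv (p * q') x
              = sqfreeSum phiInv (p * q') x
                + 1 / ((p : ℝ) - 1) * sqfreeSum phiInv (p * q') x := by field_simp; ring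
            _ ≤ _ := by rw [h2] at h1; linarith
        calc sqfreeSum phiInv (p * q') x
            = (1 - 1 / (p : ℝ)) * ((p / ((p : ℝ) - 1)) * sqfreeSum phiInv (p * q') x) := by
              field_simp
          _ ≤ (1 - 1 / (p : ℝ)) * (phiRatio q' * sqfreeSum phiInv 1 (q' * (p * x))) := by
              refine mul_le_mul_of_nonneg_left h4 ?_
              rw [sub_nonneg, div_le_one hp0]; linarith
          _ = _ := by push_cast; ring_nf

/-- `∑_{r ≤ x, (r, q) = 1} μ²(r) / φ(r) = (φ(q)/q) (log x + O(1 + log q))`, uniformly in `q`. -/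
theorem exists_sqfreeSum_phiInv_coprime_le :
    ∃ C : ℝ, 0 ≤ C ∧ ∀ q : ℕ, Squarefree q → ∀ x : ℝ, 1 ≤ x →
      |sqfreeSum phiInv q x - phiRatio q * Real.log x| ≤ phiRatio q * (C + Real.log q) := by
  obtain ⟨C, hC0, hC⟩ := exists_sqfreeSum_phiInv_sub_log_le
  refine ⟨C, hC0, fun q hq x hx => ?_⟩
  have hq0 : 0 < q := Nat.pos_of_ne_zero hq.ne_zero
  have hq1 : (1 : ℝ) ≤ q := by exact_mod_cast hq0
  have hu := phiRatio_pos hq0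
  obtain ⟨h1, h2⟩ := sqfreeSum_phiInv_coprime_bounds q hq x (by linarith)
  have h3 := abs_le.mp (hC x hx)
  have h4 := abs_le.mp (hC (q * x) (by nlinarith))
  rw [Real.log_mul (by linarith) (by linarith)] at h4
  have hlq := Real.log_nonneg hq1
  have h5 : phiRatio q * (Real.log x - C) ≤ phiRatio q * sqfreeSum phiInv 1 x :=
    mul_le_mul_of_nonneg_left (by linarith) hu.le
  have h6 : phiRatio q * sqfreeSum phiInv 1 (q * x)
      ≤ phiRatio q * (Real.log q + Real.log x + C) :=
    mul_le_mul_of_nonneg_left (by linarith) hu.le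
  have h7 : 0 ≤ phiRatio q * Real.log q := by positivity
  rw [abs_le]
  constructor <;> nlinarith

/-! ### The divisor sum as a sum over squarefree integers -/

/-- The local factor of `λ_R`: `-1` if the prime `p` divides `n` and `1 / (p - 1)` otherwise; it is
`-c_p(n) / φ(p)` for the Ramanujan sum `c_p`. It is extended by zero to composite `p`. -/
noncomputable def locWeight (n : ℤ) (p : ℕ) : ℝ :=
  if p.Prime then (if (p : ℤ) ∣ n then -1 else 1 / ((p : ℝ) - 1)) else 0

theorem locWeight_of_not_prime (n : ℤ) (p : ℕ) (hp : ¬ p.Prime) : locWeight n p = 0 := if_neg hp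

theorem totient_eq_prod_of_squarefree {r : ℕ} (hr : Squarefree r) :
    (Nat.totient r : ℝ) = ∏ p ∈ r.primeFactors, ((p : ℝ) - 1) := by
  rw [Nat.totient_eq_div_primeFactors_mul, Nat.prod_primeFactors_of_squarefree hr,
    Nat.div_self (Nat.pos_of_ne_zero hr.ne_zero), one_mul, Nat.cast_prod]
  refine Finset.prod_congr rfl fun p hp => ?_
  rw [Nat.cast_sub (Nat.prime_of_mem_primeFactors hp).one_le, Nat.cast_one]

theorem sum_divisors_id_mul_moebius {m : ℕ} (hm : Squarefree m) :
    ∑ d ∈ m.divisors, (d : ℝ) * (ArithmeticFunction.moebius d : ℝ)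
      = ∏ p ∈ m.primeFactors, (1 - (p : ℝ)) := by
  have h := ArithmeticFunction.IsMultiplicative.prodPrimeFactors_one_sub_of_squarefree
    ((ArithmeticFunction.id : ArithmeticFunction ℕ) : ArithmeticFunction ℝ)
    ArithmeticFunction.isMultiplicative_id.natCast hm
  simp only [ArithmeticFunction.natCoe_apply, ArithmeticFunction.id_apply] at h
  rw [h]
  exact Finset.sum_congr rfl fun d _ => mul_comm _ _

theorem sum_divisors_eq_prod {m : ℕ} (hm : Squarefree m) :
    ∑ d ∈ m.divisors, (d : ℝ) = ∏ p ∈ m.primeFactors, (1 + (p : ℝ)) := by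
  have h := ArithmeticFunction.IsMultiplicative.prodPrimeFactors_one_add_of_squarefree
    (f := ((ArithmeticFunction.id : ArithmeticFunction ℕ) : ArithmeticFunction ℝ))
    ArithmeticFunction.isMultiplicative_id.natCast hm
  simp only [ArithmeticFunction.natCoe_apply, ArithmeticFunction.id_apply] at h
  exact h.symm

theorem lambdaR_summand {r n : ℕ} (hr : Squarefree r) (hn : 0 < n) :
    ((ArithmeticFunction.moebius r : ℝ) ^ 2 / (Nat.totient r : ℝ)) *
      ∑ d ∈ (Nat.gcd r n).divisors, (d : ℝ) * (ArithmeticFunction.moebius d : ℝ)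
      = ∏ p ∈ r.primeFactors, locWeight n p := by
  have hg : Squarefree (Nat.gcd r n) := hr.squarefree_of_dvd (Nat.gcd_dvd_left r n)
  have hmu : (ArithmeticFunction.moebius r : ℝ) ^ 2 = 1 := by
    have := ArithmeticFunction.moebius_sq_eq_one_of_squarefree hr
    exact_mod_cast this
  rw [sum_divisors_id_mul_moebius hg, totient_eq_prod_of_squarefree hr, hmu,
    Nat.primeFactors_gcd hr.ne_zero hn.ne', ← Finset.filter_mem_eq_inter, Finset.prod_filter,
    one_div, ← Finset.prod_inv_distrib, ← Finset.prod_mul_distrib]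
  refine Finset.prod_congr rfl fun p hp => ?_
  have hpp := Nat.prime_of_mem_primeFactors hp
  have hp2 : (2 : ℝ) ≤ p := by exact_mod_cast hpp.two_le
  have hne : (p : ℝ) - 1 ≠ 0 := by linarith
  have hiff : p ∈ n.primeFactors ↔ (p : ℤ) ∣ (n : ℤ) := by
    rw [Int.natCast_dvd_natCast, Nat.mem_primeFactors]
    exact ⟨fun h => h.2.1, fun h => ⟨hpp, h, hn.ne'⟩⟩
  simp only [locWeight, if_pos hpp, hiff]
  split_ifs
  · field_simp; ring
  · simp

theorem lambdaR_eq_sqfreeSum (R : ℝ) {n : ℤ} (hn : 1 ≤ n) :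
    lambdaR R n = sqfreeSum (locWeight n) 1 R := by
  lift n to ℕ using by omega
  have hn' : 0 < n := by omega
  unfold lambdaR sqfreeSum
  rw [if_neg (by omega), Finset.sum_filter]
  refine Finset.sum_congr rfl fun r _ => ?_
  simp only [Nat.coprime_one_right_eq_true, and_true, Int.toNat_natCast]
  split_ifs with hr
  · exact lambdaR_summand hr hn'
  · rw [ArithmeticFunction.moebius_eq_zero_of_not_squarefree hr]; simp

theorem lambdaR_eq_primeIter {R : ℝ} (hR : 0 ≤ R) {n : ℤ} (hn : 1 ≤ n) {Z : ℕ} (hZ : R < Z) :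
    lambdaR R n = primeIter (locWeight n) Z geOne R := by
  rw [lambdaR_eq_sqfreeSum R hn, primeIter_geOne (locWeight_of_not_prime n) hR hZ]

/-- The coefficient of `1_{d ∣ n}` in `λ_R(n)`. -/
noncomputable def lambdaCoeff (R : ℝ) (d : ℕ) : ℝ :=
  ∑ r ∈ (Finset.Icc 1 ⌊R⌋₊).filter (fun r => d ∣ r),
    ((ArithmeticFunction.moebius r : ℝ) ^ 2 / (Nat.totient r : ℝ)) *
      ((d : ℝ) * (ArithmeticFunction.moebius d : ℝ))

theorem lambdaR_eq_sum_lambdaCoeff (R : ℝ) {n : ℤ} (hn : 1 ≤ n) :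
    lambdaR R n = ∑ d ∈ Finset.Icc 1 ⌊R⌋₊, lambdaCoeff R d * if (d : ℤ) ∣ n then 1 else 0 := by
  lift n to ℕ using by omega
  have hn' : 0 < n := by omega
  unfold lambdaR lambdaCoeff
  rw [if_neg (by omega)]
  simp only [Int.toNat_natCast, Finset.mul_sum, Finset.sum_mul, Int.natCast_dvd_natCast]
  simp only [Finset.sum_filter]
  rw [Finset.sum_comm]
  refine Finset.sum_congr rfl fun r hr => ?_
  have hr1 := Finset.mem_Icc.mp hr
  have hs : (Nat.gcd r n).divisors = (Finset.Icc 1 ⌊R⌋₊).filter (fun d => d ∣ r ∧ d ∣ n) := by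
    ext d
    simp only [Nat.mem_divisors, Finset.mem_filter, Finset.mem_Icc, Nat.dvd_gcd_iff]
    constructor
    · rintro ⟨⟨h1, h2⟩, -⟩
      have := Nat.le_of_dvd (by omega) h1
      exact ⟨⟨Nat.pos_of_dvd_of_pos h2 hn', by omega⟩, h1, h2⟩
    · rintro ⟨-, h1, h2⟩
      exact ⟨⟨h1, h2⟩, Nat.gcd_ne_zero_right hn'.ne'⟩
  rw [hs, Finset.sum_filter]
  refine Finset.sum_congr rfl fun d _ => ?_
  by_cases h1 : d ∣ r <;> by_cases h2 : d ∣ n <;> simp [h1, h2]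

theorem sum_abs_lambdaCoeff_le (R : ℝ) :
    ∑ d ∈ Finset.Icc 1 ⌊R⌋₊, |lambdaCoeff R d| ≤ sqfreeSum sigmaPhi 1 R := by
  have h1 : ∀ d, |lambdaCoeff R d| ≤ ∑ r ∈ (Finset.Icc 1 ⌊R⌋₊).filter (fun r => d ∣ r),
      ((ArithmeticFunction.moebius r : ℝ) ^ 2 / (Nat.totient r : ℝ)) * (d : ℝ) := by
    intro d
    refine (Finset.abs_sum_le_sum_abs _ _).trans (Finset.sum_le_sum fun r _ => ?_)
    have hmu : |(ArithmeticFunction.moebius d : ℝ)| ≤ 1 := by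
      have := ArithmeticFunction.abs_moebius_le_one (n := d)
      exact_mod_cast this
    have h0 : 0 ≤ (ArithmeticFunction.moebius r : ℝ) ^ 2 / (Nat.totient r : ℝ) := by positivity
    rw [abs_mul, abs_of_nonneg h0, abs_mul, Nat.abs_cast]
    refine mul_le_mul_of_nonneg_left ?_ h0
    exact mul_le_of_le_one_right (Nat.cast_nonneg d) hmu
  refine (Finset.sum_le_sum fun d _ => h1 d).trans (le_of_eq ?_)
  simp only [Finset.sum_filter]
  rw [Finset.sum_comm]
  unfold sqfreeSum
  rw [Finset.sum_filter]
  refine Finset.sum_congr rfl fun r hr => ?_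
  have hr1 := Finset.mem_Icc.mp hr
  simp only [Nat.coprime_one_right_eq_true, and_true]
  split_ifs with hs
  · have hmu : (ArithmeticFunction.moebius r : ℝ) ^ 2 = 1 := by
      have := ArithmeticFunction.moebius_sq_eq_one_of_squarefree hs
      exact_mod_cast this
    have hd : r.divisors = (Finset.Icc 1 ⌊R⌋₊).filter (fun d => d ∣ r) := by
      ext d
      simp only [Nat.mem_divisors, Finset.mem_filter, Finset.mem_Icc]
      constructor
      · rintro ⟨h1, h2⟩
        have := Nat.le_of_dvd (by omega) h1
        exact ⟨⟨Nat.pos_of_dvd_of_pos h1 (by omega), by omega⟩, h1⟩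
      · rintro ⟨-, h1⟩
        exact ⟨h1, by omega⟩
    rw [← Finset.sum_filter, ← hd, ← Finset.mul_sum, sum_divisors_eq_prod hs, hmu,
      totient_eq_prod_of_squarefree hs, one_div, ← Finset.prod_inv_distrib,
      ← Finset.prod_mul_distrib]
    refine Finset.prod_congr rfl fun p hp => ?_
    rw [sigmaPhi, if_pos (Nat.prime_of_mem_primeFactors hp)]
    ring
  · rw [ArithmeticFunction.moebius_eq_zero_of_not_squarefree hs]; simp

/-! ### Mean values over residue classes -/

theorem sum_range_mul_of_periodic {p Q : ℕ} (hp : 0 < p) (hQ : 0 < Q) (hpQ : Nat.Coprime p Q)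
    {a b : ℕ → ℝ} (ha : Function.Periodic a p) (hb : Function.Periodic b Q) :
    ∑ n ∈ Finset.range (p * Q), a n * b n
      = (∑ n ∈ Finset.range p, a n) * ∑ n ∈ Finset.range Q, b n := by
  rw [Finset.sum_mul_sum, ← Finset.sum_product']
  refine Finset.sum_nbij (fun n => (n % p, n % Q)) ?_ ?_ ?_ ?_
  · intro n _
    simp [Nat.mod_lt _ hp, Nat.mod_lt _ hQ]
  · intro m hm n hn hmn
    simp only [Prod.mk.injEq] at hmn
    have h : m ≡ n [MOD p * Q] := (Nat.modEq_and_modEq_iff_modEq_mul hpQ).mp hmn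
    exact Nat.ModEq.eq_of_lt_of_lt h (by simpa using hm) (by simpa using hn)
  · rintro ⟨x, y⟩ hxy
    simp only [Finset.coe_product, Finset.coe_range, Set.mem_prod, Set.mem_Iio] at hxy
    refine ⟨Nat.chineseRemainder hpQ x y, ?_, ?_⟩
    · simpa using Nat.chineseRemainder_lt_mul hpQ x y hp.ne' hQ.ne'
    · have := (Nat.chineseRemainder hpQ x y).2
      simp only [Prod.mk.injEq]
      exact ⟨Eq.trans this.1 (Nat.mod_eq_of_lt hxy.1), Eq.trans this.2 (Nat.mod_eq_of_lt hxy.2)⟩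
  · intro n _
    simp only [ha.map_mod_nat, hb.map_mod_nat]

/-- The indicator of `d ∣ n`. -/
noncomputable def dvdInd (d : ℕ) (n : ℤ) : ℝ := if (d : ℤ) ∣ n then 1 else 0

theorem sum_dvdInd {p : ℕ} (hp : 0 < p) (j : ℤ) :
    ∑ n ∈ Finset.range p, dvdInd p (n + j) = 1 := by
  have hp' : (p : ℤ) ≠ 0 := by omega
  have h0 := Int.emod_nonneg (-j) hp'
  have h1 := Int.emod_lt_of_pos (-j) (by omega : (0 : ℤ) < p)
  have hdvd : (p : ℤ) ∣ (-j) % p + j := by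
    have := Int.emod_add_mul_ediv (-j) p
    exact ⟨-((-j) / p), by linarith⟩
  rw [Finset.sum_eq_single ((-j) % p).toNat]
  · unfold dvdInd
    rw [Int.toNat_of_nonneg h0, if_pos hdvd]
  · intro n hn hne
    have hn' := Finset.mem_range.mp hn
    unfold dvdInd
    rw [if_neg]
    intro hd
    have h2 : (p : ℤ) ∣ n - (-j) % p := by
      have := dvd_sub hd hdvd
      rwa [show ((n : ℤ) + j) - ((-j) % p + j) = n - (-j) % p by ring] at this
    have h3 := Int.eq_zero_of_abs_lt_dvd h2 (by rw [abs_lt]; constructor <;> omega)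
    omega
  · intro hn
    exfalso
    apply hn
    rw [Finset.mem_range]
    omega

theorem dvdInd_mul_dvdInd (p : ℕ) (n i j : ℤ) :
    dvdInd p (n + i) * dvdInd p (n + j) = dvdInd p (i - j) * dvdInd p (n + i) := by
  unfold dvdInd
  by_cases h1 : (p : ℤ) ∣ n + i
  · have : (p : ℤ) ∣ n + j ↔ (p : ℤ) ∣ i - j := by
      rw [show i - j = (n + i) - (n + j) by ring]
      exact ⟨fun h => dvd_sub h1 h, fun h => (dvd_sub_right h1).mp h⟩
    simp [h1, this]
  · simp [h1]

theorem locWeight_eq {p : ℕ} (hp : p.Prime) (n : ℤ) :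
    locWeight n p = 1 / ((p : ℝ) - 1) - p / ((p : ℝ) - 1) * dvdInd p n := by
  have hp2 : (2 : ℝ) ≤ p := by exact_mod_cast hp.two_le
  have hne : (p : ℝ) - 1 ≠ 0 := by linarith
  unfold locWeight dvdInd
  rw [if_pos hp]
  split_ifs
  · field_simp; ring
  · ring

/-- The mean over `n` modulo `p` of `s₁ s₂ ∏_{i ≤ 2} locWeight (n + j_i) p`. -/
noncomputable def pairCoeff (s₁ s₂ : ℝ) (j₁ j₂ : ℤ) (p : ℕ) : ℝ :=
  if p.Prime then s₁ * s₂ * ((-1 + p * dvdInd p (j₁ - j₂)) / ((p : ℝ) - 1) ^ 2) else 0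

/-- The mean over `n` modulo `p` of `s₁ s₂ s₃ ∏_{i ≤ 3} locWeight (n + j_i) p`. -/
noncomputable def tripleCoeff (s₁ s₂ s₃ : ℝ) (j₁ j₂ j₃ : ℤ) (p : ℕ) : ℝ :=
  if p.Prime then s₁ * s₂ * s₃ * ((-2 + p * (dvdInd p (j₁ - j₂) + dvdInd p (j₁ - j₃)
    + dvdInd p (j₂ - j₃)) - (p : ℝ) ^ 2 * (dvdInd p (j₁ - j₂) * dvdInd p (j₁ - j₃)))
      / ((p : ℝ) - 1) ^ 3) else 0

theorem sum_locWeight {p : ℕ} (hp : p.Prime) (s : ℝ) (j : ℤ) :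
    ∑ n ∈ Finset.range p, s * locWeight (n + j) p = 0 := by
  have hp2 : (2 : ℝ) ≤ p := by exact_mod_cast hp.two_le
  have hne : (p : ℝ) - 1 ≠ 0 := by linarith
  simp only [locWeight_eq hp]
  rw [← Finset.mul_sum, Finset.sum_sub_distrib, ← Finset.mul_sum, sum_dvdInd hp.pos]
  simp only [Finset.sum_const, Finset.card_range, nsmul_eq_mul]
  field_simp
  ring

theorem sum_locWeight_pair {p : ℕ} (hp : p.Prime) (s₁ s₂ : ℝ) (j₁ j₂ : ℤ) :
    ∑ n ∈ Finset.range p, (s₁ * locWeight (n + j₁) p) * (s₂ * locWeight (n + j₂) p)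
      = p * pairCoeff s₁ s₂ j₁ j₂ p := by
  have hp2 : (2 : ℝ) ≤ p := by exact_mod_cast hp.two_le
  have hne : (p : ℝ) - 1 ≠ 0 := by linarith
  have e : ∀ n : ℕ, (s₁ * locWeight (n + j₁) p) * (s₂ * locWeight (n + j₂) p)
      = s₁ * s₂ / ((p : ℝ) - 1) ^ 2 * 1
        - s₁ * s₂ * p / ((p : ℝ) - 1) ^ 2 * dvdInd p (n + j₁)
        - s₁ * s₂ * p / ((p : ℝ) - 1) ^ 2 * dvdInd p (n + j₂)
        + s₁ * s₂ * p ^ 2 / ((p : ℝ) - 1) ^ 2 * dvdInd p (j₁ - j₂) * dvdInd p (n + j₁) := by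
    intro n
    have h := dvdInd_mul_dvdInd p n j₁ j₂
    rw [locWeight_eq hp, locWeight_eq hp, mul_assoc (_ / _) (dvdInd p (j₁ - j₂)), ← h]
    field_simp
    ring
  simp only [e]
  rw [Finset.sum_add_distrib, Finset.sum_sub_distrib, Finset.sum_sub_distrib, ← Finset.mul_sum,
    ← Finset.mul_sum, ← Finset.mul_sum, ← Finset.mul_sum, sum_dvdInd hp.pos, sum_dvdInd hp.pos]
  simp only [Finset.sum_const, Finset.card_range, nsmul_eq_mul, pairCoeff, if_pos hp]
  field_simp
  ring

theorem sum_locWeight_triple {p : ℕ} (hp : p.Prime) (s₁ s₂ s₃ : ℝ) (j₁ j₂ j₃ : ℤ) :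
    ∑ n ∈ Finset.range p, (s₁ * locWeight (n + j₁) p) * (s₂ * locWeight (n + j₂) p)
        * (s₃ * locWeight (n + j₃) p)
      = p * tripleCoeff s₁ s₂ s₃ j₁ j₂ j₃ p := by
  have hp2 : (2 : ℝ) ≤ p := by exact_mod_cast hp.two_le
  have hne : (p : ℝ) - 1 ≠ 0 := by linarith
  set u := s₁ * s₂ * s₃ / ((p : ℝ) - 1) ^ 3 with hu
  have e : ∀ n : ℕ, (s₁ * locWeight (n + j₁) p) * (s₂ * locWeight (n + j₂) p)
        * (s₃ * locWeight (n + j₃) p)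
      = u * 1 - u * p * dvdInd p (n + j₁) - u * p * dvdInd p (n + j₂) - u * p * dvdInd p (n + j₃)
        + u * p ^ 2 * dvdInd p (j₁ - j₂) * dvdInd p (n + j₁)
        + u * p ^ 2 * dvdInd p (j₁ - j₃) * dvdInd p (n + j₁)
        + u * p ^ 2 * dvdInd p (j₂ - j₃) * dvdInd p (n + j₂)
        - u * p ^ 3 * (dvdInd p (j₁ - j₂) * dvdInd p (j₁ - j₃)) * dvdInd p (n + j₁) := by
    intro n
    have h12 := dvdInd_mul_dvdInd p n j₁ j₂
    have h13 := dvdInd_mul_dvdInd p n j₁ j₃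
    have h23 := dvdInd_mul_dvdInd p n j₂ j₃
    have h123 : dvdInd p (j₁ - j₂) * dvdInd p (j₁ - j₃) * dvdInd p (n + j₁)
        = dvdInd p (n + j₁) * dvdInd p (n + j₂) * dvdInd p (n + j₃) := by
      rw [h12, mul_assoc, mul_assoc, h13]
    rw [mul_assoc (u * p ^ 2) (dvdInd p (j₁ - j₂)), ← h12,
      mul_assoc (u * p ^ 2) (dvdInd p (j₁ - j₃)), ← h13,
      mul_assoc (u * p ^ 2) (dvdInd p (j₂ - j₃)), ← h23, mul_assoc (u * p ^ 3), h123,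
      locWeight_eq hp, locWeight_eq hp, locWeight_eq hp, hu]
    field_simp
    ring
  simp only [e]
  rw [Finset.sum_sub_distrib, Finset.sum_add_distrib, Finset.sum_add_distrib,
    Finset.sum_add_distrib, Finset.sum_sub_distrib, Finset.sum_sub_distrib,
    Finset.sum_sub_distrib]
  simp only [← Finset.mul_sum, sum_dvdInd hp.pos]
  simp only [Finset.sum_const, Finset.card_range, nsmul_eq_mul, tripleCoeff, if_pos hp, hu]
  field_simp
  ring

/-! ### The three-variable operator and the mean value of a product of three divisor sums -/

/-- The local data of a three-fold correlation: `c12 p` is the weight of the primes `p` that divide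
exactly the first two of the three summation variables, and so on. -/
structure CorrCoeff where
  c12 : ℕ → ℝ
  c13 : ℕ → ℝ
  c23 : ℕ → ℝ
  c123 : ℕ → ℝ

/-- The operator `1 + c₁₂ S₁₂ + c₁₃ S₁₃ + c₂₃ S₂₃ + c₁₂₃ S₁₂₃`, where `S_I` divides the variables in
`I` by `p`. -/
noncomputable def corrOp (C : CorrCoeff) (p : ℕ) (f : ℝ → ℝ → ℝ → ℝ) (X Y W : ℝ) : ℝ :=
  f X Y W + C.c12 p * f (X / p) (Y / p) W + C.c13 p * f (X / p) Y (W / p)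
    + C.c23 p * f X (Y / p) (W / p) + C.c123 p * f (X / p) (Y / p) (W / p)

/-- The product of the operators `corrOp C p` over `p < Z`. -/
noncomputable def corrIter (C : CorrCoeff) : ℕ → (ℝ → ℝ → ℝ → ℝ) → ℝ → ℝ → ℝ → ℝ
  | 0, f => f
  | Z + 1, f => corrOp C Z (corrIter C Z f)

/-- The coefficients vanish off the primes. -/
def CorrCoeff.OnPrimes (C : CorrCoeff) : Prop :=
  ∀ n : ℕ, ¬ n.Prime → C.c12 n = 0 ∧ C.c13 n = 0 ∧ C.c23 n = 0 ∧ C.c123 n = 0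

theorem corrOp_of_not_prime {C : CorrCoeff} (hC : C.OnPrimes) {n : ℕ} (hn : ¬ n.Prime)
    (f : ℝ → ℝ → ℝ → ℝ) : corrOp C n f = f := by
  obtain ⟨h1, h2, h3, h4⟩ := hC n hn
  funext X Y W
  simp [corrOp, h1, h2, h3, h4]

theorem corrIter_shift (C : CorrCoeff) (Z : ℕ) (f : ℝ → ℝ → ℝ → ℝ) (u v w X Y W : ℝ) :
    corrIter C Z (fun X Y W => f (X / u) (Y / v) (W / w)) X Y W
      = corrIter C Z f (X / u) (Y / v) (W / w) := by
  induction Z generalizing X Y W with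
  | zero => rfl
  | succ Z ih =>
    simp only [corrIter, corrOp, ih, div_right_comm X (Z : ℝ), div_right_comm Y (Z : ℝ),
      div_right_comm W (Z : ℝ)]

theorem corrIter_add_mul (C : CorrCoeff) (Z : ℕ) (f g : ℝ → ℝ → ℝ → ℝ) (c X Y W : ℝ) :
    corrIter C Z (fun X Y W => f X Y W + c * g X Y W) X Y W
      = corrIter C Z f X Y W + c * corrIter C Z g X Y W := by
  induction Z generalizing X Y W with
  | zero => rfl
  | succ Z ih => simp only [corrIter, corrOp, ih]; ring

theorem corrIter_congr {C : CorrCoeff} (hC : C.OnPrimes) (Z : ℕ) {f g : ℝ → ℝ → ℝ → ℝ}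
    {X Y W : ℝ} (hX : 0 ≤ X) (hY : 0 ≤ Y) (hW : 0 ≤ W)
    (hfg : ∀ X' Y' W', 0 ≤ X' → X' ≤ X → 0 ≤ Y' → Y' ≤ Y → 0 ≤ W' → W' ≤ W →
      f X' Y' W' = g X' Y' W') :
    corrIter C Z f X Y W = corrIter C Z g X Y W := by
  induction Z generalizing X Y W with
  | zero => exact hfg X Y W hX le_rfl hY le_rfl hW le_rfl
  | succ Z ih =>
    by_cases hZ : Z.Prime
    · have hdiv : ∀ {x : ℝ}, 0 ≤ x → 0 ≤ x / Z ∧ x / Z ≤ x := fun {x} hx =>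
        ⟨by positivity, div_le_self hx (by exact_mod_cast hZ.one_le)⟩
      have key : ∀ X' Y' W', 0 ≤ X' → X' ≤ X → 0 ≤ Y' → Y' ≤ Y → 0 ≤ W' → W' ≤ W →
          corrIter C Z f X' Y' W' = corrIter C Z g X' Y' W' := by
        intro X' Y' W' h1 h2 h3 h4 h5 h6
        exact ih h1 h3 h5 fun _ _ _ a b c d e f =>
          hfg _ _ _ a (b.trans h2) c (d.trans h4) e (f.trans h6)
      obtain ⟨x0, x1⟩ := hdiv hX
      obtain ⟨y0, y1⟩ := hdiv hY
      obtain ⟨w0, w1⟩ := hdiv hW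
      simp only [corrIter, corrOp]
      rw [key X Y W hX le_rfl hY le_rfl hW le_rfl, key _ _ _ x0 x1 y0 y1 hW le_rfl,
        key _ _ _ x0 x1 hY le_rfl w0 w1, key _ _ _ hX le_rfl y0 y1 w0 w1,
        key _ _ _ x0 x1 y0 y1 w0 w1]
    · simp only [corrIter, corrOp_of_not_prime hC hZ]
      exact ih hX hY hW hfg

/-- The indicator function of `[1, ∞)³`. -/
noncomputable def geOne₃ (X Y W : ℝ) : ℝ := geOne X * geOne Y * geOne W

/-- The local data of the correlation with shifts `j₁, j₂, j₃`; an activity `s_i = 0` removes the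
`i`-th factor, so that correlations of fewer than three factors are included. -/
noncomputable def shiftCoeff (s₁ s₂ s₃ : ℝ) (j₁ j₂ j₃ : ℤ) : CorrCoeff where
  c12 := pairCoeff s₁ s₂ j₁ j₂
  c13 := pairCoeff s₁ s₃ j₁ j₃
  c23 := pairCoeff s₂ s₃ j₂ j₃
  c123 := tripleCoeff s₁ s₂ s₃ j₁ j₂ j₃

theorem shiftCoeff_onPrimes (s₁ s₂ s₃ : ℝ) (j₁ j₂ j₃ : ℤ) :
    (shiftCoeff s₁ s₂ s₃ j₁ j₂ j₃).OnPrimes := by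
  intro n hn
  simp [shiftCoeff, pairCoeff, tripleCoeff, hn]

/-- The truncated divisor sum over the primes below `Z`, as a function of all integers `n`. -/
noncomputable def sieveSum (s : ℝ) (j : ℤ) (Z : ℕ) (X : ℝ) (n : ℕ) : ℝ :=
  primeIter (fun p => s * locWeight (n + j) p) Z geOne X

theorem locWeight_congr {p : ℕ} {m n : ℤ} (h : (p : ℤ) ∣ m - n) :
    locWeight m p = locWeight n p := by
  have : (p : ℤ) ∣ m ↔ (p : ℤ) ∣ n := by
    constructor
    · intro h1; have := dvd_sub h1 h; rwa [sub_sub_cancel] at this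
    · intro h1; have := dvd_add h1 h; rwa [add_sub_cancel] at this
  simp only [locWeight, this]

theorem primeIter_congr_weight {h h' : ℕ → ℝ} (Z : ℕ) (hh : ∀ n < Z, h n = h' n) (f : ℝ → ℝ)
    (X : ℝ) : primeIter h Z f X = primeIter h' Z f X := by
  induction Z generalizing X with
  | zero => rfl
  | succ Z ih =>
    simp only [primeIter]
    rw [ih fun n hn => hh n (by omega), ih fun n hn => hh n (by omega), hh Z (by omega)]

theorem sieveSum_periodic (s : ℝ) (j : ℤ) (Z : ℕ) (X : ℝ) :
    Function.Periodic (sieveSum s j Z X) (primeProd Z) := by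
  intro n
  refine primeIter_congr_weight Z (fun p hp => ?_) geOne X
  by_cases hpp : p.Prime
  · rw [locWeight_congr]
    have := dvd_primeProd hpp hp
    push_cast
    rw [show (n : ℤ) + primeProd Z + j - (n + j) = (primeProd Z : ℤ) by ring]
    exact_mod_cast this
  · simp [locWeight, hpp]

theorem locWeight_periodic (s : ℝ) (j : ℤ) (p : ℕ) :
    Function.Periodic (fun n : ℕ => s * locWeight (n + j) p) p := by
  intro n
  simp only
  rw [locWeight_congr]
  push_cast
  exact ⟨1, by ring⟩

/-- Over a full period, the product of three truncated divisor sums has mean value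
`∏_p (1 + ∑_I m_p(I) S_I)` applied to the indicator function, by the independence of the residues
modulo different primes. -/
theorem sum_sieveSum_triple (s₁ s₂ s₃ : ℝ) (j₁ j₂ j₃ : ℤ) (Z : ℕ) (X Y W : ℝ) :
    ∑ n ∈ Finset.range (primeProd Z),
        sieveSum s₁ j₁ Z X n * sieveSum s₂ j₂ Z Y n * sieveSum s₃ j₃ Z W n
      = primeProd Z * corrIter (shiftCoeff s₁ s₂ s₃ j₁ j₂ j₃) Z geOne₃ X Y W := by
  induction Z generalizing X Y W with
  | zero => simp [primeProd_zero, sieveSum, primeIter, corrIter, geOne₃]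
  | succ Z ih =>
    by_cases hZ : Z.Prime
    · set g₁ : ℕ → ℝ := fun n => s₁ * locWeight (n + j₁) Z with hg1
      set g₂ : ℕ → ℝ := fun n => s₂ * locWeight (n + j₂) Z with hg2
      set g₃ : ℕ → ℝ := fun n => s₃ * locWeight (n + j₃) Z with hg3
      have p1 : Function.Periodic g₁ Z := locWeight_periodic s₁ j₁ Z
      have p2 : Function.Periodic g₂ Z := locWeight_periodic s₂ j₂ Z
      have p3 : Function.Periodic g₃ Z := locWeight_periodic s₃ j₃ Z
      have m1 : ∑ n ∈ Finset.range Z, g₁ n = 0 := sum_locWeight hZ s₁ j₁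
      have m2 : ∑ n ∈ Finset.range Z, g₂ n = 0 := sum_locWeight hZ s₂ j₂
      have m3 : ∑ n ∈ Finset.range Z, g₃ n = 0 := sum_locWeight hZ s₃ j₃
      have m12 : ∑ n ∈ Finset.range Z, g₁ n * g₂ n = Z * pairCoeff s₁ s₂ j₁ j₂ Z :=
        sum_locWeight_pair hZ s₁ s₂ j₁ j₂
      have m13 : ∑ n ∈ Finset.range Z, g₁ n * g₃ n = Z * pairCoeff s₁ s₃ j₁ j₃ Z :=
        sum_locWeight_pair hZ s₁ s₃ j₁ j₃
      have m23 : ∑ n ∈ Finset.range Z, g₂ n * g₃ n = Z * pairCoeff s₂ s₃ j₂ j₃ Z :=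
        sum_locWeight_pair hZ s₂ s₃ j₂ j₃
      have m123 : ∑ n ∈ Finset.range Z, g₁ n * g₂ n * g₃ n
          = Z * tripleCoeff s₁ s₂ s₃ j₁ j₂ j₃ Z := sum_locWeight_triple hZ s₁ s₂ s₃ j₁ j₂ j₃
      have split : ∀ (a : ℕ → ℝ), Function.Periodic a Z → ∀ X' Y' W' : ℝ,
          ∑ n ∈ Finset.range (Z * primeProd Z), a n *
            (sieveSum s₁ j₁ Z X' n * sieveSum s₂ j₂ Z Y' n * sieveSum s₃ j₃ Z W' n)
          = (∑ n ∈ Finset.range Z, a n)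
            * (primeProd Z * corrIter (shiftCoeff s₁ s₂ s₃ j₁ j₂ j₃) Z geOne₃ X' Y' W') := by
        intro a ha X' Y' W'
        rw [← ih]
        exact sum_range_mul_of_periodic hZ.pos (primeProd_pos Z) (coprime_primeProd hZ le_rfl) ha
          (((sieveSum_periodic s₁ j₁ Z X').mul (sieveSum_periodic s₂ j₂ Z Y')).mul
            (sieveSum_periodic s₃ j₃ Z W'))
      have step : ∀ (s : ℝ) (j : ℤ) (V : ℝ) (n : ℕ), sieveSum s j (Z + 1) V n
          = sieveSum s j Z V n + (s * locWeight (n + j) Z) * sieveSum s j Z (V / Z) n :=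
        fun s j V n => rfl
      have hZ0 : (Z : ℝ) ≠ 0 := by exact_mod_cast hZ.ne_zero
      rw [primeProd_succ_of_prime hZ]
      have expand : ∀ n : ℕ, sieveSum s₁ j₁ (Z + 1) X n * sieveSum s₂ j₂ (Z + 1) Y n
            * sieveSum s₃ j₃ (Z + 1) W n
          = 1 * (sieveSum s₁ j₁ Z X n * sieveSum s₂ j₂ Z Y n * sieveSum s₃ j₃ Z W n)
          + g₁ n * (sieveSum s₁ j₁ Z (X / Z) n * sieveSum s₂ j₂ Z Y n * sieveSum s₃ j₃ Z W n)
          + g₂ n * (sieveSum s₁ j₁ Z X n * sieveSum s₂ j₂ Z (Y / Z) n * sieveSum s₃ j₃ Z W n)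
          + g₃ n * (sieveSum s₁ j₁ Z X n * sieveSum s₂ j₂ Z Y n * sieveSum s₃ j₃ Z (W / Z) n)
          + g₁ n * g₂ n *
            (sieveSum s₁ j₁ Z (X / Z) n * sieveSum s₂ j₂ Z (Y / Z) n * sieveSum s₃ j₃ Z W n)
          + g₁ n * g₃ n *
            (sieveSum s₁ j₁ Z (X / Z) n * sieveSum s₂ j₂ Z Y n * sieveSum s₃ j₃ Z (W / Z) n)
          + g₂ n * g₃ n *
            (sieveSum s₁ j₁ Z X n * sieveSum s₂ j₂ Z (Y / Z) n * sieveSum s₃ j₃ Z (W / Z) n)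
          + g₁ n * g₂ n * g₃ n *
            (sieveSum s₁ j₁ Z (X / Z) n * sieveSum s₂ j₂ Z (Y / Z) n
              * sieveSum s₃ j₃ Z (W / Z) n) := by
        intro n
        rw [step, step, step]
        ring
      simp only [expand, Finset.sum_add_distrib]
      rw [split (fun _ => 1) (fun _ => rfl), split g₁ p1, split g₂ p2, split g₃ p3,
        split (fun n => g₁ n * g₂ n) (p1.mul p2), split (fun n => g₁ n * g₃ n) (p1.mul p3),
        split (fun n => g₂ n * g₃ n) (p2.mul p3),
        split (fun n => g₁ n * g₂ n * g₃ n) ((p1.mul p2).mul p3),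
        m1, m2, m3, m12, m13, m23, m123]
      simp only [Finset.sum_const, Finset.card_range, nsmul_eq_mul, corrIter, corrOp, shiftCoeff]
      push_cast
      ring
    · rw [primeProd_succ_of_not_prime hZ]
      have step : ∀ (s : ℝ) (j : ℤ) (V : ℝ) (n : ℕ),
          sieveSum s j (Z + 1) V n = sieveSum s j Z V n := by
        intro s j V n
        simp [sieveSum, primeIter, locWeight, hZ]
      simp only [step, ih, corrIter, corrOp_of_not_prime (shiftCoeff_onPrimes _ _ _ _ _ _) hZ]

/-! ### Counting -/

/-- The integers satisfying three simultaneous divisibility conditions have a density, up to a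
bounded error on intervals. -/
theorem exists_density (d₁ d₂ d₃ : ℕ) (h₁ : 0 < d₁) (h₂ : 0 < d₂) (h₃ : 0 < d₃) (j₁ j₂ j₃ : ℤ) :
    ∃ ρ : ℝ, ∀ (M : ℤ) (n : ℕ), |∑ m ∈ Finset.Ioc M (M + n),
      dvdInd d₁ (m + j₁) * dvdInd d₂ (m + j₂) * dvdInd d₃ (m + j₃) - n * ρ| ≤ 1 := by
  have hsum : ∀ (M : ℤ) (n : ℕ), ∑ m ∈ Finset.Ioc M (M + n),
      dvdInd d₁ (m + j₁) * dvdInd d₂ (m + j₂) * dvdInd d₃ (m + j₃)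
      = (((Finset.Ioc M (M + n)).filter (fun m => (d₁ : ℤ) ∣ m + j₁ ∧ (d₂ : ℤ) ∣ m + j₂ ∧
        (d₃ : ℤ) ∣ m + j₃)).card : ℝ) := by
    intro M n
    rw [Finset.card_filter, Nat.cast_sum]
    refine Finset.sum_congr rfl fun m _ => ?_
    unfold dvdInd
    by_cases a : (d₁ : ℤ) ∣ m + j₁ <;> by_cases b : (d₂ : ℤ) ∣ m + j₂ <;>
      by_cases c : (d₃ : ℤ) ∣ m + j₃ <;> simp [a, b, c]
  by_cases hex : ∃ v : ℤ, (d₁ : ℤ) ∣ v + j₁ ∧ (d₂ : ℤ) ∣ v + j₂ ∧ (d₃ : ℤ) ∣ v + j₃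
  · obtain ⟨v, v1, v2, v3⟩ := hex
    set D : ℕ := Nat.lcm (Nat.lcm d₁ d₂) d₃ with hD
    have hD0 : 0 < D := Nat.lcm_pos (Nat.lcm_pos h₁ h₂) h₃
    refine ⟨1 / D, fun M n => ?_⟩
    rw [hsum]
    have hfilter : (Finset.Ioc M (M + n)).filter (fun m => (d₁ : ℤ) ∣ m + j₁ ∧ (d₂ : ℤ) ∣ m + j₂ ∧
        (d₃ : ℤ) ∣ m + j₃) = (Finset.Ioc M (M + n)).filter (fun m => m ≡ v [ZMOD (D : ℤ)]) := by
      refine Finset.filter_congr fun m _ => ?_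
      have e : ∀ (d : ℕ) (j : ℤ), (d : ℤ) ∣ v + j → ((d : ℤ) ∣ m + j ↔ (d : ℤ) ∣ m - v) := by
        intro d j h
        rw [show m - v = (m + j) - (v + j) by ring]
        exact ⟨fun h' => dvd_sub h' h, fun h' => (dvd_sub_left h).mp h'⟩
      rw [e _ _ v1, e _ _ v2, e _ _ v3, Int.modEq_comm, Int.modEq_iff_dvd]
      simp only [Int.natCast_dvd, hD, Nat.lcm_dvd_iff]
      tauto
    rw [hfilter]
    have hcard := Int.Ioc_filter_modEq_card M (M + n) (r := (D : ℤ)) (by exact_mod_cast hD0) v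
    have hDq : (0 : ℚ) < D := by exact_mod_cast hD0
    push_cast at hcard
    have hsub : ((M : ℚ) + n - v) / D = (M - v) / D + n / D := by ring
    set x : ℚ := ((M : ℚ) - v) / D
    set y : ℚ := ((M : ℚ) + n - v) / D
    have hy0 : (0 : ℚ) ≤ n / D := by positivity
    have hfl : ⌊x⌋ ≤ ⌊y⌋ := Int.floor_mono (by linarith)
    rw [max_eq_left (by linarith)] at hcard
    have hc2 : |((((Finset.Ioc M (M + n)).filter (fun m => m ≡ v [ZMOD (D : ℤ)])).card : ℤ) : ℚ)
        - n / D| ≤ 1 := by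
      rw [hcard]
      have a1 := Int.floor_le x
      have a2 := Int.lt_floor_add_one x
      have a3 := Int.floor_le y
      have a4 := Int.lt_floor_add_one y
      push_cast
      rw [abs_le]
      constructor <;> linarith
    have hc3 : ((|((((Finset.Ioc M (M + n)).filter
        (fun m => m ≡ v [ZMOD (D : ℤ)])).card : ℤ) : ℚ) - n / D| : ℚ) : ℝ) ≤ ((1 : ℚ) : ℝ) := by
      exact_mod_cast hc2
    push_cast at hc3
    rw [mul_one_div]
    exact hc3
  · refine ⟨0, fun M n => ?_⟩
    rw [hsum, Finset.filter_false_of_mem fun m _ h => hex ⟨m, h⟩]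
    simp

/-- The factor `λ_R(m)` of a correlation if `s` holds, and the empty factor `1` otherwise. -/
noncomputable def activeLambda (s : Bool) (R : ℝ) (m : ℤ) : ℝ := if s then lambdaR R m else 1

/-- The activity as a real number. -/
noncomputable def act (s : Bool) : ℝ := if s then 1 else 0

theorem activeLambda_eq_primeIter (s : Bool) {R : ℝ} (hR : 1 ≤ R) {m : ℤ} (hm : 1 ≤ m) {Z : ℕ}
    (hZ : R < Z) : activeLambda s R m = primeIter (fun p => act s * locWeight m p) Z geOne R := by
  cases s with
  | true =>
    simp only [activeLambda, act, if_true, one_mul]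
    exact lambdaR_eq_primeIter (by linarith) hm hZ
  | false =>
    have : ∀ Z, primeIter (fun p => act false * locWeight m p) Z geOne R = 1 := by
      intro Z
      induction Z with
      | zero => simp [primeIter, geOne, hR]
      | succ Z ih =>
        simp only [primeIter, ih]
        simp [act]
    rw [this]
    rfl

theorem exists_activeLambda_coeff {K : ℝ} (hK : ∀ X : ℝ, 0 ≤ X → |sqfreeSum sigmaPhi 1 X| ≤ K * X)
    (s : Bool) {R : ℝ} (hR : 1 ≤ R) :
    ∃ c : ℕ → ℝ, (∀ m : ℤ, 1 ≤ m → activeLambda s R m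
        = ∑ d ∈ Finset.Icc 1 ⌊R⌋₊, c d * dvdInd d m) ∧
      ∑ d ∈ Finset.Icc 1 ⌊R⌋₊, |c d| ≤ if s then K * R else 1 := by
  cases s with
  | true =>
    refine ⟨lambdaCoeff R, fun m hm => ?_, ?_⟩
    · simp only [activeLambda, if_true]
      exact lambdaR_eq_sum_lambdaCoeff R hm
    · exact (sum_abs_lambdaCoeff_le R).trans ((le_abs_self _).trans (hK R (by linarith)))
  | false =>
    have h1 : 1 ∈ Finset.Icc 1 ⌊R⌋₊ := by simpa using hR
    refine ⟨fun d => if d = 1 then 1 else 0, fun m _ => ?_, ?_⟩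
    · simp only [ite_mul, one_mul, zero_mul, Finset.sum_ite_eq', if_pos h1]
      simp [activeLambda, dvdInd]
    · have : ∀ d : ℕ, |(if d = 1 then (1 : ℝ) else 0)| = if d = 1 then 1 else 0 := by
        intro d; split_ifs <;> simp
      simp only [this, Finset.sum_ite_eq', if_pos h1]
      simp

theorem sum_Ioc_eq_sum_range (f : ℤ → ℝ) (M : ℤ) (n : ℕ) :
    ∑ m ∈ Finset.Ioc M (M + n), f m = ∑ i ∈ Finset.range n, f (M + 1 + i) := by
  symm
  refine Finset.sum_nbij' (fun i => M + 1 + (i : ℤ)) (fun m => (m - M - 1).toNat) ?_ ?_ ?_ ?_ ?_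
  · intro i hi
    have := Finset.mem_range.mp hi
    rw [Finset.mem_Ioc]; omega
  · intro m hm
    have := Finset.mem_Ioc.mp hm
    rw [Finset.mem_range]; omega
  · intro i _
    omega
  · intro m hm
    have := Finset.mem_Ioc.mp hm
    omega
  · intro i _
    rfl

theorem sum_range_mul_periodic {f : ℕ → ℝ} {Q : ℕ} (hf : Function.Periodic f Q) (t : ℕ) :
    ∑ i ∈ Finset.range (t * Q), f i = t * ∑ i ∈ Finset.range Q, f i := by
  induction t with
  | zero => simp
  | succ t ih =>
    rw [Nat.succ_mul, Finset.sum_range_add, ih]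
    have : ∀ x, f (t * Q + x) = f x := by
      intro x
      have := hf.nat_mul t x
      rw [add_comm]
      simpa using this
    simp only [this]
    push_cast
    ring

/-- On intervals where all arguments are positive, a product of three divisor sums has mean value
`∏_p (1 + ∑_I m_p(I) S_I)`, evaluated at `(R, R, R)`, with the error `O(R)` for each active
factor. -/
theorem exists_abs_sum_activeLambda_sub_le : ∃ K : ℝ, 1 ≤ K ∧
    ∀ (s₁ s₂ s₃ : Bool) (j₁ j₂ j₃ : ℤ) (R : ℝ), 1 ≤ R → ∀ Z : ℕ, R < Z → ∀ M : ℤ,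
      0 ≤ M + j₁ → 0 ≤ M + j₂ → 0 ≤ M + j₃ → ∀ n : ℕ,
      |∑ m ∈ Finset.Ioc M (M + n), activeLambda s₁ R (m + j₁) * activeLambda s₂ R (m + j₂)
          * activeLambda s₃ R (m + j₃)
        - n * corrIter (shiftCoeff (act s₁) (act s₂) (act s₃) j₁ j₂ j₃) Z geOne₃ R R R|
      ≤ (if s₁ then K * R else 1) * (if s₂ then K * R else 1) * (if s₃ then K * R else 1) := by
  obtain ⟨K, hK1, hK⟩ := exists_sqfreeSum_sigmaPhi_le
  refine ⟨K, hK1, fun s₁ s₂ s₃ j₁ j₂ j₃ R hR Z hZ M hM1 hM2 hM3 => ?_⟩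
  set A := corrIter (shiftCoeff (act s₁) (act s₂) (act s₃) j₁ j₂ j₃) Z geOne₃ R R R with hA
  set E := (if s₁ then K * R else 1) * (if s₂ then K * R else 1) * (if s₃ then K * R else 1)
    with hE
  obtain ⟨c₁, hc1, hs1⟩ := exists_activeLambda_coeff hK s₁ hR
  obtain ⟨c₂, hc2, hs2⟩ := exists_activeLambda_coeff hK s₂ hR
  obtain ⟨c₃, hc3, hs3⟩ := exists_activeLambda_coeff hK s₃ hR
  set I := Finset.Icc 1 ⌊R⌋₊ with hI
  have hdens : ∀ d₁ d₂ d₃ : ℕ, ∃ ρ : ℝ, d₁ ∈ I → d₂ ∈ I → d₃ ∈ I → ∀ (n : ℕ),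
      |∑ m ∈ Finset.Ioc M (M + n),
        dvdInd d₁ (m + j₁) * dvdInd d₂ (m + j₂) * dvdInd d₃ (m + j₃) - n * ρ| ≤ 1 := by
    intro d₁ d₂ d₃
    by_cases h : d₁ ∈ I ∧ d₂ ∈ I ∧ d₃ ∈ I
    · obtain ⟨ρ, hρ⟩ := exists_density d₁ d₂ d₃ (Finset.mem_Icc.mp h.1).1
        (Finset.mem_Icc.mp h.2.1).1 (Finset.mem_Icc.mp h.2.2).1 j₁ j₂ j₃
      exact ⟨ρ, fun _ _ _ n => hρ M n⟩
    · exact ⟨0, fun a b c => absurd ⟨a, b, c⟩ h⟩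
  choose ρ hρ using hdens
  set B := ∑ d₁ ∈ I, ∑ d₂ ∈ I, ∑ d₃ ∈ I, c₁ d₁ * c₂ d₂ * c₃ d₃ * ρ d₁ d₂ d₃ with hB
  have hbound : ∀ n : ℕ, |∑ m ∈ Finset.Ioc M (M + n), activeLambda s₁ R (m + j₁)
      * activeLambda s₂ R (m + j₂) * activeLambda s₃ R (m + j₃) - n * B| ≤ E := by
    intro n
    have e1 : ∑ m ∈ Finset.Ioc M (M + n), activeLambda s₁ R (m + j₁)
        * activeLambda s₂ R (m + j₂) * activeLambda s₃ R (m + j₃)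
        = ∑ d₁ ∈ I, ∑ d₂ ∈ I, ∑ d₃ ∈ I, c₁ d₁ * c₂ d₂ * c₃ d₃ *
          ∑ m ∈ Finset.Ioc M (M + n),
            dvdInd d₁ (m + j₁) * dvdInd d₂ (m + j₂) * dvdInd d₃ (m + j₃) := by
      have : ∀ m ∈ Finset.Ioc M (M + n), activeLambda s₁ R (m + j₁)
          * activeLambda s₂ R (m + j₂) * activeLambda s₃ R (m + j₃)
          = ∑ d₁ ∈ I, ∑ d₂ ∈ I, ∑ d₃ ∈ I, c₁ d₁ * c₂ d₂ * c₃ d₃ *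
            (dvdInd d₁ (m + j₁) * dvdInd d₂ (m + j₂) * dvdInd d₃ (m + j₃)) := by
        intro m hm
        have hm' := (Finset.mem_Ioc.mp hm).1
        rw [hc1 _ (by omega), hc2 _ (by omega), hc3 _ (by omega), Finset.sum_mul_sum,
          Finset.sum_mul]
        refine Finset.sum_congr rfl fun d₁ _ => ?_
        rw [Finset.sum_mul]
        refine Finset.sum_congr rfl fun d₂ _ => ?_
        rw [Finset.mul_sum]
        refine Finset.sum_congr rfl fun d₃ _ => ?_
        ring
      rw [Finset.sum_congr rfl this, Finset.sum_comm]
      refine Finset.sum_congr rfl fun d₁ _ => ?_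
      rw [Finset.sum_comm]
      refine Finset.sum_congr rfl fun d₂ _ => ?_
      rw [Finset.sum_comm]
      refine Finset.sum_congr rfl fun d₃ _ => ?_
      rw [Finset.mul_sum]
    rw [e1, hB]
    rw [Finset.mul_sum, ← Finset.sum_sub_distrib]
    have h3 : ∀ d₁ ∈ I, ∀ d₂ ∈ I, ∀ d₃ ∈ I, |c₁ d₁ * c₂ d₂ * c₃ d₃ *
          ∑ m ∈ Finset.Ioc M (M + n),
            dvdInd d₁ (m + j₁) * dvdInd d₂ (m + j₂) * dvdInd d₃ (m + j₃)
          - n * (c₁ d₁ * c₂ d₂ * c₃ d₃ * ρ d₁ d₂ d₃)| ≤ |c₁ d₁| * |c₂ d₂| * |c₃ d₃| := by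
      intro d₁ i1 d₂ i2 d₃ i3
      have h := hρ d₁ d₂ d₃ i1 i2 i3 n
      rw [show ∀ a x y z : ℝ, a * x - y * (a * z) = a * (x - y * z) by intros; ring, abs_mul,
        abs_mul, abs_mul]
      exact mul_le_of_le_one_right (by positivity) h
    calc _ ≤ ∑ d₁ ∈ I, ∑ d₂ ∈ I, ∑ d₃ ∈ I, |c₁ d₁| * |c₂ d₂| * |c₃ d₃| := by
          refine (Finset.abs_sum_le_sum_abs _ _).trans (Finset.sum_le_sum fun d₁ i1 => ?_)
          rw [Finset.mul_sum, ← Finset.sum_sub_distrib]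
          refine (Finset.abs_sum_le_sum_abs _ _).trans (Finset.sum_le_sum fun d₂ i2 => ?_)
          rw [Finset.mul_sum, ← Finset.sum_sub_distrib]
          refine (Finset.abs_sum_le_sum_abs _ _).trans (Finset.sum_le_sum fun d₃ i3 => ?_)
          exact h3 d₁ i1 d₂ i2 d₃ i3
      _ = (∑ d₁ ∈ I, |c₁ d₁|) * (∑ d₂ ∈ I, |c₂ d₂|) * ∑ d₃ ∈ I, |c₃ d₃| := by
          rw [Finset.sum_mul_sum, Finset.sum_mul]
          refine Finset.sum_congr rfl fun d₁ _ => ?_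
          rw [Finset.sum_mul]
          refine Finset.sum_congr rfl fun d₂ _ => ?_
          rw [Finset.mul_sum]
      _ ≤ E := by
          have hpos : ∀ c : ℕ → ℝ, 0 ≤ ∑ d ∈ I, |c d| := fun c =>
            Finset.sum_nonneg fun d _ => abs_nonneg _
          have q1 := (hpos c₁).trans hs1
          have q2 := (hpos c₂).trans hs2
          exact mul_le_mul (mul_le_mul hs1 hs2 (hpos _) q1) hs3 (hpos _) (mul_nonneg q1 q2)
  -- the mean value over many periods identifies the density `B` with `A`
  have hQ := primeProd_pos Z
  have hper : ∀ t : ℕ, ∑ m ∈ Finset.Ioc M (M + (t * primeProd Z : ℕ)), activeLambda s₁ R (m + j₁)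
      * activeLambda s₂ R (m + j₂) * activeLambda s₃ R (m + j₃) = t * (primeProd Z * A) := by
    intro t
    rw [sum_Ioc_eq_sum_range]
    have e : ∀ i : ℕ, activeLambda s₁ R (M + 1 + i + j₁) * activeLambda s₂ R (M + 1 + i + j₂)
        * activeLambda s₃ R (M + 1 + i + j₃)
        = sieveSum (act s₁) (M + 1 + j₁) Z R i * sieveSum (act s₂) (M + 1 + j₂) Z R i
          * sieveSum (act s₃) (M + 1 + j₃) Z R i := by
      intro i
      rw [activeLambda_eq_primeIter s₁ hR (by omega) hZ,
        activeLambda_eq_primeIter s₂ hR (by omega) hZ,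
        activeLambda_eq_primeIter s₃ hR (by omega) hZ]
      unfold sieveSum
      rw [show (i : ℤ) + (M + 1 + j₁) = M + 1 + i + j₁ by ring,
        show (i : ℤ) + (M + 1 + j₂) = M + 1 + i + j₂ by ring,
        show (i : ℤ) + (M + 1 + j₃) = M + 1 + i + j₃ by ring]
    simp only [e]
    have hp := ((sieveSum_periodic (act s₁) (M + 1 + j₁) Z R).mul
      (sieveSum_periodic (act s₂) (M + 1 + j₂) Z R)).mul
      (sieveSum_periodic (act s₃) (M + 1 + j₃) Z R)
    have := sum_range_mul_periodic hp t
    simp only [Pi.mul_apply] at this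
    rw [this, sum_sieveSum_triple, hA]
    have hsc : shiftCoeff (act s₁) (act s₂) (act s₃) (M + 1 + j₁) (M + 1 + j₂) (M + 1 + j₃)
        = shiftCoeff (act s₁) (act s₂) (act s₃) j₁ j₂ j₃ := by
      unfold shiftCoeff
      congr 1 <;> funext p <;> simp only [pairCoeff, tripleCoeff, add_sub_add_left_eq_sub]
    rw [hsc]
  have hAB : A = B := by
    by_contra hne
    have hpos : 0 < |A - B| := abs_pos.mpr (sub_ne_zero.mpr hne)
    obtain ⟨t, ht⟩ := exists_nat_gt (E / |A - B|)
    rw [div_lt_iff₀ hpos] at ht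
    have h := hbound (t * primeProd Z)
    rw [hper] at h
    push_cast at h
    rw [show (t : ℝ) * (primeProd Z * A) - t * primeProd Z * B
      = (t * primeProd Z) * (A - B) by ring, abs_mul, abs_of_nonneg (by positivity)] at h
    have hQ1 : (1 : ℝ) ≤ primeProd Z := by exact_mod_cast hQ
    have : (t : ℝ) * |A - B| ≤ t * primeProd Z * |A - B| := by
      refine mul_le_mul_of_nonneg_right ?_ hpos.le
      exact le_mul_of_one_le_right (Nat.cast_nonneg t) hQ1
    linarith
  rw [hAB]
  exact hbound

/-! ### Distinct shifts: absolute convergence -/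

theorem div_natCast_lt_one {X : ℝ} (hX : X < 1) (n : ℕ) : X / n < 1 := by
  rcases le_or_gt X 0 with h | h
  · exact lt_of_le_of_lt (div_nonpos_of_nonpos_of_nonneg h (Nat.cast_nonneg n)) one_pos
  · rcases Nat.eq_zero_or_pos n with rfl | hn
    · simp
    · exact lt_of_le_of_lt (div_le_self h.le (by exact_mod_cast hn)) hX

/-- A function of three variables that vanishes as soon as one of the variables is less than one. -/
def VanishesBelowOne (f : ℝ → ℝ → ℝ → ℝ) : Prop :=
  ∀ X Y W : ℝ, X < 1 ∨ Y < 1 ∨ W < 1 → f X Y W = 0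

theorem vanishesBelowOne_geOne₃ : VanishesBelowOne geOne₃ := by
  rintro X Y W (h | h | h) <;> simp [geOne₃, geOne, not_le.mpr h]

theorem VanishesBelowOne.corrIter {f : ℝ → ℝ → ℝ → ℝ} (hf : VanishesBelowOne f) (C : CorrCoeff)
    (Z : ℕ) : VanishesBelowOne (corrIter C Z f) := by
  induction Z with
  | zero => exact hf
  | succ Z ih =>
    intro X Y W h
    have hd : ∀ {x : ℝ}, x < 1 → x / Z < 1 := fun h => div_natCast_lt_one h Z
    simp only [_root_.corrIter, corrOp]
    rw [ih X Y W h, ih (X / Z) (Y / Z) W (h.imp hd (Or.imp hd id)),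
      ih (X / Z) Y (W / Z) (h.imp hd (Or.imp id hd)),
      ih X (Y / Z) (W / Z) (h.imp id (Or.imp hd hd)),
      ih (X / Z) (Y / Z) (W / Z) (h.imp hd (Or.imp hd hd))]
    ring

theorem corrIter_geOne₃_stable (C : CorrCoeff) {R : ℝ} (hR : 0 ≤ R) {Z Z' : ℕ} (hZ : R < Z)
    (hZZ' : Z ≤ Z') : corrIter C Z' geOne₃ R R R = corrIter C Z geOne₃ R R R := by
  induction Z', hZZ' using Nat.le_induction with
  | base => rfl
  | succ n hn ih =>
    have hRn : R < n := lt_of_lt_of_le hZ (by exact_mod_cast hn)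
    have h1 : R / n < 1 := (div_lt_one (by linarith)).mpr hRn
    have hv := vanishesBelowOne_geOne₃.corrIter C n
    simp only [corrIter, corrOp]
    rw [hv (R / n) (R / n) R (Or.inl h1), hv (R / n) R (R / n) (Or.inl h1),
      hv R (R / n) (R / n) (Or.inr (Or.inl h1)), hv (R / n) (R / n) (R / n) (Or.inl h1), ih]
    ring

/-- The Euler factor of the formal product `∏_p (1 + ∑_I c_I(p) S_I)` at `S = 1`. -/
noncomputable def CorrCoeff.factor (C : CorrCoeff) (p : ℕ) : ℝ :=
  1 + (C.c12 p + C.c13 p + C.c23 p + C.c123 p)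

/-- The total absolute mass of the local coefficients. -/
noncomputable def CorrCoeff.mass (C : CorrCoeff) (p : ℕ) : ℝ :=
  |C.c12 p| + |C.c13 p| + |C.c23 p| + |C.c123 p|

theorem CorrCoeff.mass_nonneg (C : CorrCoeff) (p : ℕ) : 0 ≤ C.mass p := by
  unfold CorrCoeff.mass; positivity

theorem CorrCoeff.abs_factor_le (C : CorrCoeff) (p : ℕ) : |C.factor p| ≤ 1 + C.mass p := by
  unfold CorrCoeff.factor CorrCoeff.mass
  have h1 := abs_add_le (C.c12 p + C.c13 p + C.c23 p) (C.c123 p)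
  have h2 := abs_add_le (C.c12 p + C.c13 p) (C.c23 p)
  have h3 := abs_add_le (C.c12 p) (C.c13 p)
  have h4 := abs_add_le 1 (C.c12 p + C.c13 p + C.c23 p + C.c123 p)
  rw [abs_one] at h4
  linarith

theorem CorrCoeff.OnPrimes.mass_eq_zero {C : CorrCoeff} (hC : C.OnPrimes) {n : ℕ}
    (hn : ¬ n.Prime) : C.mass n = 0 := by
  obtain ⟨h1, h2, h3, h4⟩ := hC n hn
  simp [CorrCoeff.mass, h1, h2, h3, h4]

theorem CorrCoeff.OnPrimes.factor_eq_one {C : CorrCoeff} (hC : C.OnPrimes) {n : ℕ}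
    (hn : ¬ n.Prime) : C.factor n = 1 := by
  obtain ⟨h1, h2, h3, h4⟩ := hC n hn
  simp [CorrCoeff.factor, h1, h2, h3, h4]

/-- Rankin's trick, carried out one prime at a time: the truncation of an absolutely convergent
sum at `X, Y, W` costs a power saving. -/
theorem abs_corrIter_geOne₃_sub_prod_le {C : CorrCoeff} (hC : C.OnPrimes) (Z : ℕ) {X Y W : ℝ}
    (hX : 0 < X) (hY : 0 < Y) (hW : 0 < W) :
    |corrIter C Z geOne₃ X Y W - ∏ n ∈ Finset.range Z, C.factor n|
      ≤ (∏ n ∈ Finset.range Z, (1 + √(n : ℝ) * C.mass n)) * (1 / √X + 1 / √Y + 1 / √W) := by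
  induction Z generalizing X Y W with
  | zero =>
    simp only [corrIter, Finset.range_zero, Finset.prod_empty, one_mul]
    have hx : 0 < 1 / √X := by positivity
    have hy : 0 < 1 / √Y := by positivity
    have hw : 0 < 1 / √W := by positivity
    have hlt : ∀ {x : ℝ}, 0 < x → x < 1 → 1 ≤ 1 / √x := by
      intro x h0 h1
      rw [le_div_iff₀ (Real.sqrt_pos.mpr h0), one_mul]
      exact Real.sqrt_le_one.mpr h1.le
    by_cases h : X < 1 ∨ Y < 1 ∨ W < 1
    · rw [vanishesBelowOne_geOne₃ X Y W h, zero_sub, abs_neg, abs_one]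
      rcases h with h | h | h
      · linarith [hlt hX h]
      · linarith [hlt hY h]
      · linarith [hlt hW h]
    · push Not at h
      simp only [geOne₃, geOne, if_pos h.1, if_pos h.2.1, if_pos h.2.2]
      simp only [mul_one, sub_self, abs_zero]
      positivity
  | succ Z ih =>
    set B := ∏ n ∈ Finset.range Z, (1 + √(n : ℝ) * C.mass n) with hB
    have hB0 : 0 ≤ B := Finset.prod_nonneg fun n _ => by
      have := C.mass_nonneg n; positivity
    set P := ∏ n ∈ Finset.range Z, C.factor n with hP
    rw [Finset.prod_range_succ, Finset.prod_range_succ, ← hB, ← hP]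
    by_cases hZ : Z.Prime
    · have hp0 : (0 : ℝ) < Z := by exact_mod_cast hZ.pos
      have hp1 : (1 : ℝ) ≤ √(Z : ℝ) := by
        rw [Real.one_le_sqrt]; exact_mod_cast hZ.one_le
      have hs0 : 0 < √(Z : ℝ) := by linarith
      set w := 1 / √X + 1 / √Y + 1 / √W with hw
      have hw0 : 0 < w := by positivity
      have hdiv : ∀ {x : ℝ}, 0 < x → 1 / √(x / Z) = √(Z : ℝ) * (1 / √x) := by
        intro x hx
        rw [Real.sqrt_div hx.le]; field_simp
      have hmono : ∀ {x : ℝ}, 0 < x → 1 / √x ≤ √(Z : ℝ) * (1 / √x) := fun {x} hx =>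
        le_mul_of_one_le_left (by positivity) hp1
      have hX' : 0 < X / Z := by positivity
      have hY' : 0 < Y / Z := by positivity
      have hW' : 0 < W / Z := by positivity
      have e12 := ih hX' hY' hW
      have e13 := ih hX' hY hW'
      have e23 := ih hX hY' hW'
      have e123 := ih hX' hY' hW'
      have e0 := ih hX hY hW
      rw [hdiv hX, hdiv hY] at e12
      rw [hdiv hX, hdiv hW] at e13
      rw [hdiv hY, hdiv hW] at e23
      rw [hdiv hX, hdiv hY, hdiv hW] at e123
      have b12 : |corrIter C Z geOne₃ (X / Z) (Y / Z) W - P| ≤ √(Z : ℝ) * (B * w) :=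
        e12.trans (by rw [hw]; nlinarith [mul_le_mul_of_nonneg_left (hmono hW) hB0])
      have b13 : |corrIter C Z geOne₃ (X / Z) Y (W / Z) - P| ≤ √(Z : ℝ) * (B * w) :=
        e13.trans (by rw [hw]; nlinarith [mul_le_mul_of_nonneg_left (hmono hY) hB0])
      have b23 : |corrIter C Z geOne₃ X (Y / Z) (W / Z) - P| ≤ √(Z : ℝ) * (B * w) :=
        e23.trans (by rw [hw]; nlinarith [mul_le_mul_of_nonneg_left (hmono hX) hB0])
      have b123 : |corrIter C Z geOne₃ (X / Z) (Y / Z) (W / Z) - P| ≤ √(Z : ℝ) * (B * w) :=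
        e123.trans (by rw [hw]; linarith)
      have hid : corrIter C (Z + 1) geOne₃ X Y W - P * C.factor Z
          = (corrIter C Z geOne₃ X Y W - P)
            + C.c12 Z * (corrIter C Z geOne₃ (X / Z) (Y / Z) W - P)
            + C.c13 Z * (corrIter C Z geOne₃ (X / Z) Y (W / Z) - P)
            + C.c23 Z * (corrIter C Z geOne₃ X (Y / Z) (W / Z) - P)
            + C.c123 Z * (corrIter C Z geOne₃ (X / Z) (Y / Z) (W / Z) - P) := by
        simp only [corrIter, corrOp, CorrCoeff.factor]
        ring
      rw [hid]
      have tri : ∀ a b c d e : ℝ, |a + b + c + d + e| ≤ |a| + |b| + |c| + |d| + |e| := by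
        intro a b c d e
        have h1 := abs_add_le (a + b + c + d) e
        have h2 := abs_add_le (a + b + c) d
        have h3 := abs_add_le (a + b) c
        have h4 := abs_add_le a b
        linarith
      refine (tri _ _ _ _ _).trans ?_
      rw [abs_mul, abs_mul, abs_mul, abs_mul]
      have m12 := mul_le_mul_of_nonneg_left b12 (abs_nonneg (C.c12 Z))
      have m13 := mul_le_mul_of_nonneg_left b13 (abs_nonneg (C.c13 Z))
      have m23 := mul_le_mul_of_nonneg_left b23 (abs_nonneg (C.c23 Z))
      have m123 := mul_le_mul_of_nonneg_left b123 (abs_nonneg (C.c123 Z))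
      have hfin : B * (1 + √(Z : ℝ) * C.mass Z) * w = B * w + |C.c12 Z| * (√(Z : ℝ) * (B * w))
          + |C.c13 Z| * (√(Z : ℝ) * (B * w)) + |C.c23 Z| * (√(Z : ℝ) * (B * w))
          + |C.c123 Z| * (√(Z : ℝ) * (B * w)) := by
        simp only [CorrCoeff.mass]; ring
      rw [hfin]
      linarith
    · simp only [corrIter, corrOp_of_not_prime hC hZ, hC.factor_eq_one hZ, hC.mass_eq_zero hZ,
        mul_zero, add_zero, mul_one]
      exact ih hX hY hW

/-- `A^{ω(D)} ≪_η D^η`. -/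
theorem exists_pow_card_primeFactors_le {A η : ℝ} (hA : 1 ≤ A) (hη : 0 < η) :
    ∃ C : ℝ, 1 ≤ C ∧ ∀ D : ℕ, 0 < D → A ^ D.primeFactors.card ≤ C * (D : ℝ) ^ η := by
  obtain ⟨P, hP⟩ := exists_nat_gt (A ^ (1 / η))
  have hP0 : (0 : ℝ) < P := lt_trans (Real.rpow_pos_of_pos (by linarith) _) hP
  refine ⟨A ^ P, one_le_pow₀ hA, fun D hD => ?_⟩
  have h1 : A ^ D.primeFactors.card ≤ ∏ p ∈ D.primeFactors, ((if p < P then A else 1) *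
      (p : ℝ) ^ η) := by
    rw [← Finset.prod_const]
    refine Finset.prod_le_prod (fun _ _ => by linarith) fun p hp => ?_
    have hp1 : (1 : ℝ) ≤ p := by exact_mod_cast (Nat.prime_of_mem_primeFactors hp).one_le
    have hpη : 1 ≤ (p : ℝ) ^ η := Real.one_le_rpow hp1 hη.le
    split_ifs with h
    · exact le_mul_of_one_le_right (by linarith) hpη
    · rw [one_mul]
      push Not at h
      have h2 : (P : ℝ) ≤ p := by exact_mod_cast h
      calc A = (A ^ (1 / η)) ^ η := by
            rw [← Real.rpow_mul (by linarith), one_div_mul_cancel hη.ne', Real.rpow_one]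
        _ ≤ (p : ℝ) ^ η := by
            refine Real.rpow_le_rpow (by positivity) (by linarith) hη.le
  refine h1.trans ?_
  rw [Finset.prod_mul_distrib]
  have h2 : ∏ p ∈ D.primeFactors, (if p < P then A else 1) ≤ A ^ P := by
    rw [← Finset.prod_filter, Finset.prod_const]
    refine pow_le_pow_right₀ hA ?_
    calc _ ≤ (Finset.range P).card := Finset.card_le_card fun p hp =>
          Finset.mem_range.mpr (Finset.mem_filter.mp hp).2
      _ = P := Finset.card_range P
  have h3 : ∏ p ∈ D.primeFactors, (p : ℝ) ^ η ≤ (D : ℝ) ^ η := by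
    rw [Real.finsetProd_rpow _ _ fun p _ => Nat.cast_nonneg p]
    refine Real.rpow_le_rpow (Finset.prod_nonneg fun p _ => Nat.cast_nonneg p) ?_ hη.le
    rw [← Nat.cast_prod]
    exact_mod_cast Nat.le_of_dvd hD (Nat.prod_primeFactors_dvd D)
  exact mul_le_mul h2 h3 (Finset.prod_nonneg fun p _ => by positivity) (by positivity)

/-- The coefficients are `O(1/p²)`, except at the prime divisors of `D`, where they are
`O(1/p)`. -/
def CorrCoeff.MassBound (C : CorrCoeff) (K : ℝ) (D : ℕ) : Prop :=
  ∀ p : ℕ, p.Prime → C.mass p ≤ K / p ∧ (¬ p ∣ D → C.mass p ≤ K / (p : ℝ) ^ 2)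

theorem exists_prod_sqrt_mass_le {K η : ℝ} (hK : 0 ≤ K) (hη : 0 < η) :
    ∃ B : ℝ, 1 ≤ B ∧ ∀ (C : CorrCoeff) (D : ℕ), C.OnPrimes → 0 < D → C.MassBound K D →
      ∀ Z : ℕ, ∏ n ∈ Finset.range Z, (1 + √(n : ℝ) * C.mass n) ≤ B * (D : ℝ) ^ η := by
  obtain ⟨B₁, hB1, hB1'⟩ := exists_prod_threeHalves_le hK
  obtain ⟨B₂, hB2, hB2'⟩ := exists_pow_card_primeFactors_le (A := 1 + K) (by linarith) hη
  refine ⟨B₁ * B₂, one_le_mul_of_one_le_of_one_le hB1 hB2, fun C D hC hD hCD Z => ?_⟩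
  have hpt : ∀ n ∈ Finset.range Z, 1 + √(n : ℝ) * C.mass n
      ≤ (1 + K * threeHalves n) * (if n ∈ D.primeFactors then 1 + K else 1) := by
    intro n _
    have hth := threeHalves_nonneg n
    by_cases hn : n.Prime
    · have hn1 : (1 : ℝ) ≤ n := by exact_mod_cast hn.one_le
      have hn0 : (0 : ℝ) < n := by linarith
      have hs1 : 1 ≤ √(n : ℝ) := Real.one_le_sqrt.mpr hn1
      have hss : √(n : ℝ) * √(n : ℝ) = n := Real.mul_self_sqrt hn0.le
      obtain ⟨h1, h2⟩ := hCD n hn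
      split_ifs with hmem
      · have h3 : √(n : ℝ) * C.mass n ≤ K := by
          calc √(n : ℝ) * C.mass n ≤ √(n : ℝ) * (K / n) := by gcongr
            _ = K / √(n : ℝ) := by
              rw [← hss]; field_simp
              rw [Real.sqrt_sq (Real.sqrt_nonneg _)]
            _ ≤ K := div_le_self hK hs1
        nlinarith [mul_nonneg hK hth, mul_nonneg (mul_nonneg hK hth) hK]
      · have hnd : ¬ n ∣ D := fun h => hmem (Nat.mem_primeFactors.mpr ⟨hn, h, hD.ne'⟩)
        have h3 := h2 hnd
        have h4 := one_div_sq_le_threeHalves hn1 (δ := 1 / 2) le_rfl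
        rw [mul_one, add_le_add_iff_left]
        calc √(n : ℝ) * C.mass n ≤ √(n : ℝ) * (K / (n : ℝ) ^ 2) := by gcongr
          _ = K * ((n : ℝ) ^ (1 / 2 : ℝ) / (n : ℝ) ^ 2) := by rw [Real.sqrt_eq_rpow]; ring
          _ ≤ K * threeHalves n := mul_le_mul_of_nonneg_left h4 hK
    · rw [hC.mass_eq_zero hn, if_neg fun h => hn (Nat.prime_of_mem_primeFactors h)]
      nlinarith [mul_nonneg hK hth]
  refine (Finset.prod_le_prod (fun n _ => ?_) hpt).trans ?_
  · have := C.mass_nonneg n; positivity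
  rw [Finset.prod_mul_distrib, mul_assoc]
  refine mul_le_mul (hB1' Z) ?_ (Finset.prod_nonneg fun n _ => by split_ifs <;> linarith)
    (by linarith)
  refine le_trans ?_ (hB2' D hD)
  rw [← Finset.prod_filter, Finset.prod_const]
  refine pow_le_pow_right₀ (by linarith) (Finset.card_le_card fun p hp => ?_)
  exact (Finset.mem_filter.mp hp).2

theorem tendsto_prod_singularFactor {r : ℕ} (j : Fin r → ℤ) (hj : Function.Injective j)
    {F : ℕ → ℝ} (hF : ∀ p : ℕ, p.Prime → F p = singularFactor j p)
    (hF' : ∀ n : ℕ, ¬ n.Prime → F n = 1) :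
    Filter.Tendsto (fun Z => ∏ n ∈ Finset.range Z, F n) Filter.atTop
      (nhds (singularSeries j)) := by
  have h1 : HasProd (fun p : Nat.Primes => singularFactor j (p : ℕ)) (singularSeries j) :=
    (multipliable_singularFactor j hj).hasProd
  have h2 : HasProd F (singularSeries j) := by
    have h3 : HasProd (F ∘ ((↑) : {p : ℕ | p.Prime} → ℕ)) (singularSeries j) := by
      have : (F ∘ ((↑) : {p : ℕ | p.Prime} → ℕ))
          = fun p : Nat.Primes => singularFactor j (p : ℕ) := by
        funext p; exact hF p p.2
      rw [this]; exact h1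
    rw [hasProd_subtype_iff_mulIndicator] at h3
    convert h3 using 1
    funext n
    by_cases hn : n.Prime
    · rw [Set.mulIndicator_of_mem (by exact hn)]
    · rw [Set.mulIndicator_of_notMem (by exact hn), hF' n hn]
  exact h2.tendsto_prod_nat

/-- If the coefficients are absolutely summable, the three-fold sum up to `R` is the Euler product
up to a power saving in `R`. -/
theorem exists_abs_corrIter_sub_singularSeries_le {K η : ℝ} (hK : 0 ≤ K) (hη : 0 < η) :
    ∃ B : ℝ, 1 ≤ B ∧ ∀ (C : CorrCoeff) (D : ℕ), C.OnPrimes → 0 < D → C.MassBound K D →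
      ∀ (r : ℕ) (j : Fin r → ℤ), Function.Injective j →
      (∀ p : ℕ, p.Prime → C.factor p = singularFactor j p) →
      |singularSeries j| ≤ B * (D : ℝ) ^ η ∧
      ∀ R : ℝ, 1 ≤ R → ∀ Z : ℕ, R < Z →
        |corrIter C Z geOne₃ R R R - singularSeries j| ≤ B * (D : ℝ) ^ η * (3 / √R) := by
  obtain ⟨B, hB1, hB⟩ := exists_prod_sqrt_mass_le hK hη
  refine ⟨B, hB1, fun C D hC hD hCD r j hj hfac => ?_⟩
  have hlim := tendsto_prod_singularFactor j hj hfac fun n hn => hC.factor_eq_one hn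
  refine ⟨?_, fun R hR Z hZ => ?_⟩
  · refine le_of_tendsto hlim.abs (Filter.Eventually.of_forall fun Z => ?_)
    refine le_trans ?_ (hB C D hC hD hCD Z)
    rw [Finset.abs_prod]
    refine Finset.prod_le_prod (fun _ _ => abs_nonneg _) fun n _ => ?_
    refine (C.abs_factor_le n).trans ?_
    rcases Nat.eq_zero_or_pos n with rfl | hn
    · rw [hC.mass_eq_zero Nat.not_prime_zero]; simp
    · have : 1 ≤ √(n : ℝ) := Real.one_le_sqrt.mpr (by exact_mod_cast hn)
      have := le_mul_of_one_le_left (C.mass_nonneg n) this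
      linarith
  · refine le_of_tendsto (hlim.const_sub (corrIter C Z geOne₃ R R R)).abs ?_
    filter_upwards [Filter.eventually_ge_atTop Z] with Z' hZ'
    rw [← corrIter_geOne₃_stable C (by linarith) hZ hZ']
    have h0 : 0 < R := by linarith
    refine (abs_corrIter_geOne₃_sub_prod_le hC Z' h0 h0 h0).trans ?_
    have e : 1 / √R + 1 / √R + 1 / √R = 3 / √R := by ring
    rw [e]
    exact mul_le_mul_of_nonneg_right (hB C D hC hD hCD Z') (by positivity)

/-! ### Sums over the prime divisors of an integer -/

open Chebyshev in
theorem sum_one_div_prime_dyadic_le (k : ℕ) (hk : 1 ≤ k) :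
    ∑ p ∈ (Finset.Ioc (2 ^ k) (2 ^ (k + 1))).filter Nat.Prime, 1 / (p : ℝ) ≤ 4 / k := by
  have hk0 : (0 : ℝ) < k := by exact_mod_cast hk
  have hl2 : 0 < Real.log 2 := Real.log_pos (by norm_num)
  have h2k : (0 : ℝ) < 2 ^ k := by positivity
  have h1 : ∀ p ∈ (Finset.Ioc (2 ^ k) (2 ^ (k + 1))).filter Nat.Prime,
      1 / (p : ℝ) ≤ (1 / (2 ^ k * (k * Real.log 2))) * Real.log p := by
    intro p hp
    have hp' := Finset.mem_Ioc.mp (Finset.mem_filter.mp hp).1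
    have hlt : (2 : ℝ) ^ k < p := by exact_mod_cast hp'.1
    have hlog : (k : ℝ) * Real.log 2 ≤ Real.log p := by
      rw [← Real.log_pow]; exact Real.log_le_log h2k hlt.le
    calc 1 / (p : ℝ) ≤ 1 / 2 ^ k := one_div_le_one_div_of_le h2k hlt.le
      _ = (1 / (2 ^ k * (k * Real.log 2))) * (k * Real.log 2) := by field_simp
      _ ≤ _ := by gcongr
  have h2 : ∑ p ∈ (Finset.Ioc (2 ^ k) (2 ^ (k + 1))).filter Nat.Prime, Real.log p
      ≤ Real.log 4 * 2 ^ (k + 1) := by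
    have h3 := theta_le_log4_mul_x (x := ((2 ^ (k + 1) : ℕ) : ℝ)) (by positivity)
    have h4 : ∑ p ∈ (Finset.Ioc (2 ^ k) (2 ^ (k + 1))).filter Nat.Prime, Real.log p
        ≤ θ ((2 ^ (k + 1) : ℕ) : ℝ) := by
      unfold Chebyshev.theta
      rw [Nat.floor_natCast]
      refine Finset.sum_le_sum_of_subset_of_nonneg (Finset.filter_subset_filter _
        (Finset.Ioc_subset_Ioc_left (Nat.zero_le _))) fun p _ _ => Real.log_natCast_nonneg p
    push_cast at h3 h4
    exact h4.trans h3
  calc _ ≤ _ := Finset.sum_le_sum h1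
    _ = (1 / (2 ^ k * (k * Real.log 2))) * _ := (Finset.mul_sum _ _ _).symm
    _ ≤ (1 / (2 ^ k * (k * Real.log 2))) * (Real.log 4 * 2 ^ (k + 1)) := by gcongr
    _ = 4 / k := by
        rw [show (4 : ℝ) = 2 ^ 2 by norm_num, Real.log_pow, pow_succ]
        field_simp
        norm_num

/-- The weak form `∑_{p ≤ 2^m} 1/p ≤ 5 + 4 log m` of Mertens' theorem. -/
theorem sum_one_div_prime_le (m : ℕ) (hm : 1 ≤ m) :
    ∑ p ∈ (Finset.Icc 1 (2 ^ m)).filter Nat.Prime, 1 / (p : ℝ) ≤ 5 + 4 * Real.log m := by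
  have h1 : ∀ m : ℕ, ∑ p ∈ (Finset.Icc 1 (2 ^ (m + 1))).filter Nat.Prime, 1 / (p : ℝ)
      ≤ 1 + 4 * (harmonic m : ℝ) := by
    intro m
    induction m with
    | zero =>
      have : (Finset.Icc 1 (2 ^ (0 + 1))).filter Nat.Prime = {2} := by decide
      rw [this]
      norm_num
    | succ m ih =>
      have e : (Finset.Icc 1 (2 ^ (m + 1 + 1))).filter Nat.Prime
          = (Finset.Icc 1 (2 ^ (m + 1))).filter Nat.Prime
            ∪ (Finset.Ioc (2 ^ (m + 1)) (2 ^ (m + 1 + 1))).filter Nat.Prime := by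
        rw [← Finset.filter_union]
        congr 1
        ext x
        have : 2 ^ (m + 1) ≤ 2 ^ (m + 1 + 1) := Nat.pow_le_pow_right (by norm_num) (by omega)
        have : 1 ≤ 2 ^ (m + 1) := Nat.one_le_two_pow
        simp only [Finset.mem_Icc, Finset.mem_union, Finset.mem_Ioc]
        omega
      rw [e, Finset.sum_union]
      · have h2 := sum_one_div_prime_dyadic_le (m + 1) (by omega)
        rw [harmonic_succ]
        push_cast at h2 ⊢
        have h3 : 4 / ((m : ℝ) + 1) = 4 * ((m : ℝ) + 1)⁻¹ := by ring
        linarith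
      · refine Finset.disjoint_filter_filter (Finset.disjoint_left.mpr fun x h1 h2 => ?_)
        have h1' := Finset.mem_Icc.mp h1
        have h2' := Finset.mem_Ioc.mp h2
        omega
  obtain ⟨n, rfl⟩ : ∃ n, m = n + 1 := ⟨m - 1, by omega⟩
  have h2 := harmonic_le_one_add_log n
  have h3 : Real.log (n : ℝ) ≤ Real.log ((n + 1 : ℕ) : ℝ) := by
    rcases Nat.eq_zero_or_pos n with rfl | hn
    · simp
    · exact Real.log_le_log (by exact_mod_cast hn) (by push_cast; linarith)
  linarith [h1 n]

theorem sum_log_primeFactors_le {D : ℕ} (hD : 0 < D) :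
    ∑ p ∈ D.primeFactors, Real.log p ≤ Real.log D := by
  rw [← Real.log_prod fun p hp => by
    exact_mod_cast (Nat.prime_of_mem_primeFactors hp).ne_zero, ← Nat.cast_prod]
  refine Real.log_le_log ?_ ?_
  · exact_mod_cast Finset.prod_pos fun p hp => (Nat.prime_of_mem_primeFactors hp).pos
  · exact_mod_cast Nat.le_of_dvd hD (Nat.prod_primeFactors_dvd D)

/-- Both `∏_{p ∣ D} (1 + O(1/p))` and `∑_{p ∣ D} log p / p` are smaller than any power of `log D`:
the primes above `log D` contribute a bounded amount, and for those below `log D` one uses the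
estimate for the sum of `1/p`. -/
theorem exists_primeFactors_sums_le {K : ℝ} (hK : 0 ≤ K) :
    ∃ B : ℝ, 0 ≤ B ∧ ∀ D : ℕ, 0 < D →
      Real.exp (K * ∑ p ∈ D.primeFactors, 1 / (p : ℝ)) *
        (1 + ∑ p ∈ D.primeFactors, Real.log p / p) ≤ B * √(1 + Real.log D) := by
  -- with `y = 1 + log D` one has `m ≤ 3 y^δ / δ` for `2^(m-1) ≤ y < 2^m`
  set δ : ℝ := 1 / (4 * (4 * K + 2)) with hδ
  have hδ0 : 0 < δ := by positivity
  refine ⟨Real.exp (8 * K) * (3 / δ) ^ (4 * K) * (2 + (1 + 1 / δ) ^ 2), by positivity,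
    fun D hD => ?_⟩
  have hD1 : (1 : ℝ) ≤ D := by exact_mod_cast hD
  have hlD : 0 ≤ Real.log D := Real.log_nonneg hD1
  set y := 1 + Real.log D with hy
  have hy1 : 1 ≤ y := by linarith
  have hly : 0 ≤ Real.log y := Real.log_nonneg hy1
  have hl2 : 0 < Real.log 2 := Real.log_pos (by norm_num)
  have hl2' : (1 : ℝ) / 2 < Real.log 2 := by linarith [Real.log_two_gt_d9]
  set m := Nat.log 2 ⌊y⌋₊ + 1 with hm
  have hfl1 : 1 ≤ ⌊y⌋₊ := by rwa [Nat.one_le_floor_iff]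
  have hlt : y < 2 ^ m := by
    have h1 : ⌊y⌋₊ < 2 ^ m := Nat.lt_pow_succ_log_self (by norm_num) _
    have h2 := (Nat.floor_lt' (by positivity)).mp h1
    exact_mod_cast h2
  have hmle : (m : ℝ) ≤ 1 + 2 * Real.log y := by
    have h1 : 2 ^ (Nat.log 2 ⌊y⌋₊) ≤ ⌊y⌋₊ := Nat.pow_log_le_self 2 (by omega)
    have h2 : (2 : ℝ) ^ (Nat.log 2 ⌊y⌋₊) ≤ y := by
      have h3 : ((2 ^ (Nat.log 2 ⌊y⌋₊) : ℕ) : ℝ) ≤ ⌊y⌋₊ := by exact_mod_cast h1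
      push_cast at h3
      exact h3.trans (Nat.floor_le (by linarith))
    have h3 := Real.log_le_log (by positivity) h2
    rw [Real.log_pow] at h3
    rw [hm]; push_cast
    nlinarith [Nat.cast_nonneg (α := ℝ) (Nat.log 2 ⌊y⌋₊)]
  have hm1 : (1 : ℝ) ≤ m := by rw [hm]; push_cast; linarith [Nat.cast_nonneg (α := ℝ) (Nat.log 2 ⌊y⌋₊)]
  have hyδ : 1 ≤ y ^ δ := Real.one_le_rpow hy1 hδ0.le
  have hlogy : 1 + Real.log y ≤ (1 + 1 / δ) * y ^ δ := one_add_log_le_rpow hy1 hδ0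
  have hδ1 : 1 ≤ 1 / δ := by
    rw [hδ, one_div_one_div]; linarith
  have hm3 : (m : ℝ) ≤ 3 / δ * y ^ δ := by
    have h1 := Real.log_le_rpow_div (by linarith : 0 ≤ y) hδ0
    have h2 : 3 / δ * y ^ δ = 1 / δ * y ^ δ + 2 * (y ^ δ / δ) := by ring
    have h3 : 1 ≤ 1 / δ * y ^ δ := one_le_mul_of_one_le_of_one_le hδ1 hyδ
    linarith
  have hsplit : ∀ f : ℕ → ℝ, (∀ n, 0 ≤ f n) → ∀ c : ℝ, 0 ≤ c →
      (∀ p : ℕ, p.Prime → y < p → f p ≤ c * (Real.log p / y)) →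
      ∑ p ∈ D.primeFactors, f p
        ≤ ∑ p ∈ (Finset.Icc 1 ⌊y⌋₊).filter Nat.Prime, f p + c := by
    intro f hf c hc hfc
    rw [← Finset.sum_filter_add_sum_filter_not D.primeFactors (fun p => p ≤ ⌊y⌋₊)]
    refine add_le_add ?_ ?_
    · refine Finset.sum_le_sum_of_subset_of_nonneg (fun p hp => ?_) fun p _ _ => hf p
      obtain ⟨h1, h2⟩ := Finset.mem_filter.mp hp
      have h3 := Nat.prime_of_mem_primeFactors h1
      exact Finset.mem_filter.mpr ⟨Finset.mem_Icc.mpr ⟨h3.one_le, h2⟩, h3⟩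
    · have h1 : ∑ p ∈ D.primeFactors.filter (fun p => ¬ p ≤ ⌊y⌋₊), f p
          ≤ ∑ p ∈ D.primeFactors.filter (fun p => ¬ p ≤ ⌊y⌋₊), (c / y) * Real.log p := by
        refine Finset.sum_le_sum fun p hp => ?_
        obtain ⟨h1, h2⟩ := Finset.mem_filter.mp hp
        have h3 := hfc p (Nat.prime_of_mem_primeFactors h1)
          ((Nat.floor_lt (by linarith)).mp (not_le.mp h2))
        calc f p ≤ _ := h3
          _ = _ := by ring
      refine h1.trans ?_
      have h2 : ∑ p ∈ D.primeFactors.filter (fun p => ¬ p ≤ ⌊y⌋₊), (c / y) * Real.log p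
          ≤ ∑ p ∈ D.primeFactors, (c / y) * Real.log p :=
        Finset.sum_le_sum_of_subset_of_nonneg (Finset.filter_subset _ _) fun p _ _ => by
          have := Real.log_natCast_nonneg p
          positivity
      refine h2.trans ?_
      rw [← Finset.mul_sum]
      calc c / y * ∑ p ∈ D.primeFactors, Real.log p ≤ c / y * y := by
            have := sum_log_primeFactors_le hD
            gcongr
            linarith
        _ = c := by field_simp
  have hS1 : ∑ p ∈ D.primeFactors, 1 / (p : ℝ) ≤ 7 + 4 * Real.log m := by
    have h1 := hsplit (fun p => 1 / (p : ℝ)) (fun n => by positivity) 2 (by norm_num) ?_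
    · refine h1.trans ?_
      have h2 := sum_one_div_prime_le m (by omega)
      have h3 : ∑ p ∈ (Finset.Icc 1 ⌊y⌋₊).filter Nat.Prime, 1 / (p : ℝ)
          ≤ ∑ p ∈ (Finset.Icc 1 (2 ^ m)).filter Nat.Prime, 1 / (p : ℝ) := by
        refine Finset.sum_le_sum_of_subset_of_nonneg (Finset.filter_subset_filter _
          (Finset.Icc_subset_Icc_right ?_)) fun p _ _ => by positivity
        exact (Nat.lt_pow_succ_log_self (by norm_num) _).le
      linarith
    · intro p hp hyp
      have hp2 : (2 : ℝ) ≤ p := by exact_mod_cast hp.two_le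
      have h1 : Real.log 2 ≤ Real.log p := Real.log_le_log (by norm_num) hp2
      rw [← mul_div_assoc, div_le_div_iff₀ (by linarith) (by linarith)]
      nlinarith
  have hS2 : ∑ p ∈ D.primeFactors, Real.log p / p ≤ (1 + Real.log y) ^ 2 + 1 := by
    have h1 := hsplit (fun p => Real.log p / (p : ℝ))
      (fun n => div_nonneg (Real.log_natCast_nonneg n) (Nat.cast_nonneg n)) 1 (by norm_num) ?_
    · refine h1.trans (add_le_add ?_ le_rfl)
      have h2 : ∑ p ∈ (Finset.Icc 1 ⌊y⌋₊).filter Nat.Prime, Real.log p / (p : ℝ)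
          ≤ ∑ p ∈ Finset.Icc 1 ⌊y⌋₊, Real.log y * (1 / (p : ℝ)) := by
        refine (Finset.sum_le_sum_of_subset_of_nonneg (Finset.filter_subset _ _)
          fun p _ _ => div_nonneg (Real.log_natCast_nonneg p) (Nat.cast_nonneg p)).trans
          (Finset.sum_le_sum fun p hp => ?_)
        obtain ⟨h3, h4⟩ := Finset.mem_Icc.mp hp
        have h5 : (p : ℝ) ≤ y := le_trans (by exact_mod_cast h4) (Nat.floor_le (by linarith))
        have h6 : Real.log p ≤ Real.log y := Real.log_le_log (by exact_mod_cast h3) h5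
        rw [mul_one_div]
        gcongr
      refine h2.trans ?_
      rw [← Finset.mul_sum]
      have h3 := harmonicSum_le hy1
      unfold harmonicSum at h3
      nlinarith [mul_le_mul_of_nonneg_left h3 hly]
    · intro p hp hyp
      rw [one_mul]
      have := Real.log_natCast_nonneg p
      gcongr
  have hE : Real.exp (K * ∑ p ∈ D.primeFactors, 1 / (p : ℝ))
      ≤ Real.exp (8 * K) * (3 / δ) ^ (4 * K) * y ^ (δ * (4 * K)) := by
    have hm0 : (0 : ℝ) < m := by linarith
    calc Real.exp (K * ∑ p ∈ D.primeFactors, 1 / (p : ℝ))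
        ≤ Real.exp (8 * K + Real.log m * (4 * K)) := by
          apply Real.exp_le_exp.mpr
          nlinarith [mul_le_mul_of_nonneg_left hS1 hK]
      _ = Real.exp (8 * K) * (m : ℝ) ^ (4 * K) := by
          rw [Real.exp_add, ← Real.rpow_def_of_pos hm0]
      _ ≤ Real.exp (8 * K) * (3 / δ * y ^ δ) ^ (4 * K) := by
          gcongr
      _ = _ := by
          rw [Real.mul_rpow (by positivity) (by positivity), ← Real.rpow_mul (by linarith)]
          ring
  have hF : 1 + ∑ p ∈ D.primeFactors, Real.log p / p
      ≤ (2 + (1 + 1 / δ) ^ 2) * y ^ (δ * 2) := by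
    have h1 : (1 + Real.log y) ^ 2 ≤ ((1 + 1 / δ) * y ^ δ) ^ 2 :=
      pow_le_pow_left₀ (by linarith) hlogy 2
    have h2 : ((1 + 1 / δ) * y ^ δ) ^ 2 = (1 + 1 / δ) ^ 2 * y ^ (δ * 2) := by
      rw [mul_pow, Real.rpow_mul (by linarith), Real.rpow_two]
    have h3 : 1 ≤ y ^ (δ * 2) := Real.one_le_rpow hy1 (by positivity)
    nlinarith
  have hpow : y ^ (δ * (4 * K)) * y ^ (δ * 2) ≤ √y := by
    rw [← Real.rpow_add (by linarith), Real.sqrt_eq_rpow]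
    refine Real.rpow_le_rpow_of_exponent_le hy1 ?_
    rw [← mul_add, hδ]
    have : (0 : ℝ) < 4 * K + 2 := by linarith
    field_simp
    norm_num
  have hFnn : 0 ≤ 1 + ∑ p ∈ D.primeFactors, Real.log p / p :=
    add_nonneg zero_le_one (Finset.sum_nonneg fun p _ =>
      div_nonneg (Real.log_natCast_nonneg p) (Nat.cast_nonneg p))
  calc _ ≤ (Real.exp (8 * K) * (3 / δ) ^ (4 * K) * y ^ (δ * (4 * K)))
        * ((2 + (1 + 1 / δ) ^ 2) * y ^ (δ * 2)) := by gcongr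
    _ = Real.exp (8 * K) * (3 / δ) ^ (4 * K) * (2 + (1 + 1 / δ) ^ 2)
        * (y ^ (δ * (4 * K)) * y ^ (δ * 2)) := by ring
    _ ≤ _ := by gcongr

/-! ### A repeated shift: one logarithmic variable -/

/-- The three-variable sum in which the primes dividing exactly the first two variables are summed
freely, over squarefree integers coprime to `q`, while those below `Z` are distributed over the
other three slots. -/
noncomputable def pairHybrid (C : CorrCoeff) : ℕ → ℕ → ℝ → ℝ → ℝ → ℝ
  | 0, q, X, Y, W => sqfreeSum phiInv q (min X Y) * geOne W
  | Z + 1, q, X, Y, W => pairHybrid C Z q X Y W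
      + C.c13 Z * pairHybrid C Z (Z * q) (X / Z) Y (W / Z)
      + C.c23 Z * pairHybrid C Z (Z * q) X (Y / Z) (W / Z)
      + C.c123 Z * pairHybrid C Z (Z * q) (X / Z) (Y / Z) (W / Z)

theorem pairHybrid_split {C : CorrCoeff} (hC : C.OnPrimes) (Z : ℕ) {p q : ℕ} (hp : p.Prime)
    (hpZ : Z ≤ p) (hpq : Nat.Coprime p q) (X Y W : ℝ) :
    pairHybrid C Z q X Y W = pairHybrid C Z (p * q) X Y W
      + phiInv p * pairHybrid C Z (p * q) (X / p) (Y / p) W := by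
  induction Z generalizing q X Y W with
  | zero =>
    simp only [pairHybrid]
    rw [sqfreeSum_split phiInv hp hpq, min_div_div_right (Nat.cast_nonneg p)]
    ring
  | succ Z ih =>
    by_cases hZ : Z.Prime
    · have hpZq : Nat.Coprime p (Z * q) :=
        Nat.Coprime.mul_right ((Nat.coprime_primes hp hZ).mpr (by omega)) hpq
      simp only [pairHybrid]
      rw [ih (by omega) hpq, ih (by omega) hpZq, ih (by omega) hpZq, ih (by omega) hpZq,
        show Z * (p * q) = p * (Z * q) by ring, div_right_comm X (Z : ℝ) (p : ℝ),
        div_right_comm Y (Z : ℝ) (p : ℝ)]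
      ring
    · obtain ⟨-, h2, h3, h4⟩ := hC Z hZ
      simp only [pairHybrid, h2, h3, h4, zero_mul, add_zero]
      exact ih (by omega) hpq X Y W

theorem corrIter_pairHybrid {C : CorrCoeff} (hC : C.OnPrimes) (h12 : C.c12 = phiInv) (Z : ℕ) {q : ℕ}
    (hq : Nat.Coprime (primeProd Z) q) (X Y W : ℝ) :
    corrIter C Z (pairHybrid C 0 (primeProd Z * q)) X Y W = pairHybrid C Z q X Y W := by
  induction Z generalizing q X Y W with
  | zero => simp [corrIter, primeProd_zero]
  | succ Z ih =>
    by_cases hZ : Z.Prime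
    · rw [primeProd_succ_of_prime hZ] at hq ⊢
      rw [Nat.coprime_mul_iff_left] at hq
      have hq' : Nat.Coprime (primeProd Z) (Z * q) :=
        Nat.Coprime.mul_right (coprime_primeProd hZ le_rfl).symm hq.2
      rw [show Z * primeProd Z * q = primeProd Z * (Z * q) by ring]
      simp only [corrIter, corrOp, ih hq']
      rw [pairHybrid, pairHybrid_split hC Z hZ le_rfl hq.1 X Y W, h12]
    · rw [primeProd_succ_of_not_prime hZ] at hq ⊢
      obtain ⟨-, h2, h3, h4⟩ := hC Z hZ
      simp only [corrIter, corrOp_of_not_prime hC hZ]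
      rw [ih hq X Y W]
      simp only [pairHybrid, h2, h3, h4, zero_mul, add_zero]

theorem corrIter_geOne₃_eq_pairHybrid {C : CorrCoeff} (hC : C.OnPrimes) (h12 : C.c12 = phiInv)
    {R : ℝ} (hR : 0 ≤ R) {Z : ℕ} (hZ : R < Z) :
    corrIter C Z geOne₃ R R R = pairHybrid C Z 1 R R R := by
  rw [← corrIter_pairHybrid hC h12 Z (Nat.coprime_one_right _)]
  refine corrIter_congr hC Z hR hR hR fun X Y W _ hX _ hY _ _ => ?_
  simp only [pairHybrid, geOne₃]
  rw [sqfreeSum_primeProd phiInv Z 1 (lt_of_le_of_lt ((min_le_left X Y).trans hX) hZ)]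
  congr 1
  simp only [geOne, le_min_iff]
  split_ifs <;> simp_all

/-- The relative mass of the coefficients outside the logarithmic slot. -/
noncomputable def CorrCoeff.pairMass (C : CorrCoeff) (p : ℕ) : ℝ :=
  (1 - 1 / (p : ℝ)) * (|C.c13 p| + |C.c23 p| + |C.c123 p|)

/-- The Euler factor that remains after the logarithmic slot has been summed. -/
noncomputable def CorrCoeff.pairFactor (C : CorrCoeff) (p : ℕ) : ℝ :=
  1 + (1 - 1 / (p : ℝ)) * (C.c13 p + C.c23 p + C.c123 p)

theorem one_sub_one_div_natCast_nonneg (p : ℕ) : 0 ≤ 1 - 1 / (p : ℝ) := by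
  rcases Nat.eq_zero_or_pos p with rfl | hp
  · simp
  · rw [sub_nonneg, div_le_one (by exact_mod_cast hp)]
    exact_mod_cast hp

theorem CorrCoeff.pairMass_nonneg (C : CorrCoeff) (p : ℕ) : 0 ≤ C.pairMass p :=
  mul_nonneg (one_sub_one_div_natCast_nonneg p) (by positivity)

theorem sqfreeSum_of_lt_one (h : ℕ → ℝ) (q : ℕ) {X : ℝ} (hX : X < 1) : sqfreeSum h q X = 0 := by
  unfold sqfreeSum
  rw [Nat.floor_eq_zero.mpr hX]
  simp

theorem exists_abs_pairHybrid_zero_sub_le : ∃ C₀ : ℝ, 0 ≤ C₀ ∧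
    ∀ (C : CorrCoeff) (q : ℕ), Squarefree q → ∀ R x y w : ℝ, 1 ≤ R → 1 ≤ x → 1 ≤ y → 1 ≤ w →
      |pairHybrid C 0 q (R / x) (R / y) (R / w) - phiRatio q * Real.log R|
        ≤ phiRatio q * (C₀ + Real.log q + (Real.log x + Real.log y + Real.log w)) := by
  obtain ⟨C₀, hC0, hC⟩ := exists_sqfreeSum_phiInv_coprime_le
  refine ⟨C₀, hC0, fun C q hq R x y w hR hx hy hw => ?_⟩
  have hu := phiRatio_pos (Nat.pos_of_ne_zero hq.ne_zero)
  have hlq : 0 ≤ Real.log q := Real.log_natCast_nonneg q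
  have hlR := Real.log_nonneg hR
  have hlx := Real.log_nonneg hx
  have hly := Real.log_nonneg hy
  have hlw := Real.log_nonneg hw
  have hbig : ∀ {z : ℝ}, 1 ≤ z → R / z < 1 → Real.log R ≤ Real.log z := by
    intro z hz h
    rw [div_lt_one (by linarith)] at h
    exact Real.log_le_log (by linarith) h.le
  have hzero : ∀ {v : ℝ}, v = 0 →
      Real.log R ≤ C₀ + Real.log q + (Real.log x + Real.log y + Real.log w) →
      |v - phiRatio q * Real.log R|
        ≤ phiRatio q * (C₀ + Real.log q + (Real.log x + Real.log y + Real.log w)) := by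
    intro v hv h
    rw [hv, zero_sub, abs_neg, abs_of_nonneg (by positivity)]
    exact mul_le_mul_of_nonneg_left h hu.le
  simp only [pairHybrid]
  by_cases h3 : R / w < 1
  · refine hzero (by simp [geOne, not_le.mpr h3]) ?_
    linarith [hbig hw h3]
  by_cases h12 : min (R / x) (R / y) < 1
  · refine hzero (by rw [sqfreeSum_of_lt_one _ _ h12, zero_mul]) ?_
    rcases min_lt_iff.mp h12 with h | h
    · linarith [hbig hx h]
    · linarith [hbig hy h]
  · rw [geOne, if_pos (not_lt.mp h3), mul_one]
    have h1 := hC q hq _ (not_lt.mp h12)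
    have hlog : |Real.log (min (R / x) (R / y)) - Real.log R|
        ≤ Real.log x + Real.log y := by
      have ex : Real.log (R / x) = Real.log R - Real.log x :=
        Real.log_div (by linarith) (by linarith)
      have ey : Real.log (R / y) = Real.log R - Real.log y :=
        Real.log_div (by linarith) (by linarith)
      rcases min_choice (R / x) (R / y) with h | h <;> rw [h]
      · rw [ex, abs_le]; constructor <;> linarith
      · rw [ey, abs_le]; constructor <;> linarith
    have hid : sqfreeSum phiInv q (min (R / x) (R / y)) - phiRatio q * Real.log R
        = (sqfreeSum phiInv q (min (R / x) (R / y))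
            - phiRatio q * Real.log (min (R / x) (R / y)))
          + phiRatio q * (Real.log (min (R / x) (R / y)) - Real.log R) := by ring
    rw [hid]
    refine (abs_add_le _ _).trans ?_
    rw [abs_mul, abs_of_pos hu]
    have := mul_le_mul_of_nonneg_left hlog hu.le
    nlinarith [mul_nonneg hu.le hlw]

/-- The main estimate for a repeated shift, proved one prime at a time. The error carries the
factor `φ(q)/q` and grows only with the logarithm of the moduli already removed. -/
theorem exists_abs_pairHybrid_sub_le : ∃ C₀ : ℝ, 0 ≤ C₀ ∧
    ∀ C : CorrCoeff, C.OnPrimes → ∀ (Z q : ℕ), Squarefree q → Nat.Coprime (primeProd Z) q →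
    ∀ R x y w : ℝ, 1 ≤ R → 1 ≤ x → 1 ≤ y → 1 ≤ w →
      |pairHybrid C Z q (R / x) (R / y) (R / w)
          - phiRatio q * (∏ n ∈ Finset.range Z, C.pairFactor n) * Real.log R|
        ≤ phiRatio q * ((∏ n ∈ Finset.range Z, (1 + C.pairMass n)) *
          (C₀ + 4 * ∑ n ∈ Finset.range Z, C.pairMass n * Real.log n + Real.log q
            + (Real.log x + Real.log y + Real.log w))) := by
  obtain ⟨C₀, hC0, hbase⟩ := exists_abs_pairHybrid_zero_sub_le
  refine ⟨C₀, hC0, fun C hC Z => ?_⟩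
  induction Z with
  | zero =>
    intro q hq _ R x y w hR hx hy hw
    simpa using hbase C q hq R x y w hR hx hy hw
  | succ Z ih =>
    intro q hq hcop R x y w hR hx hy hw
    rw [Finset.prod_range_succ, Finset.prod_range_succ, Finset.sum_range_succ]
    set P := ∏ n ∈ Finset.range Z, C.pairFactor n
    set A := ∏ n ∈ Finset.range Z, (1 + C.pairMass n) with hA
    set S := ∑ n ∈ Finset.range Z, C.pairMass n * Real.log n with hS
    have hA0 : 0 ≤ A := Finset.prod_nonneg fun n _ => by
      have := C.pairMass_nonneg n; positivity
    by_cases hZ : Z.Prime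
    · rw [primeProd_succ_of_prime hZ, Nat.coprime_mul_iff_left] at hcop
      have hsq : Squarefree (Z * q) := (Nat.squarefree_mul hcop.1).mpr ⟨hZ.squarefree, hq⟩
      have hcop' : Nat.Coprime (primeProd Z) (Z * q) :=
        Nat.Coprime.mul_right (coprime_primeProd hZ le_rfl).symm hcop.2
      have hZ1 : (1 : ℝ) ≤ Z := by exact_mod_cast hZ.one_le
      have hZ0 : (0 : ℝ) < Z := by linarith
      have hq0 : (0 : ℝ) < q := by
        have := Nat.pos_of_ne_zero hq.ne_zero
        exact_mod_cast this
      have hu := phiRatio_pos (Nat.pos_of_ne_zero hq.ne_zero)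
      set u := phiRatio q
      have hu' : phiRatio (Z * q) = (1 - 1 / (Z : ℝ)) * u := phiRatio_prime_mul hZ hcop.1
      set v := 1 - 1 / (Z : ℝ) with hv
      have hv0 : 0 ≤ v := one_sub_one_div_natCast_nonneg Z
      have hlZ : 0 ≤ Real.log Z := Real.log_nonneg hZ1
      have hlq : Real.log ((Z * q : ℕ) : ℝ) = Real.log Z + Real.log q := by
        push_cast; exact Real.log_mul hZ0.ne' hq0.ne'
      have hge : ∀ {z : ℝ}, 1 ≤ z → 1 ≤ Z * z := fun {z} hz =>
        one_le_mul_of_one_le_of_one_le hZ1 hz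
      have hlz : ∀ {z : ℝ}, 1 ≤ z → Real.log (Z * z) = Real.log Z + Real.log z := fun {z} hz =>
        Real.log_mul hZ0.ne' (by linarith)
      have hdd : ∀ z : ℝ, R / z / Z = R / (Z * z) := fun z => by rw [div_div, mul_comm]
      set E := C₀ + 4 * S + Real.log q + (Real.log x + Real.log y + Real.log w) with hE
      have e0 := ih q hq hcop.2 R x y w hR hx hy hw
      have e13 := ih (Z * q) hsq hcop' R (Z * x) y (Z * w) hR (hge hx) hy (hge hw)
      have e23 := ih (Z * q) hsq hcop' R x (Z * y) (Z * w) hR hx (hge hy) (hge hw)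
      have e123 := ih (Z * q) hsq hcop' R (Z * x) (Z * y) (Z * w) hR (hge hx) (hge hy) (hge hw)
      rw [hu', hlq, hlz hx, hlz hw] at e13
      rw [hu', hlq, hlz hy, hlz hw] at e23
      rw [hu', hlq, hlz hx, hlz hy, hlz hw] at e123
      -- Replacing `q` by `p q` and dividing up to three variables by `p` costs at most `4 log p`.
      have hbnd : ∀ {e : ℝ}, e ≤ E + 4 * Real.log Z →
          v * u * (A * e) ≤ v * (u * (A * (E + 4 * Real.log Z))) := by
        intro e he
        rw [mul_assoc]
        gcongr
      replace e13 := e13.trans (hbnd (by rw [hE]; linarith))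
      replace e23 := e23.trans (hbnd (by rw [hE]; linarith))
      replace e123 := e123.trans (hbnd (by rw [hE]; linarith))
      simp only [pairHybrid, hdd]
      set F := u * (A * (E + 4 * Real.log Z)) with hF
      set ℓ := Real.log R
      set T0 := pairHybrid C Z q (R / x) (R / y) (R / w)
      set T13 := pairHybrid C Z (Z * q) (R / (Z * x)) (R / y) (R / (Z * w))
      set T23 := pairHybrid C Z (Z * q) (R / x) (R / (Z * y)) (R / (Z * w))
      set T123 := pairHybrid C Z (Z * q) (R / (Z * x)) (R / (Z * y)) (R / (Z * w))
      -- The three sums with modulus `p q` have main terms with `φ(p q)/(p q) = (1 - 1/p) φ(q)/q`, and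
      -- all four main terms add up to `C.pairFactor p`.
      have hid : T0 + C.c13 Z * T13 + C.c23 Z * T23 + C.c123 Z * T123
          - u * (P * C.pairFactor Z) * ℓ
          = (T0 - u * P * ℓ) + C.c13 Z * (T13 - v * u * P * ℓ) + C.c23 Z * (T23 - v * u * P * ℓ)
            + C.c123 Z * (T123 - v * u * P * ℓ) := by
        simp only [CorrCoeff.pairFactor, ← hv]
        ring
      rw [hid]
      have tri : ∀ a b c d : ℝ, |a + b + c + d| ≤ |a| + |b| + |c| + |d| := by
        intro a b c d
        have h2 := abs_add_le (a + b + c) d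
        have h3 := abs_add_le (a + b) c
        have h4 := abs_add_le a b
        linarith
      refine (tri _ _ _ _).trans ?_
      rw [abs_mul, abs_mul, abs_mul]
      have m13 := mul_le_mul_of_nonneg_left e13 (abs_nonneg (C.c13 Z))
      have m23 := mul_le_mul_of_nonneg_left e23 (abs_nonneg (C.c23 Z))
      have m123 := mul_le_mul_of_nonneg_left e123 (abs_nonneg (C.c123 Z))
      set ρ := C.pairMass Z with hρ
      have hρ0 : 0 ≤ ρ := C.pairMass_nonneg Z
      have hsum : |C.c13 Z| * (v * F) + |C.c23 Z| * (v * F) + |C.c123 Z| * (v * F) = ρ * F := by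
        rw [hρ]; simp only [CorrCoeff.pairMass, ← hv]; ring
      have htarget : u * (A * (1 + ρ) * (C₀ + 4 * (S + ρ * Real.log Z) + Real.log q
          + (Real.log x + Real.log y + Real.log w)))
          = u * (A * E) + ρ * F + u * A * (ρ * ρ * (4 * Real.log Z)) := by
        rw [hF, hE]; ring
      rw [htarget]
      have : 0 ≤ u * A * (ρ * ρ * (4 * Real.log Z)) := by positivity
      linarith
    · obtain ⟨-, h2, h3, h4⟩ := hC Z hZ
      rw [primeProd_succ_of_not_prime hZ] at hcop
      have hm : C.pairMass Z = 0 := by simp [CorrCoeff.pairMass, h2, h3, h4]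
      have hf : C.pairFactor Z = 1 := by simp [CorrCoeff.pairFactor, h2, h3, h4]
      simp only [pairHybrid, h2, h3, h4, hm, hf, zero_mul, add_zero, mul_one]
      exact ih q hq hcop R x y w hR hx hy hw

theorem summable_one_div_sq : Summable fun n : ℕ => 1 / (n : ℝ) ^ 2 :=
  Real.summable_one_div_nat_pow.mpr (by norm_num)

/-- For a repeated shift the three-fold sum is the Euler product times `log R`, with an error that
is `o(log R)` for shifts of polynomial size in `R`. -/
theorem exists_abs_corrIter_sub_singularSeries_mul_log_le {K : ℝ} (hK : 0 ≤ K) :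
    ∃ B : ℝ, 1 ≤ B ∧ ∀ (C : CorrCoeff) (D : ℕ), C.OnPrimes → C.c12 = phiInv → 0 < D →
      (∀ p : ℕ, p.Prime → |C.c13 p| + |C.c23 p| + |C.c123 p| ≤ K / p ∧
        (¬ p ∣ D → |C.c13 p| + |C.c23 p| + |C.c123 p| ≤ K / (p : ℝ) ^ 2)) →
      ∀ (r : ℕ) (j : Fin r → ℤ), Function.Injective j →
      (∀ p : ℕ, p.Prime → C.pairFactor p = singularFactor j p) →
      ∀ R : ℝ, 1 ≤ R → ∀ Z : ℕ, R < Z →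
        |corrIter C Z geOne₃ R R R - singularSeries j * Real.log R|
          ≤ B * √(1 + Real.log D) := by
  obtain ⟨C₀, hC0, hmain⟩ := exists_abs_pairHybrid_sub_le
  obtain ⟨B, hB0, hB⟩ := exists_primeFactors_sums_le hK
  set σ := ∑' n : ℕ, 1 / (n : ℝ) ^ 2 with hσ
  set τ := ∑' n : ℕ, threeHalves n with hτ
  have hσ0 : 0 ≤ σ := tsum_nonneg fun n => by positivity
  have hτ0 : 0 ≤ τ := tsum_nonneg threeHalves_nonneg
  refine ⟨1 + Real.exp (K * σ) * (C₀ + 8 * K * τ + 4 * K) * B, by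
    have : 0 ≤ Real.exp (K * σ) * (C₀ + 8 * K * τ + 4 * K) * B := by positivity
    linarith, fun C D hC h12 hD hCD r j hj hfac R hR Z hZ => ?_⟩
  have hD1 : (1 : ℝ) ≤ D := by exact_mod_cast hD
  have hlD := Real.log_nonneg hD1
  have hmle : ∀ p : ℕ, C.pairMass p ≤ |C.c13 p| + |C.c23 p| + |C.c123 p| := fun p => by
    refine mul_le_of_le_one_left (by positivity) ?_
    have : (0 : ℝ) ≤ 1 / p := by positivity
    linarith
  -- The primes outside `D` contribute convergent sums; those dividing `D` are collected in sums of
  -- `1/p` and `log p / p`.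
  have hpt : ∀ n : ℕ, C.pairMass n
      ≤ K * (1 / (n : ℝ) ^ 2) + if n ∈ D.primeFactors then K * (1 / (n : ℝ)) else 0 := by
    intro n
    by_cases hn : n.Prime
    · obtain ⟨h1, h2⟩ := hCD n hn
      have h0 : 0 ≤ K * (1 / (n : ℝ) ^ 2) := by positivity
      split_ifs with hmem
      · have := (hmle n).trans h1
        rw [div_eq_mul_one_div] at this
        linarith
      · have := (hmle n).trans (h2 fun h => hmem (Nat.mem_primeFactors.mpr ⟨hn, h, hD.ne'⟩))
        rw [div_eq_mul_one_div] at this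
        linarith
    · obtain ⟨-, h2, h3, h4⟩ := hC n hn
      have : C.pairMass n = 0 := by simp [CorrCoeff.pairMass, h2, h3, h4]
      rw [this]
      split_ifs <;> positivity
  have hfin : ∀ (Z : ℕ) (f : ℕ → ℝ), (∀ n, 0 ≤ f n) →
      ∑ n ∈ Finset.range Z, (if n ∈ D.primeFactors then f n else 0)
        ≤ ∑ p ∈ D.primeFactors, f p := by
    intro Z f hf
    rw [← Finset.sum_filter]
    exact Finset.sum_le_sum_of_subset_of_nonneg (fun p hp => (Finset.mem_filter.mp hp).2)
      fun p _ _ => hf p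
  have hS1 : ∀ Z : ℕ, ∑ n ∈ Finset.range Z, C.pairMass n
      ≤ K * σ + K * ∑ p ∈ D.primeFactors, 1 / (p : ℝ) := by
    intro Z
    refine (Finset.sum_le_sum fun n _ => hpt n).trans ?_
    rw [Finset.sum_add_distrib, ← Finset.mul_sum, Finset.mul_sum D.primeFactors]
    refine add_le_add (mul_le_mul_of_nonneg_left ?_ hK) ?_
    · exact summable_one_div_sq.sum_le_tsum _ fun n _ => by positivity
    · exact hfin Z (fun n => K * (1 / (n : ℝ))) fun n => by positivity
  have hS2 : ∀ Z : ℕ, ∑ n ∈ Finset.range Z, C.pairMass n * Real.log n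
      ≤ 2 * K * τ + K * ∑ p ∈ D.primeFactors, Real.log p / (p : ℝ) := by
    intro Z
    have hpt2 : ∀ n : ℕ, C.pairMass n * Real.log n ≤ 2 * K * threeHalves n
        + if n ∈ D.primeFactors then K * (Real.log n / (n : ℝ)) else 0 := by
      intro n
      have hln := Real.log_natCast_nonneg n
      refine (mul_le_mul_of_nonneg_right (hpt n) hln).trans ?_
      rw [add_mul]
      refine add_le_add ?_ ?_
      · rcases Nat.eq_zero_or_pos n with rfl | hn
        · simp; exact mul_nonneg (by positivity) (threeHalves_nonneg 0)
        · have hn1 : (1 : ℝ) ≤ n := by exact_mod_cast hn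
          have h1 := Real.log_le_rpow_div (by linarith : (0 : ℝ) ≤ n)
            (by norm_num : (0 : ℝ) < 1 / 2)
          have h2 := one_div_sq_le_threeHalves hn1 (δ := 1 / 2) le_rfl
          calc K * (1 / (n : ℝ) ^ 2) * Real.log n
              ≤ K * (1 / (n : ℝ) ^ 2) * ((n : ℝ) ^ (1 / 2 : ℝ) / (1 / 2)) := by gcongr
            _ = 2 * K * ((n : ℝ) ^ (1 / 2 : ℝ) / (n : ℝ) ^ 2) := by ring
            _ ≤ _ := mul_le_mul_of_nonneg_left h2 (by positivity)
      · split_ifs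
        · exact le_of_eq (by ring)
        · simp
    refine (Finset.sum_le_sum fun n _ => hpt2 n).trans ?_
    rw [Finset.sum_add_distrib, ← Finset.mul_sum, Finset.mul_sum D.primeFactors]
    refine add_le_add (mul_le_mul_of_nonneg_left ?_ (by positivity)) ?_
    · exact summable_threeHalves.sum_le_tsum _ fun n _ => threeHalves_nonneg n
    · exact hfin Z (fun n => K * (Real.log n / (n : ℝ))) fun n =>
        mul_nonneg hK (div_nonneg (Real.log_natCast_nonneg n) (Nat.cast_nonneg n))
  set U := ∑ p ∈ D.primeFactors, 1 / (p : ℝ) with hU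
  set V := ∑ p ∈ D.primeFactors, Real.log p / (p : ℝ) with hV
  have hV0 : 0 ≤ V := Finset.sum_nonneg fun p _ =>
    div_nonneg (Real.log_natCast_nonneg p) (Nat.cast_nonneg p)
  have hlim := tendsto_prod_singularFactor j hj hfac fun n hn => by
    obtain ⟨-, h2, h3, h4⟩ := hC n hn
    simp [CorrCoeff.pairFactor, h2, h3, h4]
  -- The three-fold sum does not depend on `Z > R`, so the Euler product may be completed.
  have key : |corrIter C Z geOne₃ R R R - singularSeries j * Real.log R|
      ≤ Real.exp (K * σ + K * U) * (C₀ + 4 * (2 * K * τ + K * V)) := by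
    refine le_of_tendsto ((hlim.mul_const (Real.log R)).const_sub
      (corrIter C Z geOne₃ R R R)).abs ?_
    filter_upwards [Filter.eventually_ge_atTop Z] with Z' hZ'
    have hRZ' : R < Z' := lt_of_lt_of_le hZ (by exact_mod_cast hZ')
    rw [← corrIter_geOne₃_stable C (by linarith) hZ hZ',
      corrIter_geOne₃_eq_pairHybrid hC h12 (by linarith) hRZ']
    have h := hmain C hC Z' 1 squarefree_one (Nat.coprime_one_right _) R 1 1 1 hR le_rfl le_rfl
      le_rfl
    simp only [div_one, phiRatio, Nat.totient_one, Nat.cast_one, one_mul, Real.log_one,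
      add_zero] at h
    refine h.trans (mul_le_mul ?_ ?_ ?_ (Real.exp_pos _).le)
    · refine (prod_one_add_le_exp_sum _ _ fun n _ => C.pairMass_nonneg n).trans ?_
      exact Real.exp_le_exp.mpr (hS1 Z')
    · linarith [hS2 Z']
    · have : 0 ≤ ∑ n ∈ Finset.range Z', C.pairMass n * Real.log n := Finset.sum_nonneg fun n _ =>
        mul_nonneg (C.pairMass_nonneg n) (Real.log_natCast_nonneg n)
      positivity
  refine key.trans ?_
  have hBD := hB D hD
  have hsq : 0 ≤ √(1 + Real.log D) := Real.sqrt_nonneg _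
  calc Real.exp (K * σ + K * U) * (C₀ + 4 * (2 * K * τ + K * V))
      ≤ Real.exp (K * σ + K * U) * ((C₀ + 8 * K * τ + 4 * K) * (1 + V)) := by
        refine mul_le_mul_of_nonneg_left ?_ (Real.exp_pos _).le
        have : 0 ≤ (C₀ + 8 * K * τ) * V := by positivity
        nlinarith
    _ = Real.exp (K * σ) * (C₀ + 8 * K * τ + 4 * K) * (Real.exp (K * U) * (1 + V)) := by
        rw [Real.exp_add]; ring
    _ ≤ Real.exp (K * σ) * (C₀ + 8 * K * τ + 4 * K) * (B * √(1 + Real.log D)) := by gcongr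
    _ ≤ _ := by nlinarith

/-! ### Sums of powers of logarithms -/

/-- The first-order Euler–Maclaurin formula for a function whose derivative is `O(t^(-3/2))`. -/
theorem exists_abs_sum_sub_antideriv_le {f F f' : ℝ → ℝ} {C : ℝ} (hC : 0 ≤ C)
    (hF : ∀ t, 1 ≤ t → HasDerivAt F (f t) t) (hf : ∀ t, 1 ≤ t → HasDerivAt f (f' t) t)
    (hb : ∀ t, 1 ≤ t → |f t| ≤ C / √t) (hb' : ∀ t, 1 ≤ t → |f' t| ≤ C / (t * √t)) :
    ∃ c : ℝ, ∀ t : ℝ, 1 ≤ t → |∑ n ∈ Finset.Icc 1 ⌊t⌋₊, f n - F t - c| ≤ 10 * C / √t := by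
  set u : ℕ → ℝ := fun m => ∑ n ∈ Finset.Icc 1 (m + 1), f n - F ((m + 1 : ℕ) : ℝ) with hu
  set g : ℕ → ℝ := fun m => 4 * C / √((m + 1 : ℕ) : ℝ) with hg
  have hg0 : ∀ m, 0 ≤ g m := fun m => by positivity
  have mvtF : ∀ a b : ℝ, 1 ≤ a → a < b → ∃ ξ, a < ξ ∧ ξ < b ∧ F b - F a = f ξ * (b - a) := by
    intro a b ha hab
    obtain ⟨ξ, hξ, h⟩ := exists_hasDerivAt_eq_slope F f hab
      (fun t ht => (hF t (ha.trans ht.1)).continuousAt.continuousWithinAt)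
      (fun t ht => hF t (ha.trans ht.1.le))
    refine ⟨ξ, hξ.1, hξ.2, ?_⟩
    rw [h, div_mul_cancel₀]
    linarith
  have mvtf : ∀ a b : ℝ, 1 ≤ a → a < b → ∃ ξ, a < ξ ∧ ξ < b ∧ f b - f a = f' ξ * (b - a) := by
    intro a b ha hab
    obtain ⟨ξ, hξ, h⟩ := exists_hasDerivAt_eq_slope f f' hab
      (fun t ht => (hf t (ha.trans ht.1)).continuousAt.continuousWithinAt)
      (fun t ht => hf t (ha.trans ht.1.le))
    refine ⟨ξ, hξ.1, hξ.2, ?_⟩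
    rw [h, div_mul_cancel₀]
    linarith
  -- By this estimate `u - g` increases and `u + g` decreases, so `u` converges with error at most `g`.
  have hstep : ∀ m, |u (m + 1) - u m| ≤ g m - g (m + 1) := by
    intro m
    have ha : (1 : ℝ) ≤ ((m + 1 : ℕ) : ℝ) := by push_cast; linarith [Nat.cast_nonneg (α := ℝ) m]
    set a : ℝ := ((m + 1 : ℕ) : ℝ)
    have hb1 : ((m + 1 + 1 : ℕ) : ℝ) = a + 1 := by simp [a]
    have e : u (m + 1) - u m = f (a + 1) - (F (a + 1) - F a) := by
      simp only [hu]
      rw [Finset.sum_Icc_succ_top (by omega), hb1]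
      ring
    obtain ⟨ξ, hξ1, hξ2, h1⟩ := mvtF a (a + 1) ha (by linarith)
    obtain ⟨η, hη1, hη2, h2⟩ := mvtf ξ (a + 1) (by linarith) hξ2
    have e2 : u (m + 1) - u m = f' η * (a + 1 - ξ) := by
      rw [e, h1, ← h2]; ring
    have hs0 : 0 < √a := Real.sqrt_pos.mpr (by linarith)
    have hle : |f' η| ≤ C / (a * √a) := by
      refine (hb' η (by linarith)).trans ?_
      have : √a ≤ √η := Real.sqrt_le_sqrt (by linarith)
      have : a ≤ η := by linarith
      have : 0 ≤ η := by linarith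
      gcongr
    rw [e2, abs_mul, abs_of_nonneg (by linarith : 0 ≤ a + 1 - ξ)]
    have h3 : |f' η| * (a + 1 - ξ) ≤ C / (a * √a) := by
      refine (mul_le_of_le_one_right (abs_nonneg _) (by linarith)).trans hle
    refine h3.trans ?_
    simp only [hg, hb1]
    change C / (a * √a) ≤ 4 * C / √a - 4 * C / √(a + 1)
    set s := √a with hs
    set t := √(a + 1) with ht
    have hss : s * s = a := Real.mul_self_sqrt (by linarith)
    have htt : t * t = a + 1 := Real.mul_self_sqrt (by linarith)
    have ht0 : 0 < t := Real.sqrt_pos.mpr (by linarith)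
    have hst : s ≤ t := Real.sqrt_le_sqrt (by linarith)
    have ht2 : t ≤ 3 / 2 * s := by
      by_contra hcon
      push Not at hcon
      nlinarith
    rw [← hss, div_sub_div _ _ hs0.ne' ht0.ne', div_le_div_iff₀ (by positivity) (by positivity)]
    have hkey : s * t ≤ 4 * (t - s) * (s * s * s) := by
      have h5 : (t - s) * (t + s) = 1 := by linarith
      have h6 : 2 / 5 ≤ (t - s) * s := by
        have : 0 ≤ (t - s) * (3 / 2 * s - t) := mul_nonneg (by linarith) (by linarith)
        linarith
      have h7 : 2 / 5 * (s * s) ≤ (t - s) * s * (s * s) :=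
        mul_le_mul_of_nonneg_right h6 (by positivity)
      have h8 : t * s ≤ 3 / 2 * s * s := mul_le_mul_of_nonneg_right ht2 hs0.le
      linarith [mul_pos hs0 hs0]
    calc C * (s * t) ≤ C * (4 * (t - s) * (s * s * s)) := by gcongr
      _ = _ := by ring
  have hmono : Monotone fun m => u m - g m := monotone_nat_of_le_succ fun m => by
    have := abs_le.mp (hstep m); linarith
  have hanti : Antitone fun m => u m + g m := antitone_nat_of_succ_le fun m => by
    have := abs_le.mp (hstep m); linarith
  have hcross : ∀ n m, u n - g n ≤ u m + g m := by
    intro n m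
    have h1 := hmono (le_max_left n m)
    have h2 := hanti (le_max_right n m)
    have h3 := hg0 (max n m)
    simp only at h1 h2
    linarith
  refine ⟨⨆ n, (u n - g n), fun t ht => ?_⟩
  have hc : ∀ m, |u m - ⨆ n, (u n - g n)| ≤ g m := by
    intro m
    have h1 : u m - g m ≤ ⨆ n, (u n - g n) :=
      le_ciSup (f := fun n => u n - g n) ⟨u 0 + g 0, by rintro _ ⟨n, rfl⟩; exact hcross n 0⟩ m
    have h2 : ⨆ n, (u n - g n) ≤ u m + g m := ciSup_le fun n => hcross n m
    rw [abs_le]; constructor <;> linarith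
  have hm1 : 1 ≤ ⌊t⌋₊ := Nat.one_le_floor_iff _ |>.mpr ht
  obtain ⟨m, hm⟩ := Nat.exists_eq_add_of_le' hm1
  have h1 := hc m
  set a : ℝ := ((m + 1 : ℕ) : ℝ) with ha
  have hat : a ≤ t := by rw [ha, ← hm]; exact Nat.floor_le (by linarith)
  have hat2 : t < a + 1 := by
    have := Nat.lt_floor_add_one t
    rw [hm] at this; exact this
  have ha1 : 1 ≤ a := by rw [ha]; exact_mod_cast (by omega : 1 ≤ m + 1)
  have hsa : 1 / √a ≤ 2 / √t := by
    have hs0 : 0 < √a := Real.sqrt_pos.mpr (by linarith)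
    have ht0 : 0 < √t := Real.sqrt_pos.mpr (by linarith)
    rw [div_le_div_iff₀ hs0 ht0]
    have : √t ≤ √(4 * a) := Real.sqrt_le_sqrt (by linarith)
    rw [Real.sqrt_mul (by norm_num), show (4 : ℝ) = 2 ^ 2 by norm_num,
      Real.sqrt_sq (by norm_num)] at this
    linarith
  have hFt : |F t - F a| ≤ C / √a := by
    rcases hat.lt_or_eq with h | h
    · obtain ⟨ξ, hξ1, hξ2, h2⟩ := mvtF a t ha1 h
      rw [h2, abs_mul, abs_of_nonneg (by linarith : 0 ≤ t - a)]
      refine (mul_le_of_le_one_right (abs_nonneg _) (by linarith)).trans ?_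
      refine (hb ξ (by linarith)).trans ?_
      have : √a ≤ √ξ := Real.sqrt_le_sqrt hξ1.le
      have : 0 < √a := Real.sqrt_pos.mpr (by linarith)
      gcongr
    · rw [h]; simp; positivity
  have e : ∑ n ∈ Finset.Icc 1 ⌊t⌋₊, f n - F t - ⨆ n, (u n - g n)
      = (u m - ⨆ n, (u n - g n)) - (F t - F a) := by
    simp only [hu]; rw [hm]; ring
  rw [e]
  refine (abs_sub _ _).trans ?_
  have hgm : g m = 4 * C * (1 / √a) := by simp only [hg]; rw [ha]; ring
  have hCa : C / √a = C * (1 / √a) := by ring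
  have : C * (1 / √a) ≤ C * (2 / √t) := by gcongr
  have e3 : 10 * C / √t = 5 * (C * (2 / √t)) := by ring
  rw [e3]
  linarith

theorem log_pow_le_sqrt (k : ℕ) {t : ℝ} (ht : 1 ≤ t) :
    Real.log t ^ k ≤ 2 ^ k * k.factorial * √t := by
  have h := Real.pow_div_factorial_le_exp (Real.log t / 2)
    (by have := Real.log_nonneg ht; positivity) k
  have h2 : Real.exp (Real.log t / 2) = √t := by
    rw [Real.sqrt_eq_rpow, Real.rpow_def_of_pos (by linarith)]; congr 1; ring
  rw [h2, div_pow, div_div, div_le_iff₀ (by positivity)] at h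
  linarith

/-- The sum `∑_{n ≤ t} (log n)^k / n`. -/
noncomputable def logSum (k : ℕ) (t : ℝ) : ℝ := ∑ n ∈ Finset.Icc 1 ⌊t⌋₊, Real.log n ^ k / n

theorem exists_abs_logSum_sub_le (k : ℕ) : ∃ c C : ℝ, 0 ≤ C ∧ ∀ t : ℝ, 1 ≤ t →
    |logSum k t - Real.log t ^ (k + 1) / (k + 1) - c| ≤ C / √t := by
  set A : ℝ := 2 ^ k * k.factorial + k * (2 ^ (k - 1) * (k - 1).factorial) with hA
  have hA0 : 0 ≤ A := by positivity
  have hd1 : ∀ t : ℝ, 1 ≤ t → HasDerivAt (fun t => Real.log t ^ (k + 1) / (k + 1)) (Real.log t ^ k / t) t := by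
    intro t ht
    have ht0 : t ≠ 0 := by linarith
    have h := ((Real.hasDerivAt_log ht0).pow (k + 1)).div_const ((k : ℝ) + 1)
    refine h.congr_deriv ?_
    have : (k : ℝ) + 1 ≠ 0 := by positivity
    simp only [Nat.add_sub_cancel]
    push_cast
    field_simp
  have hd2 : ∀ t : ℝ, 1 ≤ t → HasDerivAt (fun t => Real.log t ^ k / t)
      ((k * Real.log t ^ (k - 1) - Real.log t ^ k) / t ^ 2) t := by
    intro t ht
    have ht0 : t ≠ 0 := by linarith
    have h := ((Real.hasDerivAt_log ht0).pow k).div (hasDerivAt_id t) ht0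
    refine h.congr_deriv ?_
    simp only [id, Pi.pow_apply]
    field_simp
  have hd3 : ∀ t : ℝ, 1 ≤ t → |Real.log t ^ k / t| ≤ A / √t := by
    intro t ht
    have hl := Real.log_nonneg ht
    have hs : 0 < √t := Real.sqrt_pos.mpr (by linarith)
    have hst : √t * √t = t := Real.mul_self_sqrt (by linarith)
    rw [abs_of_nonneg (by positivity), div_le_div_iff₀ (by linarith) hs]
    have h1 := log_pow_le_sqrt k ht
    have h2 : (2 : ℝ) ^ k * k.factorial ≤ A := le_add_of_nonneg_right (by positivity)
    calc Real.log t ^ k * √t ≤ (2 ^ k * k.factorial * √t) * √t := by gcongr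
      _ = 2 ^ k * k.factorial * t := by rw [mul_assoc, hst]
      _ ≤ A * t := by gcongr
  have hd4 : ∀ t : ℝ, 1 ≤ t → |(k * Real.log t ^ (k - 1) - Real.log t ^ k) / t ^ 2| ≤ A / (t * √t) := by
    intro t ht
    have hl := Real.log_nonneg ht
    have hs : 0 < √t := Real.sqrt_pos.mpr (by linarith)
    have hst : √t * √t = t := Real.mul_self_sqrt (by linarith)
    rw [abs_div, abs_of_pos (by positivity : (0 : ℝ) < t ^ 2),
      div_le_div_iff₀ (by positivity) (by positivity)]
    have h1 := log_pow_le_sqrt k ht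
    have h2 := log_pow_le_sqrt (k - 1) ht
    have h3 : |(k : ℝ) * Real.log t ^ (k - 1) - Real.log t ^ k| ≤ A * √t := by
      refine (abs_sub _ _).trans ?_
      rw [abs_of_nonneg (by positivity), abs_of_nonneg (by positivity)]
      have : (k : ℝ) * Real.log t ^ (k - 1) ≤ k * (2 ^ (k - 1) * (k - 1).factorial * √t) := by
        gcongr
      rw [hA]
      linarith
    calc _ ≤ (A * √t) * (t * √t) := by gcongr
      _ = A * (t * (√t * √t)) := by ring
      _ = A * t ^ 2 := by rw [hst]; ring
  obtain ⟨c, hc⟩ := exists_abs_sum_sub_antideriv_le hA0 hd1 hd2 hd3 hd4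
  exact ⟨c, 10 * A, by positivity, hc⟩

/-- The constants in the expansions of `∑_{n ≤ t} (log n)^k / n` for `k = 0, 1, 2`. -/
theorem exists_logSum_expansions : ∃ c₀ c₁ c₂ C : ℝ, 0 ≤ C ∧ ∀ t : ℝ, 1 ≤ t →
    |harmonicSum t - Real.log t - c₀| ≤ C / √t ∧
    |logSum 1 t - Real.log t ^ 2 / 2 - c₁| ≤ C / √t ∧
    |logSum 2 t - Real.log t ^ 3 / 3 - c₂| ≤ C / √t := by
  obtain ⟨c₀, C₀, h0, H0⟩ := exists_abs_logSum_sub_le 0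
  obtain ⟨c₁, C₁, h1, H1⟩ := exists_abs_logSum_sub_le 1
  obtain ⟨c₂, C₂, h2, H2⟩ := exists_abs_logSum_sub_le 2
  refine ⟨c₀, c₁, c₂, C₀ + C₁ + C₂, by positivity, fun t ht => ?_⟩
  have hle : ∀ {x a : ℝ}, x ≤ a / √t → a ≤ C₀ + C₁ + C₂ → x ≤ (C₀ + C₁ + C₂) / √t :=
    fun hx ha => hx.trans (div_le_div_of_nonneg_right ha (Real.sqrt_nonneg _))
  refine ⟨hle (a := C₀) ?_ (by linarith), hle (a := C₁) ?_ (by linarith),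
    hle (a := C₂) ?_ (by linarith)⟩
  · have := H0 t ht
    simpa [logSum, harmonicSum] using this
  · have := H1 t ht
    norm_num at this ⊢
    exact this
  · have := H2 t ht
    norm_num at this ⊢
    exact this

/-! ### Möbius inversion of logarithmic averages -/

theorem sum_moebius_sum_one_div {G : ℝ → ℝ} (hG : ∀ y < 1, G y = 0) {N : ℕ} (hN : 1 ≤ N) {R : ℝ}
    (hR : R < N + 1) :
    ∑ d ∈ Finset.Icc 1 N, (ArithmeticFunction.moebius d : ℝ) / d *
      ∑ n ∈ Finset.Icc 1 N, 1 / (n : ℝ) * G (R / d / n) = G R := by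
  have h1 : ∑ d ∈ Finset.Icc 1 N, (ArithmeticFunction.moebius d : ℝ) / d *
      ∑ n ∈ Finset.Icc 1 N, 1 / (n : ℝ) * G (R / d / n)
      = ∑ x ∈ Finset.Icc 1 N ×ˢ Finset.Icc 1 N, ∑ m ∈ Finset.Icc 1 N,
        if x.1 * x.2 = m then (ArithmeticFunction.moebius x.1 : ℝ) * (1 / m * G (R / m)) else 0 := by
    rw [Finset.sum_product]
    refine Finset.sum_congr rfl fun d hd => ?_
    rw [Finset.mul_sum]
    refine Finset.sum_congr rfl fun n hn => ?_
    rw [Finset.sum_ite_eq]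
    have hd1 := (Finset.mem_Icc.mp hd).1
    have hn1 := (Finset.mem_Icc.mp hn).1
    have hd0 : (d : ℝ) ≠ 0 := by exact_mod_cast (by omega : d ≠ 0)
    have hn0 : (n : ℝ) ≠ 0 := by exact_mod_cast (by omega : n ≠ 0)
    rw [div_div]
    split_ifs with hmem
    · push_cast
      field_simp
    · have hlt : N < d * n := by
        by_contra h
        exact hmem (Finset.mem_Icc.mpr ⟨Nat.mul_pos hd1 hn1, not_lt.mp h⟩)
      have : (N : ℝ) + 1 ≤ (d : ℝ) * n := by exact_mod_cast hlt
      rw [hG (R / (d * n)) ((div_lt_one (by positivity)).mpr (by linarith))]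
      ring
  rw [h1, Finset.sum_comm]
  have h2 : ∀ m ∈ Finset.Icc 1 N, ∑ x ∈ Finset.Icc 1 N ×ˢ Finset.Icc 1 N,
      (if x.1 * x.2 = m then (ArithmeticFunction.moebius x.1 : ℝ) * (1 / m * G (R / m)) else 0)
      = if m = 1 then 1 / m * G (R / m) else 0 := by
    intro m hm
    obtain ⟨hm1, hmN⟩ := Finset.mem_Icc.mp hm
    rw [← Finset.sum_filter]
    have hset : (Finset.Icc 1 N ×ˢ Finset.Icc 1 N).filter (fun x => x.1 * x.2 = m)
        = m.divisorsAntidiagonal := by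
      rw [Nat.divisorsAntidiagonal_eq_prod_filter_of_le (by omega) hmN]
      congr 1
    rw [hset, ← Finset.sum_mul]
    have h3 := congrArg (fun f : ArithmeticFunction ℝ => f m)
      (ArithmeticFunction.coe_moebius_mul_coe_zeta (R := ℝ))
    simp only [ArithmeticFunction.mul_apply, ArithmeticFunction.one_apply] at h3
    have h4 : ∑ x ∈ m.divisorsAntidiagonal, (ArithmeticFunction.moebius x.1 : ℝ)
        = if m = 1 then 1 else 0 := by
      rw [← h3]
      refine Finset.sum_congr rfl fun x hx => ?_
      have : x.2 ≠ 0 := fun h => by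
        have := (Nat.mem_divisorsAntidiagonal.mp hx)
        rw [h] at this; omega
      simp [this]
    rw [h4]
    split_ifs <;> simp
  rw [Finset.sum_congr rfl h2, Finset.sum_ite_eq', if_pos (Finset.mem_Icc.mpr ⟨le_rfl, hN⟩)]
  simp

theorem sum_Icc_eq_sum_Icc_floor {F : ℕ → ℝ} {N : ℕ} {X : ℝ} (hX : X < N + 1)
    (hF : ∀ n : ℕ, 1 ≤ n → X < n → F n = 0) :
    ∑ n ∈ Finset.Icc 1 N, F n = ∑ n ∈ Finset.Icc 1 ⌊X⌋₊, F n := by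
  have hle : ⌊X⌋₊ ≤ N := by
    have : ⌊X⌋₊ < N + 1 := Nat.floor_lt' (by omega) |>.mpr (by push_cast; exact hX)
    omega
  refine (Finset.sum_subset (Finset.Icc_subset_Icc_right hle) fun n hn hn' => ?_).symm
  have h1 := (Finset.mem_Icc.mp hn).1
  refine hF n h1 (Nat.lt_of_floor_lt ?_)
  by_contra h
  exact hn' (Finset.mem_Icc.mpr ⟨h1, not_lt.mp h⟩)

theorem sum_Icc_one_div_le {N : ℕ} {X : ℝ} (hX1 : 1 ≤ X) (hX : X < N + 1) {g : ℕ → ℝ} {E : ℝ}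
    (hE : 0 ≤ E) (hg0 : ∀ n : ℕ, 1 ≤ n → X < n → g n = 0)
    (hg : ∀ n : ℕ, 1 ≤ n → (n : ℝ) ≤ X → |g n| ≤ E / n) :
    |∑ n ∈ Finset.Icc 1 N, g n| ≤ E * (1 + Real.log X) := by
  rw [sum_Icc_eq_sum_Icc_floor hX hg0]
  calc _ ≤ ∑ n ∈ Finset.Icc 1 ⌊X⌋₊, |g n| := Finset.abs_sum_le_sum_abs _ _
    _ ≤ ∑ n ∈ Finset.Icc 1 ⌊X⌋₊, E * (1 / (n : ℝ)) := by
      refine Finset.sum_le_sum fun n hn => ?_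
      obtain ⟨h1, h2⟩ := Finset.mem_Icc.mp hn
      rw [mul_one_div]
      exact hg n h1 ((Nat.le_floor_iff (by linarith)).mp h2)
    _ = E * harmonicSum X := by rw [harmonicSum, Finset.mul_sum]
    _ ≤ _ := by gcongr; exact harmonicSum_le hX1

/-- The logarithmic averages of a quadratic polynomial in `log y`. -/
theorem exists_abs_sum_quadratic_log_sub_le {c₀ c₁ c₂ C : ℝ} (hC : 0 ≤ C)
    (h : ∀ t : ℝ, 1 ≤ t → |harmonicSum t - Real.log t - c₀| ≤ C / √t ∧
      |logSum 1 t - Real.log t ^ 2 / 2 - c₁| ≤ C / √t ∧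
      |logSum 2 t - Real.log t ^ 3 / 3 - c₂| ≤ C / √t) :
    ∃ C' : ℝ, 0 ≤ C' ∧ ∀ β κ y : ℝ, 1 ≤ y →
      |∑ n ∈ Finset.Icc 1 ⌊y⌋₊, 1 / (n : ℝ) *
          (3 / 4 * Real.log (y / n) ^ 2 + β * Real.log (y / n) + κ)
        - (1 / 4 * Real.log y ^ 3 + (3 / 4 * c₀ + β / 2) * Real.log y ^ 2
            + (-(3 / 2) * c₁ + β * c₀ + κ) * Real.log y)|
      ≤ C' * (1 + |β| + |κ|) := by
  refine ⟨20 * C + |c₂| + |c₁| + |c₀|, by positivity, fun β κ y hy => ?_⟩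
  obtain ⟨h0, h1, h2⟩ := h y hy
  set L := Real.log y with hL
  have hL0 : 0 ≤ L := Real.log_nonneg hy
  have hs1 : 1 ≤ √y := Real.one_le_sqrt.mpr hy
  have hs0 : 0 < √y := by linarith
  have hL1 : L ≤ 2 * √y := by
    have := log_pow_le_sqrt 1 hy; simpa using this
  have hL2 : L ^ 2 ≤ 8 * √y := by
    have := log_pow_le_sqrt 2 hy; norm_num at this; exact this
  have hexp : ∑ n ∈ Finset.Icc 1 ⌊y⌋₊, 1 / (n : ℝ) *
      (3 / 4 * Real.log (y / n) ^ 2 + β * Real.log (y / n) + κ)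
      = (3 / 4 * L ^ 2 + β * L + κ) * harmonicSum y - (3 / 2 * L + β) * logSum 1 y
        + 3 / 4 * logSum 2 y := by
    simp only [harmonicSum, logSum, Finset.mul_sum, ← Finset.sum_add_distrib,
      ← Finset.sum_sub_distrib]
    refine Finset.sum_congr rfl fun n hn => ?_
    have hn0 : (n : ℝ) ≠ 0 := by
      have := (Finset.mem_Icc.mp hn).1
      exact_mod_cast (by omega : n ≠ 0)
    rw [Real.log_div (by linarith) hn0, ← hL]
    ring
  set r0 := harmonicSum y - L - c₀ with hr0
  set r1 := logSum 1 y - L ^ 2 / 2 - c₁ with hr1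
  set r2 := logSum 2 y - L ^ 3 / 3 - c₂ with hr2
  rw [hexp, show harmonicSum y = r0 + L + c₀ by rw [hr0]; ring,
    show logSum 1 y = r1 + L ^ 2 / 2 + c₁ by rw [hr1]; ring,
    show logSum 2 y = r2 + L ^ 3 / 3 + c₂ by rw [hr2]; ring]
  have hid : (3 / 4 * L ^ 2 + β * L + κ) * (r0 + L + c₀)
        - (3 / 2 * L + β) * (r1 + L ^ 2 / 2 + c₁) + 3 / 4 * (r2 + L ^ 3 / 3 + c₂)
        - (1 / 4 * L ^ 3 + (3 / 4 * c₀ + β / 2) * L ^ 2 + (-(3 / 2) * c₁ + β * c₀ + κ) * L)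
      = 3 / 4 * (L ^ 2 * r0) + β * (L * r0) + κ * r0 - 3 / 2 * (L * r1) - β * r1 + 3 / 4 * r2
        + κ * c₀ - β * c₁ + 3 / 4 * c₂ := by ring
  rw [hid]
  have hCs : C / √y ≤ C := div_le_self hC hs1
  have b0 : |r0| ≤ C := h0.trans hCs
  have b1 : |r1| ≤ C := h1.trans hCs
  have b2 : |r2| ≤ C := h2.trans hCs
  have hmul : ∀ {A r K : ℝ}, 0 ≤ A → A ≤ K * √y → |r| ≤ C / √y → |A * r| ≤ K * C := by
    intro A r K hA hAK hr
    rw [abs_mul, abs_of_nonneg hA]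
    calc A * |r| ≤ (K * √y) * (C / √y) := by gcongr; linarith
      _ = K * C := by field_simp
  have e1 := hmul (sq_nonneg L) hL2 h0
  have e2 := hmul hL0 hL1 h0
  have e3 := hmul hL0 hL1 h1
  have hprod : ∀ {a b K : ℝ}, |b| ≤ K → |a * b| ≤ |a| * K := by
    intro a b K hb
    rw [abs_mul]; gcongr
  have f1 : |3 / 4 * (L ^ 2 * r0)| ≤ 6 * C := by
    refine (hprod e1).trans ?_
    rw [abs_of_pos (by norm_num)]; linarith
  have f2 : |β * (L * r0)| ≤ |β| * (2 * C) := hprod e2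
  have f3 : |κ * r0| ≤ |κ| * C := hprod b0
  have f4 : |3 / 2 * (L * r1)| ≤ 3 * C := by
    refine (hprod e3).trans ?_
    rw [abs_of_pos (by norm_num)]; linarith
  have f5 : |β * r1| ≤ |β| * C := hprod b1
  have f6 : |3 / 4 * r2| ≤ C := by
    refine (hprod b2).trans ?_
    rw [abs_of_pos (by norm_num)]; linarith
  have f7 : |κ * c₀| ≤ |κ| * |c₀| := hprod le_rfl
  have f8 : |β * c₁| ≤ |β| * |c₁| := hprod le_rfl
  have f9 : |3 / 4 * c₂| ≤ |c₂| := by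
    refine (hprod le_rfl).trans ?_
    rw [abs_of_pos (by norm_num)]; linarith [abs_nonneg c₂]
  have p1 : 0 ≤ |β| * C := by positivity
  have p2 : 0 ≤ |κ| * C := by positivity
  have p3 : 0 ≤ |β| * |c₀| := by positivity
  have p4 : 0 ≤ |β| * |c₂| := by positivity
  have p5 : 0 ≤ |κ| * |c₁| := by positivity
  have p6 : 0 ≤ |κ| * |c₂| := by positivity
  have p7 := abs_nonneg c₀
  have p8 := abs_nonneg c₁
  have htarget : (20 * C + |c₂| + |c₁| + |c₀|) * (1 + |β| + |κ|)
      = 20 * C + |c₂| + |c₁| + |c₀| + 20 * (|β| * C) + |β| * |c₂| + |β| * |c₁| + |β| * |c₀|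
        + 20 * (|κ| * C) + |κ| * |c₂| + |κ| * |c₁| + |κ| * |c₀| := by ring
  rw [htarget, abs_le]
  rw [abs_le] at f1 f2 f3 f4 f5 f6 f7 f8 f9
  constructor <;> linarith [f1.1, f1.2, f2.1, f2.2, f3.1, f3.2, f4.1, f4.2, f5.1, f5.2]

/-- If `F` is a cubic polynomial in `log y` with leading coefficient `1/4` up to a bounded error,
then its Möbius average is asymptotic to `(3/4) (log R)²`, the quadratic polynomial whose logarithmic
averages reproduce `F`. -/
theorem exists_abs_sum_moebius_mul_sub_le : ∃ C : ℝ, 0 ≤ C ∧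
    ∀ (F : ℝ → ℝ) (b c E : ℝ), 0 ≤ E → (∀ y < 1, F y = 0) → ∀ (N : ℕ),
    (∀ y : ℝ, 1 ≤ y → y < N + 1 →
      |F y - (1 / 4 * Real.log y ^ 3 + b * Real.log y ^ 2 + c * Real.log y)| ≤ E) →
    ∀ R : ℝ, 1 ≤ R → R < N + 1 →
      |∑ d ∈ Finset.Icc 1 N, (ArithmeticFunction.moebius d : ℝ) / d * F (R / d)
          - 3 / 4 * Real.log R ^ 2| ≤ C * (1 + |b| + |c| + E) * (1 + Real.log R) := by
  obtain ⟨c₀, c₁, c₂, C₀, hC0, hexp⟩ := exists_logSum_expansions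
  obtain ⟨C₁, hC1, hquad⟩ := exists_abs_sum_quadratic_log_sub_le hC0 hexp
  set A : ℝ := 2 + 3 * |c₀| + 3 / 2 * |c₁| + 3 / 2 * |c₀| ^ 2 with hA
  have hA0 : 0 ≤ A := by positivity
  refine ⟨(1 + C₁ * 2) * (1 + A), by positivity, fun F b c E hE hF N hFb R hR hRN => ?_⟩
  have hlR := Real.log_nonneg hR
  have hN : 1 ≤ N := by
    have : (0 : ℝ) < N := by linarith
    exact_mod_cast this
  -- The coefficients of the quadratic polynomial `G` below, from comparing coefficients.
  set β : ℝ := 2 * b - 3 / 2 * c₀ with hβ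
  set κ : ℝ := c + 3 / 2 * c₁ - β * c₀ with hκ
  have hβκ : |β| + |κ| ≤ A * (1 + |b| + |c|) := by
    have h1 : |β| ≤ 2 * |b| + 3 / 2 * |c₀| := by
      refine (abs_sub _ _).trans ?_
      rw [abs_mul, abs_mul, abs_of_pos (by norm_num : (0 : ℝ) < 2),
        abs_of_pos (by norm_num : (0 : ℝ) < 3 / 2)]
    have h2 : |κ| ≤ |c| + 3 / 2 * |c₁| + |β| * |c₀| := by
      refine (abs_sub _ _).trans ?_
      rw [abs_mul]
      have := abs_add_le c (3 / 2 * c₁)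
      rw [abs_mul, abs_of_pos (by norm_num : (0 : ℝ) < 3 / 2)] at this
      linarith
    have h3 : |β| * |c₀| ≤ (2 * |b| + 3 / 2 * |c₀|) * |c₀| := by gcongr
    have p1 : 0 ≤ |c₀| * |b| := by positivity
    have p2 : 0 ≤ |c₀| * |c| := by positivity
    have p3 : 0 ≤ |c₁| * |b| := by positivity
    have p4 : 0 ≤ |c₁| * |c| := by positivity
    have p5 : 0 ≤ |c₀| ^ 2 * |b| := by positivity
    have p6 : 0 ≤ |c₀| ^ 2 * |c| := by positivity
    have p7 := abs_nonneg b
    have p8 := abs_nonneg c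
    have p9 := abs_nonneg c₀
    have : A * (1 + |b| + |c|) = 2 + 3 * |c₀| + 3 / 2 * |c₁| + 3 / 2 * |c₀| ^ 2
      + 2 * |b| + 3 * (|c₀| * |b|) + 3 / 2 * (|c₁| * |b|) + 3 / 2 * (|c₀| ^ 2 * |b|)
      + 2 * |c| + 3 * (|c₀| * |c|) + 3 / 2 * (|c₁| * |c|) + 3 / 2 * (|c₀| ^ 2 * |c|) := by
      rw [hA]; ring
    rw [this]
    nlinarith
  -- The quadratic polynomial in `log y` whose logarithmic averages match the cubic one.
  set G : ℝ → ℝ := fun y => if 1 ≤ y then 3 / 4 * Real.log y ^ 2 + β * Real.log y + κ else 0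
    with hG
  have hG0 : ∀ y < 1, G y = 0 := fun y hy => if_neg (not_le.mpr hy)
  have hGR : G R = 3 / 4 * Real.log R ^ 2 + β * Real.log R + κ := if_pos hR
  have hinv := sum_moebius_sum_one_div hG0 hN hRN
  set E' : ℝ := E + C₁ * (1 + |β| + |κ|) with hE'
  have hE'0 : 0 ≤ E' := by positivity
  have hdiff : |∑ d ∈ Finset.Icc 1 N, ((ArithmeticFunction.moebius d : ℝ) / d * F (R / d)
      - (ArithmeticFunction.moebius d : ℝ) / d *
        ∑ n ∈ Finset.Icc 1 N, 1 / (n : ℝ) * G (R / d / n))| ≤ E' * (1 + Real.log R) := by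
    refine sum_Icc_one_div_le hR hRN hE'0 (fun d hd hlt => ?_) fun d hd hle => ?_
    · have hlt1 : R / d < 1 := (div_lt_one (by linarith)).mpr hlt
      rw [hF _ hlt1, Finset.sum_eq_zero fun n _ => by
        rw [hG0 _ (div_natCast_lt_one hlt1 n), mul_zero]]
      ring
    · have hd0 : (0 : ℝ) < d := by exact_mod_cast hd
      have hy1 : 1 ≤ R / d := (one_le_div hd0).mpr hle
      have hyR : R / d ≤ R := div_le_self (by linarith) (by exact_mod_cast hd)
      have hsum : ∑ n ∈ Finset.Icc 1 N, 1 / (n : ℝ) * G (R / d / n)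
          = ∑ n ∈ Finset.Icc 1 ⌊R / d⌋₊, 1 / (n : ℝ) *
            (3 / 4 * Real.log (R / d / n) ^ 2 + β * Real.log (R / d / n) + κ) := by
        rw [sum_Icc_eq_sum_Icc_floor (X := R / d) (by linarith) fun n _ hlt => by
          rw [hG0 _ ((div_lt_one (by linarith)).mpr hlt), mul_zero]]
        refine Finset.sum_congr rfl fun n hn => ?_
        obtain ⟨h1, h2⟩ := Finset.mem_Icc.mp hn
        have h3 := (Nat.le_floor_iff (by linarith)).mp h2
        have : 1 ≤ R / d / n := (one_le_div (by exact_mod_cast h1)).mpr h3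
        simp only [hG, if_pos this]
      have hq := hquad β κ (R / d) hy1
      rw [← hsum] at hq
      have hf := hFb (R / d) hy1 (by linarith)
      rw [show 3 / 4 * c₀ + β / 2 = b by rw [hβ]; ring,
        show -(3 / 2) * c₁ + β * c₀ + κ = c by rw [hκ]; ring] at hq
      rw [← mul_sub, abs_mul, abs_div, abs_of_pos hd0]
      have hmu : |(ArithmeticFunction.moebius d : ℝ)| ≤ 1 := by
        exact_mod_cast ArithmeticFunction.abs_moebius_le_one
      have htri : |F (R / d) - ∑ n ∈ Finset.Icc 1 N, 1 / (n : ℝ) * G (R / d / n)| ≤ E' := by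
        rw [abs_le] at hq hf ⊢
        constructor <;> linarith [hq.1, hq.2, hf.1, hf.2]
      calc _ ≤ 1 / (d : ℝ) * E' := by gcongr
        _ = E' / d := by ring
  rw [Finset.sum_sub_distrib, hinv, hGR] at hdiff
  have hmain : E' * (1 + Real.log R) + |β| * Real.log R + |κ|
      ≤ (1 + C₁ * 2) * (1 + A) * (1 + |b| + |c| + E) * (1 + Real.log R) := by
    have h1 : E' + (|β| + |κ|) ≤ (1 + C₁ * 2) * (1 + A) * (1 + |b| + |c| + E) := by
      set S := 1 + |b| + |c| with hS
      have hS0 : 0 ≤ S := by positivity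
      have h2 : 1 + |β| + |κ| ≤ (1 + A) * S := by
        have := abs_nonneg b
        have := abs_nonneg c
        nlinarith
      have h3 : C₁ * (1 + |β| + |κ|) ≤ C₁ * ((1 + A) * S) := by gcongr
      have p1 : 0 ≤ C₁ * ((1 + A) * S) := by positivity
      have p2 : 0 ≤ A * E := by positivity
      have p3 : 0 ≤ C₁ * ((1 + A) * E) := by positivity
      have p4 := abs_nonneg β
      have e : (1 + C₁ * 2) * (1 + A) * (S + E) = (1 + A) * S + E + A * E
        + 2 * (C₁ * ((1 + A) * S)) + 2 * (C₁ * ((1 + A) * E)) := by ring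
      rw [e, hE']
      linarith
    have h4 : |β| * Real.log R + |κ| ≤ (|β| + |κ|) * (1 + Real.log R) := by
      have := mul_nonneg (abs_nonneg κ) hlR
      have := abs_nonneg β
      linarith
    have h5 := mul_le_mul_of_nonneg_right h1 (by linarith : 0 ≤ 1 + Real.log R)
    linarith
  refine le_trans ?_ hmain
  have h6 : |β * Real.log R| = |β| * Real.log R := by rw [abs_mul, abs_of_nonneg hlR]
  have h7 := abs_le.mp h6.le
  have h8 := abs_le.mp (le_refl |κ|)
  rw [abs_le] at hdiff ⊢
  constructor <;> linarith [hdiff.1, hdiff.2, h7.1, h7.2, h8.1, h8.2]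

/-! ### A sum over three integers with bounded pairwise products -/

theorem sum_Ioc_floor_eq_sub (f : ℕ → ℝ) {Y P : ℝ} (hYP : Y ≤ P) :
    ∑ e ∈ Finset.Ioc ⌊Y⌋₊ ⌊P⌋₊, f e
      = ∑ e ∈ Finset.Icc 1 ⌊P⌋₊, f e - ∑ e ∈ Finset.Icc 1 ⌊Y⌋₊, f e := by
  rw [eq_sub_iff_add_eq, ← Finset.sum_union]
  · refine Finset.sum_congr ?_ fun _ _ => rfl
    have := Nat.floor_le_floor hYP
    ext e
    simp only [Finset.mem_union, Finset.mem_Ioc, Finset.mem_Icc]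
    omega
  · refine Finset.disjoint_left.mpr fun e he he' => ?_
    simp only [Finset.mem_Ioc, Finset.mem_Icc] at he he'
    omega

theorem sum_fourthRoot_div_le (n : ℕ) :
    ∑ e ∈ Finset.Icc 1 n, √√(e : ℝ) / e ≤ 4 * √√(n : ℝ) := by
  induction n with
  | zero => simp
  | succ n ih =>
    rw [Finset.sum_Icc_succ_top (by omega)]
    set a := √√((n + 1 : ℕ) : ℝ) with ha
    set b := √√(n : ℝ) with hb
    have ha4 : a ^ 4 = n + 1 := by
      rw [ha, show (4 : ℕ) = 2 * 2 by norm_num, pow_mul, Real.sq_sqrt (Real.sqrt_nonneg _),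
        Real.sq_sqrt (Nat.cast_nonneg _)]
      push_cast; ring
    have hb4 : b ^ 4 = n := by
      rw [hb, show (4 : ℕ) = 2 * 2 by norm_num, pow_mul, Real.sq_sqrt (Real.sqrt_nonneg _),
        Real.sq_sqrt (Nat.cast_nonneg _)]
    have ha0 : 0 < a := Real.sqrt_pos.mpr (Real.sqrt_pos.mpr (by positivity))
    have hb0 : 0 ≤ b := Real.sqrt_nonneg _
    have hba : b ≤ a := Real.sqrt_le_sqrt (Real.sqrt_le_sqrt (by push_cast; linarith))
    have hn : ((n + 1 : ℕ) : ℝ) = a ^ 4 := by rw [ha4]; push_cast; ring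
    have hstep : a / ((n + 1 : ℕ) : ℝ) ≤ 4 * (a - b) := by
      rw [hn, div_le_iff₀ (by positivity)]
      have h1 : (a - b) * (a ^ 3 + a ^ 2 * b + a * b ^ 2 + b ^ 3) = 1 := by
        have : (a - b) * (a ^ 3 + a ^ 2 * b + a * b ^ 2 + b ^ 3) = a ^ 4 - b ^ 4 := by ring
        rw [this, ha4, hb4]; ring
      have h2 : a ^ 3 + a ^ 2 * b + a * b ^ 2 + b ^ 3 ≤ 4 * a ^ 3 := by
        have e1 : a ^ 2 * b ≤ a ^ 2 * a := by gcongr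
        have e2 : a * b ^ 2 ≤ a * a ^ 2 := by gcongr
        have e3 : b ^ 3 ≤ a ^ 3 := by gcongr
        nlinarith
      have h3 := mul_le_mul_of_nonneg_left h2 (sub_nonneg.mpr hba)
      rw [h1] at h3
      have := mul_le_mul_of_nonneg_left h3 ha0.le
      linarith
    linarith

theorem sum_Ioc_inv_fourthRoot_le {Y P : ℝ} (hP : 1 ≤ P) :
    ∑ e ∈ Finset.Ioc ⌊Y⌋₊ ⌊P⌋₊, 1 / (e : ℝ) * (1 / √√(P / e)) ≤ 4 := by
  have hq : 0 < √√P := Real.sqrt_pos.mpr (Real.sqrt_pos.mpr (by linarith))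
  have h1 : ∑ e ∈ Finset.Ioc ⌊Y⌋₊ ⌊P⌋₊, 1 / (e : ℝ) * (1 / √√(P / e))
      ≤ ∑ e ∈ Finset.Icc 1 ⌊P⌋₊, 1 / (e : ℝ) * (1 / √√(P / e)) := by
    refine Finset.sum_le_sum_of_subset_of_nonneg (fun e he => ?_) fun e _ _ => by positivity
    simp only [Finset.mem_Ioc, Finset.mem_Icc] at he ⊢
    omega
  have h2 : ∑ e ∈ Finset.Icc 1 ⌊P⌋₊, 1 / (e : ℝ) * (1 / √√(P / e))
      = (∑ e ∈ Finset.Icc 1 ⌊P⌋₊, √√(e : ℝ) / e) / √√P := by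
    rw [Finset.sum_div]
    refine Finset.sum_congr rfl fun e _ => ?_
    rw [Real.sqrt_div (by linarith), Real.sqrt_div (Real.sqrt_nonneg _)]
    field_simp
  rw [h2] at h1
  refine h1.trans ?_
  rw [div_le_iff₀ hq]
  refine (sum_fourthRoot_div_le _).trans ?_
  have : √√((⌊P⌋₊ : ℕ) : ℝ) ≤ √√P :=
    Real.sqrt_le_sqrt (Real.sqrt_le_sqrt (Nat.floor_le (by linarith)))
  linarith

theorem one_add_log_div_sqrt_le {u : ℝ} (hu : 1 ≤ u) : (1 + Real.log u) / √u ≤ 4 / √√u := by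
  have hs : 1 ≤ √u := Real.one_le_sqrt.mpr hu
  have hq : 1 ≤ √√u := Real.one_le_sqrt.mpr hs
  have hqq : √√u * √√u = √u := Real.mul_self_sqrt (Real.sqrt_nonneg _)
  have h1 : Real.log u = 4 * Real.log √√u := by
    have e : u = (√√u) ^ 4 := by
      rw [show (4 : ℕ) = 2 * 2 by norm_num, pow_mul, Real.sq_sqrt (Real.sqrt_nonneg _),
        Real.sq_sqrt (by linarith)]
    conv_lhs => rw [e, Real.log_pow]
    norm_num
  have h2 := Real.log_le_sub_one_of_pos (by linarith : 0 < √√u)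
  rw [div_le_div_iff₀ (by linarith) (by linarith)]
  generalize √√u = v at hq hqq h1 h2
  rw [← hqq]
  nlinarith

/-- The cubic polynomial approximating `∑_{Y < e ≤ P} (1/e) H(P/e) H(Q/e)`, where `H` is the harmonic
sum, in terms of `ℓ = log (P/Y)` and `δ = log (Q/P)`. -/
noncomputable def outerPoly (γ ℓ δ : ℝ) : ℝ :=
  ℓ ^ 3 / 3 + γ * ℓ ^ 2 + γ ^ 2 * ℓ + δ * (ℓ ^ 2 / 2 + γ * ℓ)

set_option maxHeartbeats 400000 in
theorem exists_abs_sum_harmonicSum_mul_sub_le {c₀ c₁ c₂ C : ℝ} (hC : 0 ≤ C)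
    (h : ∀ t : ℝ, 1 ≤ t → |harmonicSum t - Real.log t - c₀| ≤ C / √t ∧
      |logSum 1 t - Real.log t ^ 2 / 2 - c₁| ≤ C / √t ∧
      |logSum 2 t - Real.log t ^ 3 / 3 - c₂| ≤ C / √t) :
    ∃ C' : ℝ, 0 ≤ C' ∧ ∀ Y P Q : ℝ, 1 ≤ Y → Y ≤ P → P ≤ Q →
      |∑ e ∈ Finset.Ioc ⌊Y⌋₊ ⌊P⌋₊, 1 / (e : ℝ) * (harmonicSum (P / e) * harmonicSum (Q / e))
        - outerPoly c₀ (Real.log P - Real.log Y) (Real.log Q - Real.log P)|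
      ≤ C' * (1 + (Real.log Q - Real.log P)) * (1 + (1 + Real.log P) ^ 2 / √Y) := by
  set g := |c₀| with hg
  have hg0 : 0 ≤ g := abs_nonneg _
  refine ⟨16 * (C * (2 + g)) + 2 * C * (4 * (1 + g) ^ 2), by positivity,
    fun Y P Q hY hYP hPQ => ?_⟩
  have hP : 1 ≤ P := hY.trans hYP
  have hQ : 1 ≤ Q := hP.trans hPQ
  set a := Real.log P with ha
  set y := Real.log Y with hy
  set δ := Real.log Q - a with hδ
  have ha0 : 0 ≤ a := Real.log_nonneg hP
  have hδ0 : 0 ≤ δ := sub_nonneg.mpr (Real.log_le_log (by linarith) hPQ)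
  -- The product of harmonic sums is replaced by the product of logarithms.
  have step1 : |∑ e ∈ Finset.Ioc ⌊Y⌋₊ ⌊P⌋₊, 1 / (e : ℝ) * (harmonicSum (P / e) * harmonicSum (Q / e))
      - ∑ e ∈ Finset.Ioc ⌊Y⌋₊ ⌊P⌋₊, 1 / (e : ℝ) * ((a - Real.log e + c₀) *
        (a + δ - Real.log e + c₀))| ≤ 16 * (C * (2 + g)) * (1 + δ) := by
    rw [← Finset.sum_sub_distrib]
    have hterm : ∀ e ∈ Finset.Ioc ⌊Y⌋₊ ⌊P⌋₊,
        |1 / (e : ℝ) * (harmonicSum (P / e) * harmonicSum (Q / e)) - 1 / (e : ℝ) *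
          ((a - Real.log e + c₀) * (a + δ - Real.log e + c₀))|
        ≤ 4 * (C * (2 + g)) * (1 + δ) * (1 / (e : ℝ) * (1 / √√(P / e))) := by
      intro e he
      obtain ⟨he1, he2⟩ := Finset.mem_Ioc.mp he
      have hepos : 0 < e := by omega
      have he0 : (0 : ℝ) < e := by exact_mod_cast hepos
      have heP : (e : ℝ) ≤ P := (Nat.le_floor_iff (by linarith)).mp he2
      have hu : 1 ≤ P / e := (one_le_div he0).mpr heP
      have hw : 1 ≤ Q / e := (one_le_div he0).mpr (heP.trans hPQ)
      have hlu : Real.log (P / e) = a - Real.log e := Real.log_div (by linarith) he0.ne'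
      have hlw : Real.log (Q / e) = a + δ - Real.log e := by
        rw [Real.log_div (by linarith) he0.ne', hδ]; ring
      have h1 := (h _ hu).1
      have h2 := (h _ hw).1
      have hHw : |harmonicSum (Q / e)| ≤ 1 + Real.log (Q / e) := by
        rw [abs_of_nonneg (harmonicSum_nonneg _)]; exact harmonicSum_le hw
      set u := P / (e : ℝ) with hudef
      set w := Q / (e : ℝ) with hwdef
      have huw : u ≤ w := by rw [hudef, hwdef]; gcongr
      have hsu : 0 < √u := Real.sqrt_pos.mpr (by linarith)
      have hC2 : C / √w ≤ C / √u := by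
        have := Real.sqrt_le_sqrt huw
        gcongr
      have hl0 := Real.log_nonneg hu
      set x := Real.log u with hx
      have hlw' : Real.log w = x + δ := by rw [hlw, hlu]; ring
      rw [← mul_sub, abs_mul, abs_of_pos (by positivity : 0 < 1 / (e : ℝ)), ← hlu,
        show a + δ - Real.log e = x + δ by rw [hlu]; ring]
      have hid : harmonicSum u * harmonicSum w - (x + c₀) * (x + δ + c₀)
          = (harmonicSum u - x - c₀) * harmonicSum w
            + (x + c₀) * (harmonicSum w - Real.log w - c₀) := by rw [hlw']; ring
      have hxc : |x + c₀| ≤ x + g := by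
        refine (abs_add_le _ _).trans ?_
        rw [abs_of_nonneg hl0]
      have hb : |harmonicSum u * harmonicSum w - (x + c₀) * (x + δ + c₀)|
          ≤ 4 * (C * (2 + g)) * (1 + δ) * (1 / √√u) := by
        rw [hid]
        refine (abs_add_le _ _).trans ?_
        rw [abs_mul, abs_mul]
        calc _ ≤ C / √u * (1 + Real.log w) + (x + g) * (C / √u) := by
              gcongr
              exact h2.trans hC2
          _ = C / √u * (1 + 2 * x + δ + g) := by rw [hlw']; ring
          _ ≤ C / √u * ((2 + g) * (1 + δ) * (1 + x)) := by
              have : 1 + 2 * x + δ + g ≤ (2 + g) * (1 + δ) * (1 + x) := by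
                have p1 : 0 ≤ δ * x := by positivity
                have p2 : 0 ≤ g * x := by positivity
                have p3 : 0 ≤ g * δ := by positivity
                have p4 : 0 ≤ g * (δ * x) := by positivity
                have e : (2 + g) * (1 + δ) * (1 + x) = 2 + 2 * x + 2 * δ + g + 2 * (δ * x)
                  + g * x + g * δ + g * (δ * x) := by ring
                linarith
              gcongr
          _ = C * (2 + g) * (1 + δ) * ((1 + x) / √u) := by ring
          _ ≤ C * (2 + g) * (1 + δ) * (4 / √√u) := by
              refine mul_le_mul_of_nonneg_left (one_add_log_div_sqrt_le hu) (by positivity)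
          _ = _ := by ring
      calc _ ≤ 1 / (e : ℝ) * (4 * (C * (2 + g)) * (1 + δ) * (1 / √√u)) := by gcongr
        _ = _ := by ring
    refine (Finset.abs_sum_le_sum_abs _ _).trans ((Finset.sum_le_sum hterm).trans ?_)
    rw [← Finset.mul_sum]
    have := sum_Ioc_inv_fourthRoot_le (Y := Y) hP
    calc _ ≤ 4 * (C * (2 + g)) * (1 + δ) * 4 := by gcongr
      _ = _ := by ring
  -- The sum of logarithms is evaluated by the expansions of the logarithmic sums.
  have step2 : |∑ e ∈ Finset.Ioc ⌊Y⌋₊ ⌊P⌋₊, 1 / (e : ℝ) * ((a - Real.log e + c₀) *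
        (a + δ - Real.log e + c₀)) - outerPoly c₀ (a - y) δ|
      ≤ 2 * C * (4 * (1 + g) ^ 2) * (1 + δ) * ((1 + a) ^ 2 / √Y) := by
    have hexp : ∑ e ∈ Finset.Ioc ⌊Y⌋₊ ⌊P⌋₊, 1 / (e : ℝ) * ((a - Real.log e + c₀) *
        (a + δ - Real.log e + c₀))
        = (a + c₀) * (a + δ + c₀) * (harmonicSum P - harmonicSum Y)
          - (2 * a + δ + 2 * c₀) * (logSum 1 P - logSum 1 Y) + (logSum 2 P - logSum 2 Y) := by
      simp only [harmonicSum, logSum, ← sum_Ioc_floor_eq_sub _ hYP, Finset.mul_sum,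
        ← Finset.sum_add_distrib, ← Finset.sum_sub_distrib]
      exact Finset.sum_congr rfl fun e _ => by ring
    obtain ⟨p0, p1, p2⟩ := h P hP
    obtain ⟨y0, y1, y2⟩ := h Y hY
    have hsY : 0 < √Y := Real.sqrt_pos.mpr (by linarith)
    have hCP : C / √P ≤ C / √Y := by
      have := Real.sqrt_le_sqrt hYP
      gcongr
    rw [← ha] at p0 p1 p2
    rw [← hy] at y0 y1 y2
    set D := C / √Y with hD
    have hD0 : 0 ≤ D := by positivity
    have comb : ∀ {A B p q c : ℝ}, |A - p - c| ≤ C / √P → |B - q - c| ≤ D →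
        |A - B - (p - q)| ≤ 2 * D := by
      intro A B p q c h1 h2
      rw [abs_le] at h1 h2 ⊢
      constructor <;> linarith [h1.1, h1.2, h2.1, h2.2]
    have r0 : |harmonicSum P - harmonicSum Y - (a - y)| ≤ 2 * D := comb p0 y0
    have r1 : |logSum 1 P - logSum 1 Y - (a ^ 2 / 2 - y ^ 2 / 2)| ≤ 2 * D := comb p1 y1
    have r2 : |logSum 2 P - logSum 2 Y - (a ^ 3 / 3 - y ^ 3 / 3)| ≤ 2 * D := comb p2 y2
    have hid : (a + c₀) * (a + δ + c₀) * (harmonicSum P - harmonicSum Y)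
          - (2 * a + δ + 2 * c₀) * (logSum 1 P - logSum 1 Y) + (logSum 2 P - logSum 2 Y)
          - outerPoly c₀ (a - y) δ
        = (a + c₀) * (a + δ + c₀) * (harmonicSum P - harmonicSum Y - (a - y))
          - (2 * a + δ + 2 * c₀) * (logSum 1 P - logSum 1 Y - (a ^ 2 / 2 - y ^ 2 / 2))
          + (logSum 2 P - logSum 2 Y - (a ^ 3 / 3 - y ^ 3 / 3)) := by
      simp only [outerPoly]; ring
    rw [hexp, hid]
    have hA : |(a + c₀) * (a + δ + c₀)| ≤ (a + g) * (a + δ + g) := by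
      rw [abs_mul]
      have e1 : |a + c₀| ≤ a + g := by
        refine (abs_add_le _ _).trans ?_
        rw [abs_of_nonneg ha0]
      have e2 : |a + δ + c₀| ≤ a + δ + g := by
        refine (abs_add_le _ _).trans ?_
        rw [abs_of_nonneg (by positivity)]
      gcongr
    have hB : |2 * a + δ + 2 * c₀| ≤ 2 * a + δ + 2 * g := by
      refine (abs_add_le _ _).trans ?_
      rw [abs_of_nonneg (by positivity), abs_mul, abs_of_pos (by norm_num : (0 : ℝ) < 2)]
    have tri : ∀ p q r : ℝ, |p - q + r| ≤ |p| + |q| + |r| := by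
      intro p q r
      have h2 := abs_add_le (p - q) r
      have h3 := abs_sub p q
      linarith
    refine (tri _ _ _).trans ?_
    rw [abs_mul, abs_mul (2 * a + δ + 2 * c₀)]
    calc _ ≤ (a + g) * (a + δ + g) * (2 * D) + (2 * a + δ + 2 * g) * (2 * D) + 2 * D := by
          gcongr
      _ = 2 * D * ((1 + a + g) * (1 + a + δ + g)) := by ring
      _ ≤ 2 * D * (((1 + g) * (1 + a)) * ((1 + g) * (1 + a) * (1 + δ))) := by
          have e1 : 1 + a + g ≤ (1 + g) * (1 + a) := by nlinarith [mul_nonneg hg0 ha0]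
          have e2 : 1 + a + δ + g ≤ (1 + g) * (1 + a) * (1 + δ) := by
            have p1 : 0 ≤ g * a := by positivity
            have p2 : 0 ≤ g * δ := by positivity
            have p3 : 0 ≤ a * δ := by positivity
            have p4 : 0 ≤ g * (a * δ) := by positivity
            have e3 : (1 + g) * (1 + a) * (1 + δ)
              = 1 + a + δ + g + g * a + g * δ + a * δ + g * (a * δ) := by ring
            linarith
          gcongr
      _ = 2 * C * (1 + g) ^ 2 * (1 + δ) * ((1 + a) ^ 2 / √Y) := by rw [hD]; ring
      _ ≤ _ := by
          have : 0 ≤ 2 * C * (1 + g) ^ 2 * (1 + δ) * ((1 + a) ^ 2 / √Y) := by positivity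
          have e : 2 * C * (4 * (1 + g) ^ 2) * (1 + δ) * ((1 + a) ^ 2 / √Y)
            = 4 * (2 * C * (1 + g) ^ 2 * (1 + δ) * ((1 + a) ^ 2 / √Y)) := by ring
          rw [e]; linarith
  have hfin := (abs_sub_le _ _ _).trans (add_le_add step1 step2)
  refine hfin.trans ?_
  set T := (1 + a) ^ 2 / √Y with hT
  have hT0 : 0 ≤ T := by positivity
  have q1 : 0 ≤ 16 * (C * (2 + g)) * (1 + δ) * T := by positivity
  have q2 : 0 ≤ 2 * C * (4 * (1 + g) ^ 2) * (1 + δ) := by positivity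
  have e : (16 * (C * (2 + g)) + 2 * C * (4 * (1 + g) ^ 2)) * (1 + δ) * (1 + T)
    = 16 * (C * (2 + g)) * (1 + δ) + 16 * (C * (2 + g)) * (1 + δ) * T
      + 2 * C * (4 * (1 + g) ^ 2) * (1 + δ) + 2 * C * (4 * (1 + g) ^ 2) * (1 + δ) * T := by ring
  rw [e]
  linarith

/-- The sum of `1 / (e₁ e₂ e₃)` over `e₁ e₂ ≤ X`, `e₁ e₃ ≤ Y`, `e₂ e₃ ≤ W`, with all variables at
most `N`. -/
noncomputable def tripleSum (N : ℕ) (X Y W : ℝ) : ℝ :=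
  ∑ e₁ ∈ Finset.Icc 1 N, 1 / (e₁ : ℝ) * ∑ e₂ ∈ Finset.Icc 1 N, 1 / (e₂ : ℝ) *
    ∑ e₃ ∈ Finset.Icc 1 N, 1 / (e₃ : ℝ) * geOne₃ (X / e₁ / e₂) (Y / e₁ / e₃) (W / e₂ / e₃)

/-- The part of a triple sum in which the first variable exceeds `Y`. -/
noncomputable def outerSum (N : ℕ) (Y P Q : ℝ) : ℝ :=
  ∑ e ∈ Finset.Icc 1 N, 1 / (e : ℝ) *
    ((1 - geOne (Y / e)) * (harmonicSum (P / e) * harmonicSum (Q / e)))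

theorem geOne_nonneg (x : ℝ) : 0 ≤ geOne x := by unfold geOne; split_ifs <;> norm_num

theorem sum_one_div_mul_geOne {N : ℕ} {X : ℝ} (hX : X < N + 1) :
    ∑ e ∈ Finset.Icc 1 N, 1 / (e : ℝ) * geOne (X / e) = harmonicSum X := by
  rw [sum_Icc_eq_sum_Icc_floor hX fun n hn hlt => by
    rw [geOne, if_neg (not_le.mpr ((div_lt_one (by exact_mod_cast hn)).mpr hlt)), mul_zero]]
  refine Finset.sum_congr rfl fun n hn => ?_
  obtain ⟨h1, h2⟩ := Finset.mem_Icc.mp hn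
  have h3 := (Nat.le_floor_iff' (by omega)).mp h2
  rw [geOne, if_pos ((one_le_div (by exact_mod_cast h1)).mpr h3), mul_one]

/-- At most one of the variables `e_i` can exceed `Y_i`, and when one does, the condition on the
other two is automatic. -/
theorem geOne₃_dissection {a b c e₁ e₂ e₃ : ℝ} (ha : 0 < a) (hb : 0 < b) (hc : 0 < c)
    (h₁ : 0 < e₁) (h₂ : 0 < e₂) (h₃ : 0 < e₃) :
    geOne₃ (a * b / e₁ / e₂) (a * c / e₁ / e₃) (b * c / e₂ / e₃)
      = geOne (a / e₁) * geOne (b / e₂) * geOne (c / e₃)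
        + (1 - geOne (a / e₁)) * (geOne (a * b / e₁ / e₂) * geOne (a * c / e₁ / e₃))
        + (1 - geOne (b / e₂)) * (geOne (a * b / e₂ / e₁) * geOne (b * c / e₂ / e₃))
        + (1 - geOne (c / e₃)) * (geOne (a * c / e₃ / e₁) * geOne (b * c / e₃ / e₂)) := by
  have key : ∀ {a b x y : ℝ}, 0 < a → 0 < b → 0 < x → 0 < y → (1 ≤ a * b / x / y ↔ x * y ≤ a * b) :=
    fun _ _ hx hy => by rw [div_div, one_le_div (mul_pos hx hy)]
  have small : ∀ {a b x y : ℝ}, 0 < a → 0 < x → 0 < y → x ≤ a → y ≤ b → x * y ≤ a * b :=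
    fun ha _ hy h h' => mul_le_mul h h' hy.le ha.le
  have large : ∀ {a b x y : ℝ}, 0 < a → 0 < b → a < x → b < y → ¬ x * y ≤ a * b :=
    fun ha hb h h' => not_le.mpr (mul_lt_mul'' h h' ha.le hb.le)
  simp only [geOne₃, geOne, key ha hb h₁ h₂, key ha hc h₁ h₃, key hb hc h₂ h₃, key ha hb h₂ h₁,
    key ha hc h₃ h₁, key hb hc h₃ h₂, one_le_div h₁, one_le_div h₂, one_le_div h₃,
    mul_comm e₂ e₁, mul_comm e₃ e₁, mul_comm e₃ e₂]
  by_cases A : e₁ ≤ a <;> by_cases B : e₂ ≤ b <;> by_cases D : e₃ ≤ c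
  · simp [A, B, D, small ha h₁ h₂ A B, small ha h₁ h₃ A D, small hb h₂ h₃ B D]
  · simp [A, B, D, small ha h₁ h₂ A B]
  · simp [A, B, D, small ha h₁ h₃ A D]
  · simp [A, B, D, large hb hc (not_le.mp B) (not_le.mp D)]
  · simp [A, B, D, small hb h₂ h₃ B D]
  · simp [A, B, D, large ha hc (not_le.mp A) (not_le.mp D)]
  · simp [A, B, D, large ha hb (not_le.mp A) (not_le.mp B)]
  · simp [A, B, D, large ha hb (not_le.mp A) (not_le.mp B),
      large ha hc (not_le.mp A) (not_le.mp D)]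

/-- Either `e₁ ≤ a`, `e₂ ≤ b`, `e₃ ≤ c`, or exactly one of these fails, because two failures would
violate the condition on a pairwise product. -/
theorem tripleSum_dissection {a b c : ℝ} (ha : 1 ≤ a) (hb : 1 ≤ b) (hc : 1 ≤ c) {N : ℕ}
    (hab : a * b < N + 1) (hac : a * c < N + 1) (hbc : b * c < N + 1) :
    tripleSum N (a * b) (a * c) (b * c)
      = harmonicSum a * harmonicSum b * harmonicSum c + outerSum N a (a * b) (a * c)
        + outerSum N b (a * b) (b * c) + outerSum N c (a * c) (b * c) := by
  have hlt : ∀ {x : ℝ} (n : ℕ), 0 ≤ x → x < N + 1 → x / n < N + 1 := fun {x} n hx h => by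
    rcases Nat.eq_zero_or_pos n with rfl | hn
    · simp; positivity
    · exact lt_of_le_of_lt (div_le_self hx (by exact_mod_cast hn)) h
  have haN : a < N + 1 := lt_of_le_of_lt (le_mul_of_one_le_right (by linarith) hb) hab
  have hbN : b < N + 1 := lt_of_le_of_lt (le_mul_of_one_le_right (by linarith) hc) hbc
  have hcN : c < N + 1 := lt_of_le_of_lt (le_mul_of_one_le_left (by linarith) ha) hac
  have hab0 : 0 ≤ a * b := by positivity
  have hac0 : 0 ≤ a * c := by positivity
  have hbc0 : 0 ≤ b * c := by positivity
  rw [← sum_one_div_mul_geOne haN, ← sum_one_div_mul_geOne hbN, ← sum_one_div_mul_geOne hcN]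
  simp only [outerSum, ← sum_one_div_mul_geOne (hlt _ hab0 hab),
    ← sum_one_div_mul_geOne (hlt _ hac0 hac), ← sum_one_div_mul_geOne (hlt _ hbc0 hbc)]
  have hexp : tripleSum N (a * b) (a * c) (b * c)
      = ∑ e₁ ∈ Finset.Icc 1 N, ∑ e₂ ∈ Finset.Icc 1 N, ∑ e₃ ∈ Finset.Icc 1 N,
        (1 / (e₁ : ℝ) * geOne (a / e₁) * (1 / (e₂ : ℝ) * geOne (b / e₂)) *
            (1 / (e₃ : ℝ) * geOne (c / e₃))
          + 1 / (e₁ : ℝ) * (1 - geOne (a / e₁)) * (1 / (e₂ : ℝ) * geOne (a * b / e₁ / e₂)) *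
            (1 / (e₃ : ℝ) * geOne (a * c / e₁ / e₃))
          + 1 / (e₂ : ℝ) * (1 - geOne (b / e₂)) * (1 / (e₁ : ℝ) * geOne (a * b / e₂ / e₁)) *
            (1 / (e₃ : ℝ) * geOne (b * c / e₂ / e₃))
          + 1 / (e₃ : ℝ) * (1 - geOne (c / e₃)) * (1 / (e₁ : ℝ) * geOne (a * c / e₃ / e₁)) *
            (1 / (e₂ : ℝ) * geOne (b * c / e₃ / e₂))) := by
    simp only [tripleSum, Finset.mul_sum]
    refine Finset.sum_congr rfl fun e₁ h₁ => Finset.sum_congr rfl fun e₂ h₂ =>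
      Finset.sum_congr rfl fun e₃ h₃ => ?_
    have p : ∀ {e : ℕ}, e ∈ Finset.Icc 1 N → (0 : ℝ) < e := fun h => by
      exact_mod_cast (Finset.mem_Icc.mp h).1
    rw [geOne₃_dissection (by linarith) (by linarith) (by linarith) (p h₁) (p h₂) (p h₃)]
    ring
  rw [hexp]
  simp only [Finset.sum_add_distrib]
  congr 1
  · congr 1
    · congr 1
      · rw [Finset.sum_mul_sum, Finset.sum_mul]
        refine Finset.sum_congr rfl fun e₁ _ => ?_
        rw [Finset.sum_mul]
        refine Finset.sum_congr rfl fun e₂ _ => ?_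
        rw [Finset.mul_sum]
      · refine Finset.sum_congr rfl fun e₁ _ => ?_
        rw [Finset.sum_mul_sum, Finset.mul_sum, Finset.mul_sum]
        refine Finset.sum_congr rfl fun e₂ _ => ?_
        rw [Finset.mul_sum, Finset.mul_sum]
        exact Finset.sum_congr rfl fun e₃ _ => by ring
    · rw [Finset.sum_comm]
      refine Finset.sum_congr rfl fun e₂ _ => ?_
      rw [Finset.sum_mul_sum, Finset.mul_sum, Finset.mul_sum]
      refine Finset.sum_congr rfl fun e₁ _ => ?_
      rw [Finset.mul_sum, Finset.mul_sum]
      exact Finset.sum_congr rfl fun e₃ _ => by ring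
  · rw [Finset.sum_congr rfl fun e₁ _ => Finset.sum_comm, Finset.sum_comm]
    refine Finset.sum_congr rfl fun e₃ _ => ?_
    rw [Finset.sum_mul_sum, Finset.mul_sum, Finset.mul_sum]
    refine Finset.sum_congr rfl fun e₁ _ => ?_
    rw [Finset.mul_sum, Finset.mul_sum]
    exact Finset.sum_congr rfl fun e₂ _ => by ring

theorem tripleSum_le {N : ℕ} {X Y W y : ℝ} (hX : X ≤ y) (hY : Y ≤ y)
    (hy : y < N + 1) : tripleSum N X Y W ≤ harmonicSum y ^ 3 := by
  have h1 : tripleSum N X Y W ≤ ∑ e₁ ∈ Finset.Icc 1 N, 1 / (e₁ : ℝ) *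
      ∑ e₂ ∈ Finset.Icc 1 N, 1 / (e₂ : ℝ) * ∑ e₃ ∈ Finset.Icc 1 N, 1 / (e₃ : ℝ) *
        (geOne (y / e₁) * geOne (y / e₂) * geOne (y / e₃)) := by
    unfold tripleSum
    gcongr with e₁ h₁ e₂ h₂ e₃ h₃
    have p : ∀ {e : ℕ}, e ∈ Finset.Icc 1 N → (1 : ℝ) ≤ e := fun h => by
      exact_mod_cast (Finset.mem_Icc.mp h).1
    have key : ∀ {X s t : ℝ}, X ≤ y → 1 ≤ s → 1 ≤ t → 1 ≤ X / s / t → 1 ≤ y / s ∧ 1 ≤ y / t := by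
      intro X s t hX hs ht h
      rw [div_div, one_le_div (by positivity)] at h
      rw [one_le_div (by linarith), one_le_div (by linarith)]
      constructor <;> nlinarith
    by_cases h : 1 ≤ X / e₁ / e₂ ∧ 1 ≤ Y / e₁ / e₃
    · obtain ⟨a1, a2⟩ := key hX (p h₁) (p h₂) h.1
      obtain ⟨-, a3⟩ := key hY (p h₁) (p h₃) h.2
      simp only [geOne₃, geOne, if_pos a1, if_pos a2, if_pos a3, if_pos h.1, if_pos h.2]
      split_ifs <;> norm_num
    · have : geOne₃ (X / e₁ / e₂) (Y / e₁ / e₃) (W / e₂ / e₃) = 0 := by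
        simp only [geOne₃, geOne]
        split_ifs <;> simp_all
      rw [this]
      exact mul_nonneg (mul_nonneg (geOne_nonneg _) (geOne_nonneg _)) (geOne_nonneg _)
  refine h1.trans (le_of_eq ?_)
  rw [pow_three, ← sum_one_div_mul_geOne hy]
  simp only [Finset.mul_sum, Finset.sum_mul]
  exact Finset.sum_congr rfl fun e₁ _ => Finset.sum_congr rfl fun e₂ _ =>
    Finset.sum_congr rfl fun e₃ _ => by ring

theorem tripleSum_nonneg (N : ℕ) (X Y W : ℝ) : 0 ≤ tripleSum N X Y W := by
  have : ∀ X Y W, 0 ≤ geOne₃ X Y W := fun X Y W =>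
    mul_nonneg (mul_nonneg (geOne_nonneg _) (geOne_nonneg _)) (geOne_nonneg _)
  unfold tripleSum
  exact Finset.sum_nonneg fun e₁ _ => mul_nonneg (by positivity) <|
    Finset.sum_nonneg fun e₂ _ => mul_nonneg (by positivity) <|
    Finset.sum_nonneg fun e₃ _ => mul_nonneg (by positivity) (this _ _ _)

theorem outerSum_comm (N : ℕ) (Y P Q : ℝ) : outerSum N Y P Q = outerSum N Y Q P := by
  simp only [outerSum, mul_comm (harmonicSum (P / _))]

theorem outerSum_eq {N : ℕ} {Y P Q : ℝ} (hY : 1 ≤ Y) (hP : P < N + 1) :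
    outerSum N Y P Q
      = ∑ e ∈ Finset.Ioc ⌊Y⌋₊ ⌊P⌋₊, 1 / (e : ℝ) * (harmonicSum (P / e) * harmonicSum (Q / e)) := by
  unfold outerSum
  rw [sum_Icc_eq_sum_Icc_floor hP fun n hn hlt => by
    rw [harmonicSum_of_lt_one ((div_lt_one (by exact_mod_cast hn)).mpr hlt)]; ring]
  rw [← Finset.sum_subset (s₁ := Finset.Ioc ⌊Y⌋₊ ⌊P⌋₊)]
  · refine Finset.sum_congr rfl fun e he => ?_
    have h1 := (Finset.mem_Ioc.mp he).1
    have h2 : Y < e := (Nat.floor_lt (by linarith)).mp h1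
    have h3 : (0 : ℝ) < e := by linarith
    rw [geOne, if_neg (not_le.mpr ((div_lt_one h3).mpr h2))]
    ring
  · intro e he
    simp only [Finset.mem_Ioc, Finset.mem_Icc] at he ⊢
    omega
  · intro e he he'
    simp only [Finset.mem_Ioc, Finset.mem_Icc] at he he'
    have h1 : (e : ℝ) ≤ Y := (Nat.le_floor_iff (by linarith)).mp (by omega)
    have h2 : (0 : ℝ) < e := by exact_mod_cast he.1
    rw [geOne, if_pos ((one_le_div h2).mpr h1)]
    ring

theorem exists_abs_outerSum_sub_le {c₀ c₁ c₂ C : ℝ} (hC : 0 ≤ C)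
    (h : ∀ t : ℝ, 1 ≤ t → |harmonicSum t - Real.log t - c₀| ≤ C / √t ∧
      |logSum 1 t - Real.log t ^ 2 / 2 - c₁| ≤ C / √t ∧
      |logSum 2 t - Real.log t ^ 3 / 3 - c₂| ≤ C / √t) :
    ∃ C' : ℝ, 0 ≤ C' ∧ ∀ (N : ℕ) (α β β' L : ℝ), 0 ≤ α → 0 ≤ β → 0 ≤ β' → α + β ≤ L → α + β' ≤ L →
      Real.exp L < N + 1 →
      |outerSum N (Real.exp α) (Real.exp α * Real.exp β) (Real.exp α * Real.exp β')
        - outerPoly c₀ (min β β') (|β - β'|)|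
      ≤ C' * (1 + |β - β'|) * (1 + (1 + L) ^ 2 / Real.exp (α / 2)) := by
  obtain ⟨C', hC'0, hC'⟩ := exists_abs_sum_harmonicSum_mul_sub_le hC h
  refine ⟨C', hC'0, fun N α β β' L hα hβ hβ' hL hL' hN => ?_⟩
  wlog hle : β ≤ β' generalizing β β' with H
  · have := H β' β hβ' hβ hL' hL (not_le.mp hle).le
    rwa [outerSum_comm, min_comm, abs_sub_comm β' β] at this
  rw [← Real.exp_add, ← Real.exp_add, outerSum_eq (Real.one_le_exp hα)
    (lt_of_le_of_lt (Real.exp_le_exp.mpr hL) hN)]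
  have h1 := hC' (Real.exp α) (Real.exp (α + β)) (Real.exp (α + β')) (Real.one_le_exp hα)
    (Real.exp_le_exp.mpr (by linarith)) (Real.exp_le_exp.mpr (by linarith))
  simp only [Real.log_exp] at h1
  rw [show α + β - α = β by ring, show α + β' - (α + β) = β' - β by ring] at h1
  rw [min_eq_left hle, abs_sub_comm β β', abs_of_nonneg (sub_nonneg.mpr hle)]
  refine h1.trans ?_
  have hs : √(Real.exp α) = Real.exp (α / 2) := by
    rw [Real.exp_half]
  rw [hs]
  have : 0 ≤ β' - β := sub_nonneg.mpr hle
  gcongr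

theorem exists_outerPoly_coeffs {γ m δ A : ℝ} (hγ : |γ| ≤ A) (hm : |m| ≤ A) (hδ : |δ| ≤ A) :
    ∃ b c d : ℝ, |b| ≤ A ∧ |c| ≤ 4 * A ^ 2 ∧ |d| ≤ 4 * A ^ 3 ∧
      ∀ L : ℝ, outerPoly γ (L / 2 + m) δ = L ^ 3 / 24 + b * L ^ 2 + c * L + d := by
  have hA0 : 0 ≤ A := (abs_nonneg _).trans hγ
  have h2 : ∀ {u v : ℝ}, |u| ≤ A → |v| ≤ A → |u * v| ≤ A ^ 2 := by
    intro u v hu hv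
    rw [abs_mul, sq]; gcongr
  have h3 : ∀ {u v : ℝ}, |u| ≤ A → |v| ≤ A ^ 2 → |u * v| ≤ A ^ 3 := by
    intro u v hu hv
    rw [abs_mul, show A ^ 3 = A * A ^ 2 by ring]; gcongr
  refine ⟨m / 4 + γ / 4 + δ / 8, m * m / 2 + γ * m + γ * γ / 2 + δ * m / 2 + δ * γ / 2,
    m * (m * m) / 3 + γ * (m * m) + γ * (γ * m) + δ * (m * m) / 2 + δ * (γ * m), ?_, ?_, ?_, ?_⟩
  · rw [abs_le] at *
    constructor <;> linarith [hγ.1, hγ.2, hm.1, hm.2, hδ.1, hδ.2]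
  · have e1 := abs_le.mp (h2 hm hm)
    have e2 := abs_le.mp (h2 hγ hm)
    have e3 := abs_le.mp (h2 hγ hγ)
    have e4 := abs_le.mp (h2 hδ hm)
    have e5 := abs_le.mp (h2 hδ hγ)
    rw [abs_le]
    constructor <;> linarith [e1.1, e1.2, e2.1, e2.2, e3.1, e3.2, e4.1, e4.2, e5.1, e5.2]
  · have e1 := abs_le.mp (h3 hm (h2 hm hm))
    have e2 := abs_le.mp (h3 hγ (h2 hm hm))
    have e3 := abs_le.mp (h3 hγ (h2 hγ hm))
    have e4 := abs_le.mp (h3 hδ (h2 hm hm))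
    have e5 := abs_le.mp (h3 hδ (h2 hγ hm))
    rw [abs_le]
    constructor <;> linarith [e1.1, e1.2, e2.1, e2.2, e3.1, e3.2, e4.1, e4.2, e5.1, e5.2]
  · intro L
    simp only [outerPoly]
    ring

theorem exists_cubic_coeffs {t₁ t₂ t₃ A : ℝ} (h₁ : |t₁| ≤ A) (h₂ : |t₂| ≤ A) (h₃ : |t₃| ≤ A) :
    ∃ b c d : ℝ, |b| ≤ A ∧ |c| ≤ 4 * A ^ 2 ∧ |d| ≤ 4 * A ^ 3 ∧
      ∀ L : ℝ, (L / 2 + t₁) * (L / 2 + t₂) * (L / 2 + t₃)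
        = L ^ 3 / 8 + b * L ^ 2 + c * L + d := by
  have hA0 : 0 ≤ A := (abs_nonneg _).trans h₁
  have h2 : ∀ {u v : ℝ}, |u| ≤ A → |v| ≤ A → |u * v| ≤ A ^ 2 := by
    intro u v hu hv
    rw [abs_mul, sq]; gcongr
  refine ⟨(t₁ + t₂ + t₃) / 4, (t₁ * t₂ + t₁ * t₃ + t₂ * t₃) / 2, t₁ * (t₂ * t₃), ?_, ?_, ?_, ?_⟩
  · rw [abs_le] at *
    constructor <;> linarith [h₁.1, h₁.2, h₂.1, h₂.2, h₃.1, h₃.2]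
  · have e1 := abs_le.mp (h2 h₁ h₂)
    have e2 := abs_le.mp (h2 h₁ h₃)
    have e3 := abs_le.mp (h2 h₂ h₃)
    rw [abs_le]
    constructor <;> linarith [e1.1, e1.2, e2.1, e2.2, e3.1, e3.2]
  · rw [abs_mul]
    calc |t₁| * |t₂ * t₃| ≤ A * A ^ 2 := by gcongr; exact h2 h₂ h₃
      _ = A ^ 3 := by ring
      _ ≤ 4 * A ^ 3 := by have := pow_nonneg hA0 3; linarith
  · intro L; ring

theorem abs_mul_three_sub_le {h₁ h₂ h₃ u₁ u₂ u₃ ρ G : ℝ} (hρ : 0 ≤ ρ)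
    (e₁ : |h₁ - u₁| ≤ ρ) (e₂ : |h₂ - u₂| ≤ ρ) (e₃ : |h₃ - u₃| ≤ ρ) (g₁ : |u₁| ≤ G)
    (k₂ : |h₂| ≤ G) (g₂ : |u₂| ≤ G) (k₃ : |h₃| ≤ G) :
    |h₁ * h₂ * h₃ - u₁ * u₂ * u₃| ≤ 3 * (ρ * G ^ 2) := by
  have hG : 0 ≤ G := (abs_nonneg _).trans g₁
  have hid : h₁ * h₂ * h₃ - u₁ * u₂ * u₃
      = (h₁ - u₁) * (h₂ * h₃) + (h₂ - u₂) * (u₁ * h₃) + (h₃ - u₃) * (u₁ * u₂) := by ring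
  have key : ∀ {a b c : ℝ}, |a| ≤ ρ → |b| ≤ G → |c| ≤ G → |a * (b * c)| ≤ ρ * G ^ 2 := by
    intro a b c ha hb hc
    rw [abs_mul, abs_mul, sq]; gcongr
  rw [hid]
  have h1 := key e₁ k₂ k₃
  have h2 := key e₂ g₁ k₃
  have h3 := key e₃ g₁ g₂
  have t1 := abs_add_le ((h₁ - u₁) * (h₂ * h₃) + (h₂ - u₂) * (u₁ * h₃)) ((h₃ - u₃) * (u₁ * u₂))
  have t2 := abs_add_le ((h₁ - u₁) * (h₂ * h₃)) ((h₂ - u₂) * (u₁ * h₃))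
  linarith

theorem sq_one_add_le_exp {L : ℝ} (hL : 0 ≤ L) : (1 + L) ^ 2 ≤ 256 * Real.exp (L / 8) := by
  have h1 := Real.add_one_le_exp (L / 16)
  have h2 : Real.exp (L / 8) = Real.exp (L / 16) ^ 2 := by
    rw [← Real.exp_nat_mul]; congr 1; push_cast; ring
  rw [h2]
  have h3 : (1 + L) ≤ 16 * Real.exp (L / 16) := by linarith
  calc (1 + L) ^ 2 ≤ (16 * Real.exp (L / 16)) ^ 2 := by gcongr
    _ = _ := by ring

set_option maxHeartbeats 1000000 in
/-- The triple sum with limits `y/x₁, y/x₂, y/x₃` is a cubic polynomial in `log y` with leading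
coefficient `1/4`, with coefficients and error controlled by powers of `log (x₁ x₂ x₃)`. -/
theorem exists_abs_tripleSum_sub_le : ∃ C : ℝ, 0 ≤ C ∧
    ∀ x₁ x₂ x₃ : ℝ, 1 ≤ x₁ → 1 ≤ x₂ → 1 ≤ x₃ → ∃ b c : ℝ,
      |b| ≤ C * (1 + (Real.log x₁ + Real.log x₂ + Real.log x₃)) ∧
      |c| ≤ C * (1 + (Real.log x₁ + Real.log x₂ + Real.log x₃)) ^ 2 ∧
      ∀ (N : ℕ) (y : ℝ), 1 ≤ y → y < N + 1 →
        |tripleSum N (y / x₁) (y / x₂) (y / x₃)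
          - (1 / 4 * Real.log y ^ 3 + b * Real.log y ^ 2 + c * Real.log y)|
        ≤ C * (1 + (Real.log x₁ + Real.log x₂ + Real.log x₃)) ^ 3 := by
  obtain ⟨c₀, c₁, c₂, C₀, hC0, hexp⟩ := exists_logSum_expansions
  obtain ⟨C₁, hC1, houter⟩ := exists_abs_outerSum_sub_le hC0 hexp
  set g := 2 + |c₀| with hg
  have hg2 : 2 ≤ g := by have := abs_nonneg c₀; linarith
  have hg4 : g ≤ g ^ 3 / 4 := by
    have h1 : g * (2 * 2) ≤ g * (g * g) := by gcongr
    have h2 : g ^ 3 = g * (g * g) := by ring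
    linarith
  refine ⟨3 * (C₀ * g ^ 2 * 256) + 3 * (C₁ * 257) + 100 * g ^ 3, by positivity,
    fun x₁ x₂ x₃ h₁ h₂ h₃ => ?_⟩
  set K := 3 * (C₀ * g ^ 2 * 256) + 3 * (C₁ * 257) + 100 * g ^ 3 with hK
  set ξ₁ := Real.log x₁ with hξ₁
  set ξ₂ := Real.log x₂ with hξ₂
  set ξ₃ := Real.log x₃ with hξ₃
  have p₁ : 0 ≤ ξ₁ := Real.log_nonneg h₁
  have p₂ : 0 ≤ ξ₂ := Real.log_nonneg h₂
  have p₃ : 0 ≤ ξ₃ := Real.log_nonneg h₃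
  set Λ := 1 + (ξ₁ + ξ₂ + ξ₃) with hΛ
  have hΛ1 : 1 ≤ Λ := by linarith
  -- `exp (L / 2 + β_i)` are the cut-offs whose pairwise products are the three limits.
  set β₁ := (ξ₃ - ξ₁ - ξ₂) / 2 with hβ₁
  set β₂ := (ξ₂ - ξ₁ - ξ₃) / 2 with hβ₂
  set β₃ := (ξ₁ - ξ₂ - ξ₃) / 2 with hβ₃
  have q₁ : |β₁| ≤ Λ - 1 := by rw [abs_le]; constructor <;> linarith
  have q₂ : |β₂| ≤ Λ - 1 := by rw [abs_le]; constructor <;> linarith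
  have q₃ : |β₃| ≤ Λ - 1 := by rw [abs_le]; constructor <;> linarith
  have hgΛ : 2 * Λ ≤ g * Λ := by gcongr
  have hA : ∀ {t : ℝ}, |t| ≤ Λ - 1 → |t| ≤ g * Λ := fun {t} ht => by linarith
  have hA' : ∀ {t : ℝ}, |t| ≤ Λ - 1 → |t + c₀| ≤ g * Λ := fun {t} ht => by
    have := abs_add_le t c₀
    have : |c₀| ≤ |c₀| * Λ := le_mul_of_one_le_right (abs_nonneg _) hΛ1
    have e : g * Λ = 2 * Λ + |c₀| * Λ := by rw [hg]; ring
    linarith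
  have hγ : |c₀| ≤ g * Λ := by
    have := hA' (t := 0) (by rw [abs_zero]; linarith)
    rwa [zero_add] at this
  have hmin : ∀ {s t : ℝ}, |s| ≤ Λ - 1 → |t| ≤ Λ - 1 → |min s t| ≤ g * Λ := fun {s t} hs ht => by
    rcases min_choice s t with h | h <;> rw [h]
    · exact hA hs
    · exact hA ht
  have hdiff : ∀ {s t : ℝ}, |s| ≤ Λ - 1 → |t| ≤ Λ - 1 → |(|s - t|)| ≤ g * Λ := fun {s t} hs ht => by
    rw [abs_abs]
    have := abs_sub s t
    linarith
  obtain ⟨b₀, d₀, f₀, hb₀, hd₀, hf₀, E₀⟩ := exists_cubic_coeffs (hA' q₁) (hA' q₂) (hA' q₃)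
  obtain ⟨b₁, d₁, f₁, hb₁, hd₁, hf₁, E₁⟩ := exists_outerPoly_coeffs hγ (hmin q₂ q₃) (hdiff q₂ q₃)
  obtain ⟨b₂, d₂, f₂, hb₂, hd₂, hf₂, E₂⟩ := exists_outerPoly_coeffs hγ (hmin q₁ q₃) (hdiff q₁ q₃)
  obtain ⟨b₃, d₃, f₃, hb₃, hd₃, hf₃, E₃⟩ := exists_outerPoly_coeffs hγ (hmin q₁ q₂) (hdiff q₁ q₂)
  have four : ∀ {a b c d B : ℝ}, |a| ≤ B → |b| ≤ B → |c| ≤ B → |d| ≤ B →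
      |a + b + c + d| ≤ 4 * B := by
    intro a b c d B ha hb hc hd
    rw [abs_le] at *
    constructor <;> linarith [ha.1, ha.2, hb.1, hb.2, hc.1, hc.2, hd.1, hd.2]
  have hbb := four hb₀ hb₁ hb₂ hb₃
  have hdd := four hd₀ hd₁ hd₂ hd₃
  have hff := four hf₀ hf₁ hf₂ hf₃
  set b := b₀ + b₁ + b₂ + b₃ with hbdef
  set c := d₀ + d₁ + d₂ + d₃ with hcdef
  set f := f₀ + f₁ + f₂ + f₃ with hfdef
  have hg1 : g ≤ g ^ 3 := le_self_pow₀ (by linarith) (by norm_num)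
  have hg23 : g ^ 2 ≤ g ^ 3 := pow_le_pow_right₀ (by linarith) (by norm_num)
  have hKg : 100 * g ^ 3 ≤ K := by
    have : 0 ≤ 3 * (C₀ * g ^ 2 * 256) + 3 * (C₁ * 257) := by positivity
    rw [hK]; linarith
  refine ⟨b, c, ?_, ?_, fun N y hy hyN => ?_⟩
  · calc |b| ≤ 4 * (g * Λ) := hbb
      _ ≤ (100 * g ^ 3) * Λ := by
        have : g * Λ ≤ g ^ 3 * Λ := by gcongr
        have : 0 ≤ g ^ 3 * Λ := by positivity
        linarith
      _ ≤ K * Λ := by gcongr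
  · calc |c| ≤ 4 * (4 * (g * Λ) ^ 2) := hdd
      _ = 16 * (g ^ 2 * Λ ^ 2) := by ring
      _ ≤ (100 * g ^ 3) * Λ ^ 2 := by
        have : g ^ 2 * Λ ^ 2 ≤ g ^ 3 * Λ ^ 2 := by gcongr
        have : 0 ≤ g ^ 3 * Λ ^ 2 := by positivity
        linarith
      _ ≤ K * Λ ^ 2 := by gcongr
  set L := Real.log y with hL
  have hL0 : 0 ≤ L := Real.log_nonneg hy
  have hyL : y = Real.exp L := (Real.exp_log (by linarith)).symm
  rcases lt_or_ge L (2 * Λ) with hsmall | hlarge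
  · -- For small `y` everything is bounded trivially.
    have hle : ∀ {x : ℝ}, 1 ≤ x → y / x ≤ y := fun hx => div_le_self (by linarith) hx
    have t0 := tripleSum_nonneg N (y / x₁) (y / x₂) (y / x₃)
    have t1 := tripleSum_le (W := y / x₃) (hle h₁) (hle h₂) hyN
    have t2 : harmonicSum y ^ 3 ≤ 27 * Λ ^ 3 := by
      have := harmonicSum_le hy
      have h0 := harmonicSum_nonneg y
      calc harmonicSum y ^ 3 ≤ (3 * Λ) ^ 3 := by gcongr; linarith
        _ = _ := by ring
    have e1 : |1 / 4 * L ^ 3 + b * L ^ 2 + c * L| ≤ 50 * (g ^ 3 * Λ ^ 3) := by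
      have a1 : |1 / 4 * L ^ 3| ≤ 2 * Λ ^ 3 := by
        rw [abs_of_nonneg (by positivity)]
        calc 1 / 4 * L ^ 3 ≤ 1 / 4 * (2 * Λ) ^ 3 := by gcongr
          _ = _ := by ring
      have a2 : |b * L ^ 2| ≤ 16 * (g * Λ ^ 3) := by
        rw [abs_mul, abs_of_nonneg (by positivity : 0 ≤ L ^ 2)]
        calc |b| * L ^ 2 ≤ (4 * (g * Λ)) * (2 * Λ) ^ 2 := by gcongr
          _ = _ := by ring
      have a3 : |c * L| ≤ 32 * (g ^ 2 * Λ ^ 3) := by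
        rw [abs_mul, abs_of_nonneg hL0]
        calc |c| * L ≤ (4 * (4 * (g * Λ) ^ 2)) * (2 * Λ) := by gcongr
          _ = _ := by ring
      have b1 : g * Λ ^ 3 ≤ g ^ 3 / 4 * Λ ^ 3 := by
        gcongr
      have b2 : g ^ 2 * Λ ^ 3 ≤ g ^ 3 * Λ ^ 3 := by gcongr
      have b3 : Λ ^ 3 ≤ g ^ 3 * Λ ^ 3 := le_mul_of_one_le_left (by positivity)
        (one_le_pow₀ (by linarith))
      have := abs_add_le (1 / 4 * L ^ 3 + b * L ^ 2) (c * L)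
      have := abs_add_le (1 / 4 * L ^ 3) (b * L ^ 2)
      linarith
    have b3 : Λ ^ 3 ≤ g ^ 3 * Λ ^ 3 := le_mul_of_one_le_left (by positivity)
      (one_le_pow₀ (by linarith))
    have hfin : |tripleSum N (y / x₁) (y / x₂) (y / x₃) - (1 / 4 * L ^ 3 + b * L ^ 2 + c * L)|
        ≤ 100 * g ^ 3 * Λ ^ 3 := by
      have h27 : |tripleSum N (y / x₁) (y / x₂) (y / x₃)| ≤ 27 * Λ ^ 3 := by
        rw [abs_of_nonneg t0]; linarith
      have := abs_sub (tripleSum N (y / x₁) (y / x₂) (y / x₃)) (1 / 4 * L ^ 3 + b * L ^ 2 + c * L)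
      have : 0 ≤ Λ ^ 3 := by positivity
      linarith
    exact hfin.trans (by gcongr)
  · -- For large `y` the dissection applies, and all three cut-offs are at least `y^(1/4)`.
    set α₁ := L / 2 + β₁ with hα₁
    set α₂ := L / 2 + β₂ with hα₂
    set α₃ := L / 2 + β₃ with hα₃
    have l₁ : L / 4 ≤ α₁ := by linarith
    have l₂ : L / 4 ≤ α₂ := by linarith
    have l₃ : L / 4 ≤ α₃ := by linarith
    have u₁ : α₁ ≤ L := by linarith
    have u₂ : α₂ ≤ L := by linarith
    have u₃ : α₃ ≤ L := by linarith
    have hdiv : ∀ {x ξ a a' : ℝ}, 1 ≤ x → ξ = Real.log x → a + a' = L - ξ →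
        y / x = Real.exp a * Real.exp a' := by
      intro x ξ a a' hx hξ ha
      rw [← Real.exp_add, ha, Real.exp_sub, ← hyL, hξ, Real.exp_log (by linarith)]
    have hs12 : α₁ + α₂ = L - ξ₁ := by rw [hα₁, hα₂, hβ₁, hβ₂]; ring
    have hs13 : α₁ + α₃ = L - ξ₂ := by rw [hα₁, hα₃, hβ₁, hβ₃]; ring
    have hs23 : α₂ + α₃ = L - ξ₃ := by rw [hα₂, hα₃, hβ₂, hβ₃]; ring
    have hlt : ∀ {a a' : ℝ}, a + a' ≤ L → Real.exp a * Real.exp a' < N + 1 := by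
      intro a a' ha
      rw [← Real.exp_add]
      exact lt_of_le_of_lt (Real.exp_le_exp.mpr ha) (hyL ▸ hyN)
    have hmL : ∀ {a : ℝ}, L / 4 ≤ a → 0 ≤ a := fun h => by linarith
    rw [hdiv h₁ hξ₁ hs12, hdiv h₂ hξ₂ hs13, hdiv h₃ hξ₃ hs23,
      tripleSum_dissection (Real.one_le_exp (hmL l₁)) (Real.one_le_exp (hmL l₂))
        (Real.one_le_exp (hmL l₃)) (hlt (by linarith)) (hlt (by linarith)) (hlt (by linarith))]
    set t := Real.exp (L / 8) with ht
    have ht0 : 0 < t := Real.exp_pos _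
    have hsq := sq_one_add_le_exp hL0
    rw [← ht] at hsq
    -- The contribution of small variables.
    have hH : ∀ {a : ℝ}, L / 4 ≤ a → a ≤ L → |harmonicSum (Real.exp a) - (a + c₀)| ≤ C₀ / t ∧
        |a + c₀| ≤ g * (1 + L) ∧ |harmonicSum (Real.exp a)| ≤ g * (1 + L) := by
      intro a ha haL
      have ha0 : 0 ≤ a := hmL ha
      have h1 := (hexp (Real.exp a) (Real.one_le_exp ha0)).1
      have h2 := harmonicSum_le (Real.one_le_exp ha0)
      rw [Real.log_exp] at h1 h2
      have hs : t ≤ √(Real.exp a) := by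
        rw [← Real.exp_half]
        exact Real.exp_le_exp.mpr (by linarith)
      have hgL : 0 ≤ |c₀| * L := by positivity
      have e : g * (1 + L) = 2 + 2 * L + |c₀| + |c₀| * L := by rw [hg]; ring
      refine ⟨?_, ?_, ?_⟩
      · rw [show harmonicSum (Real.exp a) - (a + c₀) = harmonicSum (Real.exp a) - a - c₀ by ring]
        exact h1.trans (by gcongr)
      · have := abs_add_le a c₀
        rw [abs_of_nonneg ha0] at this
        linarith
      · rw [abs_of_nonneg (harmonicSum_nonneg _)]
        linarith [abs_nonneg c₀]
    obtain ⟨i₁, j₁, k₁⟩ := hH l₁ u₁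
    obtain ⟨i₂, j₂, k₂⟩ := hH l₂ u₂
    obtain ⟨i₃, j₃, k₃⟩ := hH l₃ u₃
    have m0 : |harmonicSum (Real.exp α₁) * harmonicSum (Real.exp α₂) * harmonicSum (Real.exp α₃)
        - (α₁ + c₀) * (α₂ + c₀) * (α₃ + c₀)| ≤ 3 * (C₀ * g ^ 2 * 256) := by
      refine (abs_mul_three_sub_le (by positivity) i₁ i₂ i₃ j₁ k₂ j₂ k₃).trans ?_
      calc 3 * (C₀ / t * (g * (1 + L)) ^ 2) = 3 * (C₀ * g ^ 2 * ((1 + L) ^ 2 / t)) := by ring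
        _ ≤ 3 * (C₀ * g ^ 2 * 256) := by
          have : (1 + L) ^ 2 / t ≤ 256 := (div_le_iff₀ ht0).mpr hsq
          gcongr
    -- The contribution of one large variable.
    have hO : ∀ {a s s' : ℝ}, L / 4 ≤ a → |s| ≤ Λ - 1 → |s'| ≤ Λ - 1 → 0 ≤ L / 2 + s →
        0 ≤ L / 2 + s' → |s - s'| ≤ Λ - 1 → a + (L / 2 + s) ≤ L → a + (L / 2 + s') ≤ L →
        |outerSum N (Real.exp a) (Real.exp a * Real.exp (L / 2 + s))
            (Real.exp a * Real.exp (L / 2 + s'))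
          - outerPoly c₀ (L / 2 + min s s') (|s - s'|)| ≤ C₁ * 257 * Λ := by
      intro a s s' ha hs hs' hs0 hs0' hss hsum hsum'
      have h1 := houter N a (L / 2 + s) (L / 2 + s') L (hmL ha) hs0 hs0' hsum hsum' (hyL ▸ hyN)
      rw [min_add_add_left, add_sub_add_left_eq_sub] at h1
      refine h1.trans ?_
      have h2 : (1 + L) ^ 2 / Real.exp (a / 2) ≤ 256 := by
        rw [div_le_iff₀ (Real.exp_pos _)]
        have : t ≤ Real.exp (a / 2) := Real.exp_le_exp.mpr (by linarith)
        linarith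
      calc C₁ * (1 + |s - s'|) * (1 + (1 + L) ^ 2 / Real.exp (a / 2))
          ≤ C₁ * Λ * (1 + 256) := by gcongr; linarith
        _ = _ := by ring
    have hd : ∀ {s s' : ℝ}, s - s' ≤ Λ - 1 → s' - s ≤ Λ - 1 → |s - s'| ≤ Λ - 1 := fun h h' => by
      rw [abs_le]; constructor <;> linarith
    have m1 := hO l₁ q₂ q₃ (hmL l₂) (hmL l₃) (hd (by linarith) (by linarith))
      (by linarith) (by linarith)
    have m2 := hO l₂ q₁ q₃ (hmL l₁) (hmL l₃) (hd (by linarith) (by linarith))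
      (by linarith) (by linarith)
    have m3 := hO l₃ q₁ q₂ (hmL l₁) (hmL l₂) (hd (by linarith) (by linarith))
      (by linarith) (by linarith)
    rw [E₁] at m1
    rw [E₂] at m2
    rw [E₃] at m3
    rw [show (α₁ + c₀) * (α₂ + c₀) * (α₃ + c₀)
      = (L / 2 + (β₁ + c₀)) * (L / 2 + (β₂ + c₀)) * (L / 2 + (β₃ + c₀)) by
        rw [hα₁, hα₂, hα₃]; ring, E₀] at m0
    rw [mul_comm (Real.exp α₂) (Real.exp α₁)] at m2
    rw [mul_comm (Real.exp α₃) (Real.exp α₁), mul_comm (Real.exp α₃) (Real.exp α₂)] at m3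
    have hΛ3 : Λ ≤ Λ ^ 3 := le_self_pow₀ hΛ1 (by norm_num)
    have hΛ31 : 1 ≤ Λ ^ 3 := one_le_pow₀ hΛ1
    have z0 : 3 * (C₀ * g ^ 2 * 256) ≤ 3 * (C₀ * g ^ 2 * 256) * Λ ^ 3 :=
      le_mul_of_one_le_right (by positivity) hΛ31
    have z1 : C₁ * 257 * Λ ≤ C₁ * 257 * Λ ^ 3 := by gcongr
    have z2 : 4 * (4 * (g * Λ) ^ 3) = 16 * (g ^ 3 * Λ ^ 3) := by ring
    rw [z2] at hff
    have z3 : 0 ≤ g ^ 3 * Λ ^ 3 := by positivity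
    have z4 : K * Λ ^ 3 = 3 * (C₀ * g ^ 2 * 256) * Λ ^ 3 + 3 * (C₁ * 257 * Λ ^ 3)
      + 100 * (g ^ 3 * Λ ^ 3) := by rw [hK]; ring
    rw [z4]
    have z5 : b * L ^ 2 = b₀ * L ^ 2 + b₁ * L ^ 2 + b₂ * L ^ 2 + b₃ * L ^ 2 := by rw [hbdef]; ring
    have z6 : c * L = d₀ * L + d₁ * L + d₂ * L + d₃ * L := by rw [hcdef]; ring
    rw [z5, z6]
    rw [abs_le] at hff m0 m1 m2 m3 ⊢
    constructor <;> linarith [hff.1, hff.2, m0.1, m0.2, m1.1, m1.2, m2.1, m2.2, m3.1, m3.2]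

/-! ### Multiplicative layers over the integers coprime to a modulus -/

/-- Division of the three variables by `e^u, e^v, e^w`. -/
noncomputable def dilate (u v w e : ℕ) (f : ℝ → ℝ → ℝ → ℝ) (X Y W : ℝ) : ℝ :=
  f (X / (e : ℝ) ^ u) (Y / (e : ℝ) ^ v) (W / (e : ℝ) ^ w)

/-- The operator `∑_e b(e) S_e`, where `S_e` is dilation by `e` with weights `u, v, w` and `e` runs
over the integers up to `N` that are coprime to `q`. -/
noncomputable def layer (b : ℕ → ℝ) (N u v w q : ℕ) (f : ℝ → ℝ → ℝ → ℝ) (X Y W : ℝ) : ℝ :=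
  ∑ e ∈ (Finset.Icc 1 N).filter (fun e => Nat.Coprime e q), b e * dilate u v w e f X Y W

/-- The operator `1 - S_p / p`. -/
noncomputable def eulerOp (u v w p : ℕ) (f : ℝ → ℝ → ℝ → ℝ) (X Y W : ℝ) : ℝ :=
  f X Y W + -(1 / (p : ℝ)) * dilate u v w p f X Y W

/-- Equality of functions of three variables below `N + 1`. -/
def BoxEq (N : ℕ) (f g : ℝ → ℝ → ℝ → ℝ) : Prop :=
  ∀ X Y W : ℝ, X < N + 1 → Y < N + 1 → W < N + 1 → f X Y W = g X Y W

theorem div_lt_add_one {X : ℝ} {N : ℕ} (hX : X < N + 1) (e u : ℕ) : X / (e : ℝ) ^ u < N + 1 := by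
  rcases Nat.eq_zero_or_pos (e ^ u) with h | h
  · have : (e : ℝ) ^ u = 0 := by exact_mod_cast h
    rw [this, div_zero]; positivity
  · have h1 : (1 : ℝ) ≤ (e : ℝ) ^ u := by exact_mod_cast h
    rcases le_or_gt X 0 with h0 | h0
    · exact lt_of_le_of_lt (div_nonpos_of_nonpos_of_nonneg h0 (by linarith)) (by positivity)
    · exact lt_of_le_of_lt (div_le_self h0.le h1) hX

theorem dilate_mul (u v w p m : ℕ) (f : ℝ → ℝ → ℝ → ℝ) (X Y W : ℝ) :
    dilate u v w (p * m) f X Y W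
      = dilate u v w m f (X / (p : ℝ) ^ u) (Y / (p : ℝ) ^ v) (W / (p : ℝ) ^ w) := by
  simp only [dilate, Nat.cast_mul, mul_pow, div_div]

theorem layer_eulerOp (b : ℕ → ℝ) (N u v w q u' v' w' p : ℕ) (f : ℝ → ℝ → ℝ → ℝ) :
    layer b N u v w q (eulerOp u' v' w' p f) = eulerOp u' v' w' p (layer b N u v w q f) := by
  funext X Y W
  simp only [layer, eulerOp, dilate, div_right_comm X, div_right_comm Y, div_right_comm W,
    Finset.mul_sum, ← Finset.sum_add_distrib]
  exact Finset.sum_congr rfl fun e _ => by ring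

theorem VanishesBelowOne.dilate {f : ℝ → ℝ → ℝ → ℝ} (hf : VanishesBelowOne f) (u v w e : ℕ) :
    VanishesBelowOne (dilate u v w e f) := by
  have hd : ∀ {x : ℝ} (u : ℕ), x < 1 → x / (e : ℝ) ^ u < 1 := fun {x} u h => by
    have := div_natCast_lt_one h (e ^ u)
    rwa [Nat.cast_pow] at this
  exact fun X Y W h => hf _ _ _ (h.imp (hd u) (Or.imp (hd v) (hd w)))

theorem VanishesBelowOne.layer {f : ℝ → ℝ → ℝ → ℝ} (hf : VanishesBelowOne f) (b : ℕ → ℝ)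
    (N u v w q : ℕ) : VanishesBelowOne (layer b N u v w q f) := fun X Y W h =>
  Finset.sum_eq_zero fun e _ => by rw [hf.dilate u v w e X Y W h, mul_zero]

theorem BoxEq.trans {N : ℕ} {f g h : ℝ → ℝ → ℝ → ℝ} (h₁ : BoxEq N f g) (h₂ : BoxEq N g h) :
    BoxEq N f h := fun X Y W hX hY hW => (h₁ X Y W hX hY hW).trans (h₂ X Y W hX hY hW)

theorem BoxEq.dilate {N : ℕ} {f g : ℝ → ℝ → ℝ → ℝ} (h : BoxEq N f g) (u v w e : ℕ) :
    BoxEq N (dilate u v w e f) (dilate u v w e g) := fun _ _ _ hX hY hW =>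
  h _ _ _ (div_lt_add_one hX e u) (div_lt_add_one hY e v) (div_lt_add_one hW e w)

theorem BoxEq.layer {N : ℕ} {f g : ℝ → ℝ → ℝ → ℝ} (h : BoxEq N f g) (b : ℕ → ℝ) (u v w q : ℕ) :
    BoxEq N (layer b N u v w q f) (layer b N u v w q g) := fun X Y W hX hY hW =>
  Finset.sum_congr rfl fun e _ => by rw [h.dilate u v w e X Y W hX hY hW]

theorem BoxEq.eulerOp {N : ℕ} {f g : ℝ → ℝ → ℝ → ℝ} (h : BoxEq N f g) (u v w p : ℕ) :
    BoxEq N (eulerOp u v w p f) (eulerOp u v w p g) := fun X Y W hX hY hW => by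
  simp only [_root_.eulerOp, h X Y W hX hY hW, h.dilate u v w p X Y W hX hY hW]

theorem BoxEq.corrIter {N : ℕ} {f g : ℝ → ℝ → ℝ → ℝ} (h : BoxEq N f g) (C : CorrCoeff) (Z : ℕ) :
    BoxEq N (corrIter C Z f) (corrIter C Z g) := by
  induction Z with
  | zero => exact h
  | succ Z ih =>
    intro X Y W hX hY hW
    have hd : ∀ {x : ℝ}, x < N + 1 → x / Z < N + 1 := fun h => by
      simpa using div_lt_add_one h Z 1
    simp only [_root_.corrIter, corrOp]
    rw [ih X Y W hX hY hW, ih _ _ _ (hd hX) (hd hY) hW, ih _ _ _ (hd hX) hY (hd hW),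
      ih _ _ _ hX (hd hY) (hd hW), ih _ _ _ (hd hX) (hd hY) (hd hW)]

theorem dilate_eq_zero {f : ℝ → ℝ → ℝ → ℝ} (hf : VanishesBelowOne f) {N u v w e : ℕ}
    (huvw : u ≠ 0 ∨ v ≠ 0 ∨ w ≠ 0) (he : N + 1 ≤ e) {X Y W : ℝ} (hX : X < N + 1) (hY : Y < N + 1)
    (hW : W < N + 1) : dilate u v w e f X Y W = 0 := by
  have key : ∀ {X : ℝ} {u : ℕ}, X < N + 1 → u ≠ 0 → X / (e : ℝ) ^ u < 1 := by
    intro X u hX hu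
    have he1 : (N : ℝ) + 1 ≤ e := by exact_mod_cast he
    have hN : (0 : ℝ) ≤ N := Nat.cast_nonneg N
    have h1 : (e : ℝ) ≤ (e : ℝ) ^ u := le_self_pow₀ (by linarith) hu
    rw [div_lt_one (by linarith)]
    linarith
  exact hf _ _ _ (huvw.imp (key hX) (Or.imp (key hY) (key hW)))

/-- The summands divisible by the prime `p`, for a coefficient with `b(pm) = b'(m)/p`. -/
theorem sum_dilate_prime_mul {f : ℝ → ℝ → ℝ → ℝ} (hf : VanishesBelowOne f) {N u v w p q : ℕ}
    (huvw : u ≠ 0 ∨ v ≠ 0 ∨ w ≠ 0) (hp : p.Prime) {b b' : ℕ → ℝ}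
    (hb : ∀ m, Nat.Coprime m q → b (p * m) = 1 / (p : ℝ) * b' m) {X Y W : ℝ} (hX : X < N + 1)
    (hY : Y < N + 1) (hW : W < N + 1) :
    ∑ m ∈ (Finset.Icc 1 (N / p)).filter (fun m => Nat.Coprime m q),
        b (p * m) * dilate u v w (p * m) f X Y W
      = 1 / (p : ℝ) * layer b' N u v w q f (X / (p : ℝ) ^ u) (Y / (p : ℝ) ^ v)
        (W / (p : ℝ) ^ w) := by
  rw [layer, Finset.mul_sum]
  have hsub : (Finset.Icc 1 (N / p)).filter (fun m => Nat.Coprime m q)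
      ⊆ (Finset.Icc 1 N).filter (fun m => Nat.Coprime m q) :=
    Finset.filter_subset_filter _ (Finset.Icc_subset_Icc_right (Nat.div_le_self N p))
  rw [← Finset.sum_subset hsub]
  · refine Finset.sum_congr rfl fun m hm => ?_
    rw [hb m (Finset.mem_filter.mp hm).2, dilate_mul]
    ring
  · intro m hm hm'
    have hlt : N / p < m := by
      by_contra h
      simp only [Finset.mem_filter, Finset.mem_Icc] at hm hm'
      exact hm' ⟨⟨hm.1.1, not_lt.mp h⟩, hm.2⟩
    have hle : N + 1 ≤ p * m := by
      have := (Nat.div_lt_iff_lt_mul hp.pos).mp hlt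
      rw [mul_comm]; exact this
    rw [← dilate_mul, dilate_eq_zero hf huvw hle hX hY hW]
    ring

/-- Removing the multiples of `p` from a harmonic layer. -/
theorem boxEq_layer_one_div {f : ℝ → ℝ → ℝ → ℝ} (hf : VanishesBelowOne f) (N : ℕ) {u v w p q : ℕ}
    (huvw : u ≠ 0 ∨ v ≠ 0 ∨ w ≠ 0) (hp : p.Prime) (hpq : Nat.Coprime p q) :
    BoxEq N (layer (fun e => 1 / (e : ℝ)) N u v w (p * q) f)
      (eulerOp u v w p (layer (fun e => 1 / (e : ℝ)) N u v w q f)) := by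
  intro X Y W hX hY hW
  have h1 := sum_coprime_split (fun e => 1 / (e : ℝ) * dilate u v w e f X Y W) hp hpq N
  rw [sum_dilate_prime_mul (b := fun e => 1 / (e : ℝ)) (b' := fun e => 1 / (e : ℝ)) hf huvw hp
    (fun m _ => by push_cast; rw [one_div_mul_one_div]) hX hY hW] at h1
  simp only [eulerOp]
  rw [show layer (fun e => 1 / (e : ℝ)) N u v w q f X Y W = _ from h1]
  simp only [dilate, layer]
  ring

/-- Removing the multiples of `p` from a Möbius layer. -/
theorem boxEq_layer_moebius {f : ℝ → ℝ → ℝ → ℝ} (hf : VanishesBelowOne f) (N : ℕ) {u v w p q : ℕ}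
    (huvw : u ≠ 0 ∨ v ≠ 0 ∨ w ≠ 0) (hp : p.Prime) (hpq : Nat.Coprime p q) :
    BoxEq N (eulerOp u v w p
        (layer (fun e => (ArithmeticFunction.moebius e : ℝ) / e) N u v w (p * q) f))
      (layer (fun e => (ArithmeticFunction.moebius e : ℝ) / e) N u v w q f) := by
  intro X Y W hX hY hW
  have h1 := sum_coprime_split
    (fun e => (ArithmeticFunction.moebius e : ℝ) / e * dilate u v w e f X Y W) hp hpq N
  have hb : ∀ m, Nat.Coprime m q → (ArithmeticFunction.moebius (p * m) : ℝ) / ((p * m : ℕ) : ℝ)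
      = 1 / (p : ℝ) * (if Nat.Coprime m p then -((ArithmeticFunction.moebius m : ℝ) / m) else 0) := by
    intro m _
    split_ifs with hmp
    · rw [ArithmeticFunction.isMultiplicative_moebius.map_mul_of_coprime hmp.symm,
        ArithmeticFunction.moebius_apply_prime hp]
      push_cast
      rw [one_div, mul_neg, div_eq_mul_inv, div_eq_mul_inv, mul_inv]
      ring
    · have hdvd : p ∣ m := by
        by_contra h
        exact hmp ((Nat.Prime.coprime_iff_not_dvd hp).mpr h).symm
      have hsq : ¬ Squarefree (p * m) := fun h => by
        have := h p (mul_dvd_mul_left p hdvd)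
        exact hp.one_lt.ne' (Nat.isUnit_iff.mp this)
      rw [ArithmeticFunction.moebius_eq_zero_of_not_squarefree hsq]
      simp
  rw [sum_dilate_prime_mul (b := fun e => (ArithmeticFunction.moebius e : ℝ) / e)
    (b' := fun m => if Nat.Coprime m p then -((ArithmeticFunction.moebius m : ℝ) / m) else 0)
    hf huvw hp hb hX hY hW] at h1
  have h2 : ∀ X Y W, layer
      (fun m => if Nat.Coprime m p then -((ArithmeticFunction.moebius m : ℝ) / m) else 0)
      N u v w q f X Y W
      = -layer (fun e => (ArithmeticFunction.moebius e : ℝ) / e) N u v w (p * q) f X Y W := by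
    intro X Y W
    simp only [layer, ite_mul, zero_mul, ← Finset.sum_neg_distrib]
    rw [← Finset.sum_filter, Finset.filter_filter]
    refine Finset.sum_congr (Finset.filter_congr fun e _ => ?_) fun e _ => by ring
    rw [Nat.coprime_mul_iff_right, and_comm]
  rw [h2] at h1
  rw [show layer (fun e => (ArithmeticFunction.moebius e : ℝ) / e) N u v w q f X Y W = _ from h1]
  simp only [eulerOp, dilate, layer]
  ring

/-- The model for the triple of equal shifts, over integers coprime to `q`: the Euler product
`∏_p (1 - S₁₂₃/p) / ((1 - S₁₂/p) (1 - S₁₃/p) (1 - S₂₃/p))` applied to the indicator function. -/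
noncomputable def tripleModel (N q : ℕ) : ℝ → ℝ → ℝ → ℝ :=
  layer (fun e => (ArithmeticFunction.moebius e : ℝ) / e) N 1 1 1 q
    (layer (fun e => 1 / (e : ℝ)) N 1 1 0 q
      (layer (fun e => 1 / (e : ℝ)) N 1 0 1 q
        (layer (fun e => 1 / (e : ℝ)) N 0 1 1 q geOne₃)))

theorem vanishesBelowOne_tripleModel (N q : ℕ) : VanishesBelowOne (tripleModel N q) :=
  (((vanishesBelowOne_geOne₃.layer _ _ _ _ _ _).layer _ _ _ _ _ _).layer _ _ _ _ _ _).layer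
    _ _ _ _ _ _

theorem boxEq_eulerOp_tripleModel (N : ℕ) {p q : ℕ} (hp : p.Prime) (hpq : Nat.Coprime p q) :
    BoxEq N (eulerOp 1 1 1 p (tripleModel N (p * q)))
      (eulerOp 1 1 0 p (eulerOp 1 0 1 p (eulerOp 0 1 1 p (tripleModel N q)))) := by
  have v0 := vanishesBelowOne_geOne₃
  have v1 : ∀ q', VanishesBelowOne (layer (fun e => 1 / (e : ℝ)) N 0 1 1 q' geOne₃) := fun q' =>
    v0.layer _ _ _ _ _ _
  have v2 : ∀ q', VanishesBelowOne (layer (fun e => 1 / (e : ℝ)) N 1 0 1 q'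
    (layer (fun e => 1 / (e : ℝ)) N 0 1 1 q' geOne₃)) := fun q' => (v1 q').layer _ _ _ _ _ _
  have s1 := boxEq_layer_one_div v0 N (u := 0) (v := 1) (w := 1) (by simp) hp hpq
  have s2 := s1.layer (fun e => 1 / (e : ℝ)) 1 0 1 (p * q)
  rw [layer_eulerOp] at s2
  have s3 := s2.trans
    ((boxEq_layer_one_div (v1 q) N (u := 1) (v := 0) (w := 1) (by simp) hp hpq).eulerOp 0 1 1 p)
  have s4 := s3.layer (fun e => 1 / (e : ℝ)) 1 1 0 (p * q)
  rw [layer_eulerOp, layer_eulerOp] at s4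
  have s5 := s4.trans (((boxEq_layer_one_div (v2 q) N (u := 1) (v := 1) (w := 0) (by simp) hp
    hpq).eulerOp 1 0 1 p).eulerOp 0 1 1 p)
  have s6 := s5.layer (fun e => (ArithmeticFunction.moebius e : ℝ) / e) 1 1 1 q
  rw [layer_eulerOp, layer_eulerOp, layer_eulerOp] at s6
  have s7 := boxEq_layer_moebius ((v2 (p * q)).layer (fun e => 1 / (e : ℝ)) N 1 1 0 (p * q)) N
    (u := 1) (v := 1) (w := 1) (by simp) hp hpq
  have hcomm : ∀ f : ℝ → ℝ → ℝ → ℝ,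
      eulerOp 0 1 1 p (eulerOp 1 0 1 p (eulerOp 1 1 0 p f))
        = eulerOp 1 1 0 p (eulerOp 1 0 1 p (eulerOp 0 1 1 p f)) := by
    intro f
    funext X Y W
    simp only [eulerOp, dilate, pow_zero, pow_one, div_one]
    ring
  have s8 := s7.trans s6
  rw [hcomm] at s8
  exact s8

theorem boxEq_tripleModel_primeProd {N Z : ℕ} (hN : 1 ≤ N) (hZ : N < Z) :
    BoxEq N (tripleModel N (primeProd Z)) geOne₃ := by
  have hset : (Finset.Icc 1 N).filter (fun e => Nat.Coprime e (primeProd Z)) = {1} := by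
    ext e
    simp only [Finset.mem_filter, Finset.mem_Icc, Finset.mem_singleton]
    constructor
    · rintro ⟨⟨h1, h2⟩, h3⟩
      exact eq_one_of_coprime_primeProd h1 (by omega) h3
    · rintro rfl
      exact ⟨⟨le_rfl, hN⟩, Nat.coprime_one_left _⟩
  intro X Y W _ _ _
  simp [tripleModel, layer, dilate, hset]

theorem tripleModel_one (N : ℕ) (X Y W : ℝ) :
    tripleModel N 1 X Y W = ∑ d ∈ Finset.Icc 1 N, (ArithmeticFunction.moebius d : ℝ) / d *
      tripleSum N (X / d) (Y / d) (W / d) := by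
  simp [tripleModel, layer, dilate, tripleSum]

/-! ### Three equal shifts -/

/-- The model for three equal shifts is asymptotic to `(3/4) (log R)²`. -/
theorem exists_abs_tripleModel_one_sub_le : ∃ C : ℝ, 0 ≤ C ∧
    ∀ x₁ x₂ x₃ : ℝ, 1 ≤ x₁ → 1 ≤ x₂ → 1 ≤ x₃ → ∀ (N : ℕ) (R : ℝ), 1 ≤ R → R < N + 1 →
      |tripleModel N 1 (R / x₁) (R / x₂) (R / x₃) - 3 / 4 * Real.log R ^ 2|
        ≤ C * (x₁ * x₂ * x₃) ^ (1 / 18 : ℝ) * (1 + Real.log R) := by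
  obtain ⟨C₀, hC0, htriple⟩ := exists_abs_tripleSum_sub_le
  obtain ⟨C₁, hC1, hmoeb⟩ := exists_abs_sum_moebius_mul_sub_le
  refine ⟨C₁ * (1 + 3 * C₀) * 55 ^ 3, by positivity, fun x₁ x₂ x₃ h₁ h₂ h₃ N R hR hRN => ?_⟩
  obtain ⟨b, c, hb, hc, hF⟩ := htriple x₁ x₂ x₃ h₁ h₂ h₃
  have hlog : Real.log x₁ + Real.log x₂ + Real.log x₃ = Real.log (x₁ * x₂ * x₃) := by
    rw [Real.log_mul (by positivity) (by positivity), Real.log_mul (by positivity) (by positivity)]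
  rw [hlog] at hb hc hF
  set x := x₁ * x₂ * x₃ with hx
  have hx1 : 1 ≤ x := one_le_mul_of_one_le_of_one_le (one_le_mul_of_one_le_of_one_le h₁ h₂) h₃
  set Λ := 1 + Real.log x with hΛ
  have hΛ1 : 1 ≤ Λ := by have := Real.log_nonneg hx1; linarith
  have hvan : ∀ y < 1, tripleSum N (y / x₁) (y / x₂) (y / x₃) = 0 := by
    intro y hy
    have hyx : y / x₁ < 1 := by
      rcases le_or_gt y 0 with h | h
      · exact lt_of_le_of_lt (div_nonpos_of_nonpos_of_nonneg h (by linarith)) one_pos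
      · exact lt_of_le_of_lt (div_le_self h.le h₁) hy
    unfold tripleSum
    refine Finset.sum_eq_zero fun e₁ _ => ?_
    rw [Finset.sum_eq_zero fun e₂ _ => ?_, mul_zero]
    rw [Finset.sum_eq_zero fun e₃ _ => ?_, mul_zero]
    rw [vanishesBelowOne_geOne₃ _ _ _ (Or.inl (div_natCast_lt_one (div_natCast_lt_one hyx _) _)),
      mul_zero]
  have hm := hmoeb (fun y => tripleSum N (y / x₁) (y / x₂) (y / x₃)) b c (C₀ * Λ ^ 3)
    (by positivity) hvan N (fun y hy hyN => hF N y hy hyN) R hR hRN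
  rw [tripleModel_one]
  simp only [div_right_comm R _ x₁, div_right_comm R _ x₂, div_right_comm R _ x₃] at hm
  refine hm.trans ?_
  have hlR := Real.log_nonneg hR
  refine mul_le_mul_of_nonneg_right ?_ (by linarith)
  have hΛ2 : Λ ≤ Λ ^ 3 := le_self_pow₀ hΛ1 (by norm_num)
  have hΛ3 : Λ ^ 2 ≤ Λ ^ 3 := pow_le_pow_right₀ hΛ1 (by norm_num)
  have hΛ4 : 1 ≤ Λ ^ 3 := one_le_pow₀ hΛ1
  have hsum : 1 + |b| + |c| + C₀ * Λ ^ 3 ≤ (1 + 3 * C₀) * Λ ^ 3 := by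
    have e1 : C₀ * Λ ≤ C₀ * Λ ^ 3 := by gcongr
    have e2 : C₀ * Λ ^ 2 ≤ C₀ * Λ ^ 3 := by gcongr
    linarith
  have hpow : Λ ^ 3 ≤ 55 ^ 3 * x ^ (1 / 18 : ℝ) := by
    have h := one_add_log_le_rpow hx1 (δ := 1 / 54) (by norm_num)
    rw [← hΛ] at h
    norm_num at h
    calc Λ ^ 3 ≤ (55 * x ^ (1 / 54 : ℝ)) ^ 3 := by
          have : 0 ≤ Λ := by linarith
          norm_num
          gcongr
      _ = 55 ^ 3 * x ^ (1 / 18 : ℝ) := by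
          rw [mul_pow, ← Real.rpow_natCast (x ^ (1 / 54 : ℝ)) 3, ← Real.rpow_mul (by linarith)]
          norm_num
  calc C₁ * (1 + |b| + |c| + C₀ * Λ ^ 3) ≤ C₁ * ((1 + 3 * C₀) * (55 ^ 3 * x ^ (1 / 18 : ℝ))) := by
        gcongr
        exact hsum.trans (by gcongr)
    _ = _ := by ring

theorem corrIter_eulerOp (C : CorrCoeff) (Z u v w p : ℕ) (f : ℝ → ℝ → ℝ → ℝ) :
    corrIter C Z (eulerOp u v w p f) = eulerOp u v w p (corrIter C Z f) := by
  funext X Y W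
  have h := corrIter_add_mul C Z f (dilate u v w p f) (-(1 / (p : ℝ))) X Y W
  have h2 := corrIter_shift C Z f ((p : ℝ) ^ u) ((p : ℝ) ^ v) ((p : ℝ) ^ w) X Y W
  unfold eulerOp
  rw [h]
  congr 2

/-- The local coefficients of three equal shifts. -/
def CorrCoeff.EqualShifts (C : CorrCoeff) : Prop :=
  ∀ p : ℕ, p.Prime → C.c12 p = 1 / ((p : ℝ) - 1) ∧ C.c13 p = 1 / ((p : ℝ) - 1) ∧
    C.c23 p = 1 / ((p : ℝ) - 1) ∧ C.c123 p = -(((p : ℝ) - 2) / ((p : ℝ) - 1) ^ 2)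

/-- The difference between the true local operator and that of the model. -/
noncomputable def modelDefect (C : CorrCoeff) (p : ℕ) (f : ℝ → ℝ → ℝ → ℝ) (X Y W : ℝ) : ℝ :=
  corrOp C p (eulerOp 1 1 0 p (eulerOp 1 0 1 p (eulerOp 0 1 1 p f))) X Y W
    - eulerOp 1 1 1 p f X Y W

theorem equalShifts_coeff_bounds {p : ℝ} (hp2 : 2 ≤ p) :
    |1 / (p - 1) - 1 / p| ≤ 2 * (1 / p ^ 2) ∧
    |-((p - 2) / (p - 1) ^ 2) + 1 / p| ≤ 2 * (1 / p ^ 2) ∧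
    |1 / (p - 1) * (1 / p)| ≤ 2 * (1 / p ^ 2) ∧
    |1 / p * -((p - 2) / (p - 1) ^ 2)| ≤ 2 * (1 / p ^ 2) ∧
    |1 / (p - 1)| ≤ 1 ∧ |-((p - 2) / (p - 1) ^ 2)| ≤ 1 ∧
    |(1 / p) ^ 2| ≤ 1 / p ^ 2 ∧ |(1 / p) ^ 3| ≤ 1 / p ^ 2 := by
  set a := 1 / (p - 1) with ha
  set τ := -((p - 2) / (p - 1) ^ 2) with hτ
  set b := 1 / p with hb
  set Q := 1 / p ^ 2 with hQ
  have hp1 : (1 : ℝ) ≤ p - 1 := by linarith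
  have hpp : p ≤ 2 * (p - 1) := by linarith
  have ha0 : 0 ≤ a := by positivity
  have hb0 : 0 ≤ b := by positivity
  have hab : |a - b| ≤ 2 * Q := by
    have e : a - b = 1 / ((p - 1) * p) := by rw [ha, hb]; field_simp; ring
    rw [e, abs_of_nonneg (by positivity), hQ, mul_one_div,
      div_le_div_iff₀ (by positivity) (by positivity)]
    nlinarith
  have hτb : |τ + b| ≤ 2 * Q := by
    have e : τ + b = 1 / ((p - 1) ^ 2 * p) := by rw [hτ, hb]; field_simp; ring
    rw [e, abs_of_nonneg (by positivity), hQ, mul_one_div,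
      div_le_div_iff₀ (by positivity) (by positivity)]
    have h1 : p * p ≤ 2 * (p - 1) * p := by gcongr
    have h2 : 2 * (p - 1) * p ≤ 2 * (p - 1) ^ 2 * p := by
      have : p - 1 ≤ (p - 1) ^ 2 := le_self_pow₀ hp1 (by norm_num)
      gcongr
    linarith
  have hamb : |a * b| ≤ 2 * Q := by
    rw [abs_of_nonneg (by positivity), ha, hb, hQ, one_div_mul_one_div, mul_one_div,
      div_le_div_iff₀ (by positivity) (by positivity)]
    nlinarith
  have ha1 : |a| ≤ 1 := by
    rw [abs_of_nonneg ha0, ha, div_le_one (by linarith)]; exact hp1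
  have hτa : |τ| ≤ a := by
    rw [hτ, abs_neg, abs_of_nonneg (div_nonneg (by linarith) (by positivity)), ha,
      div_le_div_iff₀ (by positivity) (by positivity)]
    nlinarith
  have hτ1 : |τ| ≤ 1 := hτa.trans ((le_abs_self a).trans ha1)
  have hbτ : |b * τ| ≤ 2 * Q := by
    rw [abs_mul, abs_of_nonneg hb0]
    refine le_trans ?_ ((le_abs_self _).trans hamb)
    rw [mul_comm]
    gcongr
  have hb2 : |b ^ 2| ≤ Q := by
    rw [abs_of_nonneg (by positivity), hb, hQ, one_div_pow]
  have hb3 : |b ^ 3| ≤ Q := by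
    rw [abs_of_nonneg (by positivity)]
    have h1 : b ≤ 1 := by rw [hb, div_le_one (by linarith)]; linarith
    calc b ^ 3 ≤ b ^ 2 := pow_le_pow_of_le_one hb0 h1 (by norm_num)
      _ = Q := by rw [hb, hQ, one_div_pow]
  exact ⟨hab, hτb, hamb, hbτ, ha1, hτ1, hb2, hb3⟩

/-- The local operators agree to first order in `1/p`. -/
theorem abs_modelDefect_le {C : CorrCoeff} (hC : C.EqualShifts) {p : ℕ} (hp : p.Prime)
    {f : ℝ → ℝ → ℝ → ℝ} {X Y W M : ℝ}
    (hf : ∀ i j k : ℕ, i ≤ 3 → j ≤ 3 → k ≤ 3 →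
      |f (X / (p : ℝ) ^ i) (Y / (p : ℝ) ^ j) (W / (p : ℝ) ^ k)| ≤ M) :
    |modelDefect C p f X Y W| ≤ 52 / (p : ℝ) ^ 2 * M := by
  obtain ⟨h12, h13, h23, h123⟩ := hC p hp
  have hp2 : (2 : ℝ) ≤ p := by exact_mod_cast hp.two_le
  set F : ℕ → ℕ → ℕ → ℝ := fun i j k => f (X / (p : ℝ) ^ i) (Y / (p : ℝ) ^ j) (W / (p : ℝ) ^ k)
    with hF
  have hM : 0 ≤ M := (abs_nonneg _).trans (hf 0 0 0 (by omega) (by omega) (by omega))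
  set a := 1 / ((p : ℝ) - 1) with ha
  set τ := -(((p : ℝ) - 2) / ((p : ℝ) - 1) ^ 2) with hτ
  set b := 1 / (p : ℝ) with hb
  -- All coefficients are `O(1/p²)`: those of order `1/p` cancel in `a - b` and `τ + b`.
  have hid : modelDefect C p f X Y W
      = (a - b) * (F 1 1 0 + F 1 0 1 + F 0 1 1) + (τ + b) * F 1 1 1
        - a * b * (F 2 2 0 + F 2 0 2 + F 0 2 2 + 2 * F 2 1 1 + 2 * F 1 2 1 + 2 * F 1 1 2)
        - b * τ * (F 2 2 1 + F 2 1 2 + F 1 2 2)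
        + b ^ 2 * ((F 2 1 1 + F 1 2 1 + F 1 1 2)
          + a * (F 3 2 1 + F 2 3 1 + F 2 2 2 + F 3 1 2 + F 2 2 2 + F 2 1 3 + F 2 2 2 + F 1 3 2
            + F 1 2 3)
          + τ * (F 3 2 2 + F 2 3 2 + F 2 2 3))
        - b ^ 3 * (F 2 2 2 + a * (F 3 3 2 + F 3 2 3 + F 2 3 3) + τ * F 3 3 3) := by
    simp only [modelDefect, corrOp, eulerOp, dilate, h12, h13, h23, h123, hF, pow_zero, pow_one,
      div_one, div_div, ← pow_two, ← pow_succ, ← hb]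
    ring
  have hq : ∀ i j k : ℕ, i ≤ 3 → j ≤ 3 → k ≤ 3 → |F i j k| ≤ M := hf
  clear_value F
  have plus : ∀ {x y A B : ℝ}, |x| ≤ A → |y| ≤ B → |x + y| ≤ A + B := fun hx hy =>
    (abs_add_le _ _).trans (add_le_add hx hy)
  have times : ∀ {x y A B : ℝ}, |x| ≤ A → |y| ≤ B → |x * y| ≤ A * B := fun hx hy => by
    rw [abs_mul]
    exact mul_le_mul hx hy (abs_nonneg _) ((abs_nonneg _).trans hx)
  have minus : ∀ {x y A B : ℝ}, |x| ≤ A → |y| ≤ B → |x - y| ≤ A + B := fun hx hy =>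
    (abs_sub _ _).trans (add_le_add hx hy)
  have two : |(2 : ℝ)| ≤ 2 := by norm_num
  obtain ⟨hab, hτb, hamb, hbτ, ha1, hτ1, hb2, hb3⟩ := equalShifts_coeff_bounds hp2
  have n0 : 0 ≤ 3 := by norm_num
  have n1 : 1 ≤ 3 := by norm_num
  have n2 : 2 ≤ 3 := by norm_num
  have n3 : 3 ≤ 3 := le_rfl
  have f222 := hq 2 2 2 n2 n2 n2
  have s1 : |F 1 1 0 + F 1 0 1 + F 0 1 1| ≤ M + M + M :=
    plus (plus (hq 1 1 0 n1 n1 n0) (hq 1 0 1 n1 n0 n1)) (hq 0 1 1 n0 n1 n1)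
  have s3 : |F 2 2 0 + F 2 0 2 + F 0 2 2 + 2 * F 2 1 1 + 2 * F 1 2 1 + 2 * F 1 1 2|
      ≤ M + M + M + 2 * M + 2 * M + 2 * M :=
    plus (plus (plus (plus (plus (hq 2 2 0 n2 n2 n0) (hq 2 0 2 n2 n0 n2)) (hq 0 2 2 n0 n2 n2))
      (times two (hq 2 1 1 n2 n1 n1))) (times two (hq 1 2 1 n1 n2 n1))) (times two (hq 1 1 2 n1 n1 n2))
  have s4 : |F 2 2 1 + F 2 1 2 + F 1 2 2| ≤ M + M + M :=
    plus (plus (hq 2 2 1 n2 n2 n1) (hq 2 1 2 n2 n1 n2)) (hq 1 2 2 n1 n2 n2)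
  have s5 : |F 2 1 1 + F 1 2 1 + F 1 1 2| ≤ M + M + M :=
    plus (plus (hq 2 1 1 n2 n1 n1) (hq 1 2 1 n1 n2 n1)) (hq 1 1 2 n1 n1 n2)
  have s6 : |F 3 2 1 + F 2 3 1 + F 2 2 2 + F 3 1 2 + F 2 2 2 + F 2 1 3 + F 2 2 2 + F 1 3 2
      + F 1 2 3| ≤ M + M + M + M + M + M + M + M + M :=
    plus (plus (plus (plus (plus (plus (plus (plus (hq 3 2 1 n3 n2 n1) (hq 2 3 1 n2 n3 n1)) f222)
      (hq 3 1 2 n3 n1 n2)) f222) (hq 2 1 3 n2 n1 n3)) f222) (hq 1 3 2 n1 n3 n2)) (hq 1 2 3 n1 n2 n3)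
  have s7 : |F 3 2 2 + F 2 3 2 + F 2 2 3| ≤ M + M + M :=
    plus (plus (hq 3 2 2 n3 n2 n2) (hq 2 3 2 n2 n3 n2)) (hq 2 2 3 n2 n2 n3)
  have s8 : |F 3 3 2 + F 3 2 3 + F 2 3 3| ≤ M + M + M :=
    plus (plus (hq 3 3 2 n3 n3 n2) (hq 3 2 3 n3 n2 n3)) (hq 2 3 3 n2 n3 n3)
  have t1 := times hab s1
  have t2 := times hτb (hq 1 1 1 n1 n1 n1)
  have t3 := times hamb s3
  have t4 := times hbτ s4
  have t5 := times hb2 (plus (plus s5 (times ha1 s6)) (times hτ1 s7))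
  have t6 := times hb3 (plus (plus f222 (times ha1 s8)) (times hτ1 (hq 3 3 3 n3 n3 n3)))
  rw [hid]
  refine (minus (plus (minus (minus (plus t1 t2) t3) t4) t5) t6).trans (le_of_eq ?_)
  ring

theorem modelDefect_add_const {C : CorrCoeff} (hC : C.EqualShifts) {p : ℕ} (hp : p.Prime)
    (f : ℝ → ℝ → ℝ → ℝ) (m X Y W : ℝ) :
    modelDefect C p (fun X Y W => f X Y W - m) X Y W = modelDefect C p f X Y W := by
  obtain ⟨h12, h13, h23, h123⟩ := hC p hp
  have hp2 : (2 : ℝ) ≤ p := by exact_mod_cast hp.two_le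
  have hp0 : (p : ℝ) ≠ 0 := by linarith
  have hp1 : (p : ℝ) - 1 ≠ 0 := by linarith
  have hconst : (1 + 3 * (1 / ((p : ℝ) - 1)) + -(((p : ℝ) - 2) / ((p : ℝ) - 1) ^ 2))
      * (1 - 1 / (p : ℝ)) ^ 3 = 1 - 1 / (p : ℝ) := by
    field_simp
    ring
  have hdiff : modelDefect C p (fun X Y W => f X Y W - m) X Y W - modelDefect C p f X Y W
      = -m * ((1 + 3 * (1 / ((p : ℝ) - 1)) + -(((p : ℝ) - 2) / ((p : ℝ) - 1) ^ 2))
        * (1 - 1 / (p : ℝ)) ^ 3 - (1 - 1 / (p : ℝ))) := by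
    simp only [modelDefect, corrOp, eulerOp, dilate, h12, h13, h23, h123]
    ring
  rw [hconst, sub_self, mul_zero, sub_eq_zero] at hdiff
  exact hdiff

/-- The three-fold sum with the primes below `Z` treated exactly and the others by the model. -/
noncomputable def tripleHybrid (C : CorrCoeff) (N Z : ℕ) : ℝ → ℝ → ℝ → ℝ :=
  corrIter C Z (tripleModel N (primeProd Z))

theorem vanishesBelowOne_tripleHybrid (C : CorrCoeff) (N Z : ℕ) :
    VanishesBelowOne (tripleHybrid C N Z) := (vanishesBelowOne_tripleModel N _).corrIter C Z

theorem tripleHybrid_succ_of_not_prime {C : CorrCoeff} (hC : C.OnPrimes) (N : ℕ) {Z : ℕ}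
    (hZ : ¬ Z.Prime) : tripleHybrid C N (Z + 1) = tripleHybrid C N Z := by
  rw [tripleHybrid, tripleHybrid, primeProd_succ_of_not_prime hZ, corrIter,
    corrOp_of_not_prime hC hZ]

theorem eulerOp_tripleHybrid_succ (C : CorrCoeff) (N : ℕ) {p : ℕ} (hp : p.Prime) {X Y W : ℝ}
    (hX : X < N + 1) (hY : Y < N + 1) (hW : W < N + 1) :
    eulerOp 1 1 1 p (fun X Y W => tripleHybrid C N (p + 1) X Y W - tripleHybrid C N p X Y W) X Y W
      = modelDefect C p (tripleHybrid C N p) X Y W := by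
  have h1 := ((boxEq_eulerOp_tripleModel N hp (coprime_primeProd hp le_rfl)).corrIter C (p + 1))
    X Y W hX hY hW
  rw [corrIter_eulerOp] at h1
  rw [show corrIter C (p + 1) (eulerOp 1 1 0 p (eulerOp 1 0 1 p (eulerOp 0 1 1 p
      (tripleModel N (primeProd p))))) = corrOp C p (eulerOp 1 1 0 p (eulerOp 1 0 1 p
      (eulerOp 0 1 1 p (tripleHybrid C N p)))) by
    rw [corrIter, corrIter_eulerOp, corrIter_eulerOp, corrIter_eulerOp, tripleHybrid]] at h1
  rw [← primeProd_succ_of_prime hp] at h1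
  rw [modelDefect, ← h1]
  simp only [eulerOp, dilate, tripleHybrid]
  ring

theorem tripleHybrid_eq_corrIter_geOne₃ (C : CorrCoeff) {N Z : ℕ} (hN : 1 ≤ N) (hZ : N < Z) :
    BoxEq N (tripleHybrid C N Z) (corrIter C Z geOne₃) :=
  (boxEq_tripleModel_primeProd hN hZ).corrIter C Z

/-- Inversion of `1 - S₁₂₃/p` for functions that vanish below one: a bound of power growth in the
dilation parameters is preserved up to a constant. -/
theorem abs_le_of_abs_eulerOp_le {g : ℝ → ℝ → ℝ → ℝ} (hg : VanishesBelowOne g) {p : ℕ}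
    (hp : p.Prime) {R M : ℝ} (hM : 0 ≤ M)
    (h : ∀ x₁ x₂ x₃ : ℝ, 1 ≤ x₁ → 1 ≤ x₂ → 1 ≤ x₃ →
      |eulerOp 1 1 1 p g (R / x₁) (R / x₂) (R / x₃)| ≤ M * (x₁ * x₂ * x₃) ^ (1 / 18 : ℝ))
    {x₁ x₂ x₃ : ℝ} (h₁ : 1 ≤ x₁) (h₂ : 1 ≤ x₂) (h₃ : 1 ≤ x₃) :
    |g (R / x₁) (R / x₂) (R / x₃)| ≤ 4 * M * (x₁ * x₂ * x₃) ^ (1 / 18 : ℝ) := by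
  have hp2 : (2 : ℝ) ≤ p := by exact_mod_cast hp.two_le
  have main : ∀ (n : ℕ) (x₁ x₂ x₃ : ℝ), 1 ≤ x₁ → 1 ≤ x₂ → 1 ≤ x₃ → R / x₁ < (p : ℝ) ^ n →
      |g (R / x₁) (R / x₂) (R / x₃)| ≤ 4 * M * (x₁ * x₂ * x₃) ^ (1 / 18 : ℝ) := by
    intro n
    induction n with
    | zero =>
      intro x₁ x₂ x₃ h₁ h₂ h₃ hlt
      rw [pow_zero] at hlt
      rw [hg _ _ _ (Or.inl hlt), abs_zero]
      positivity
    | succ n ih =>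
      intro x₁ x₂ x₃ h₁ h₂ h₃ hlt
      have hge : ∀ {z : ℝ}, 1 ≤ z → 1 ≤ p * z := fun {z} hz =>
        one_le_mul_of_one_le_of_one_le (by linarith) hz
      have hdd : ∀ z : ℝ, R / z / p = R / (p * z) := fun z => by rw [div_div, mul_comm]
      have hlt' : R / (p * x₁) < (p : ℝ) ^ n := by
        rw [← hdd, div_lt_iff₀ (by linarith)]
        rwa [pow_succ] at hlt
      have i1 := ih (p * x₁) (p * x₂) (p * x₃) (hge h₁) (hge h₂) (hge h₃) hlt'
      have i2 := h x₁ x₂ x₃ h₁ h₂ h₃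
      simp only [eulerOp, dilate, pow_one, hdd] at i2
      set t := (x₁ * x₂ * x₃) ^ (1 / 18 : ℝ) with ht
      have ht0 : 0 ≤ t := by positivity
      have hpow : (p * x₁ * (p * x₂) * (p * x₃)) ^ (1 / 18 : ℝ) = (p : ℝ) ^ (1 / 6 : ℝ) * t := by
        rw [show p * x₁ * (p * x₂) * (p * x₃) = (p : ℝ) ^ (3 : ℝ) * (x₁ * x₂ * x₃) by
          norm_cast; push_cast; ring, Real.mul_rpow (by positivity) (by positivity),
          ← Real.rpow_mul (by positivity)]
        rw [ht]
        norm_num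
      rw [hpow] at i1
      -- `p^(1/6) / p ≤ 1 / √p ≤ 3/4`.
      have hsmall : 1 / (p : ℝ) * (p : ℝ) ^ (1 / 6 : ℝ) ≤ 3 / 4 := by
        have e1 : (p : ℝ) ^ (1 / 6 : ℝ) ≤ √p := by
          rw [Real.sqrt_eq_rpow]
          exact Real.rpow_le_rpow_of_exponent_le (by linarith) (by norm_num)
        have e2 : √(p : ℝ) * √(p : ℝ) = p := Real.mul_self_sqrt (by linarith)
        have e3 : 4 / 3 ≤ √(p : ℝ) := Real.le_sqrt_of_sq_le (by norm_num; linarith)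
        rw [one_div_mul_eq_div, div_le_iff₀ (by linarith)]
        nlinarith
      have hid : g (R / x₁) (R / x₂) (R / x₃)
          = (g (R / x₁) (R / x₂) (R / x₃)
              + -(1 / (p : ℝ)) * g (R / (p * x₁)) (R / (p * x₂)) (R / (p * x₃)))
            + 1 / (p : ℝ) * g (R / (p * x₁)) (R / (p * x₂)) (R / (p * x₃)) := by ring
      rw [hid]
      refine (abs_add_le _ _).trans ?_
      rw [abs_mul, abs_of_nonneg (by positivity : (0 : ℝ) ≤ 1 / p)]
      calc _ ≤ M * t + 1 / (p : ℝ) * (4 * M * ((p : ℝ) ^ (1 / 6 : ℝ) * t)) := by gcongr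
        _ = M * t + (1 / (p : ℝ) * (p : ℝ) ^ (1 / 6 : ℝ)) * (4 * M * t) := by ring
        _ ≤ M * t + 3 / 4 * (4 * M * t) := by gcongr
        _ = 4 * M * t := by ring
  obtain ⟨n, hn⟩ := pow_unbounded_of_one_lt (R / x₁) (by linarith : (1 : ℝ) < p)
  exact main n x₁ x₂ x₃ h₁ h₂ h₃ hn

/-- For three equal shifts the three-fold sum is asymptotic to `(3/4) (log R)²`. -/
theorem exists_abs_corrIter_equalShifts_sub_le : ∃ B : ℝ, 0 ≤ B ∧ ∀ C : CorrCoeff, C.OnPrimes →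
    C.EqualShifts → ∀ R : ℝ, 1 ≤ R → ∀ Z : ℕ, R < Z →
      |corrIter C Z geOne₃ R R R - 3 / 4 * Real.log R ^ 2| ≤ B * (1 + Real.log R) := by
  obtain ⟨C₀, hC0, hbase⟩ := exists_abs_tripleModel_one_sub_le
  obtain ⟨K, hK1, hK⟩ := exists_prod_threeHalves_le (C := 208) (by norm_num)
  refine ⟨K * C₀, by positivity, fun C hCP hC R hR Z hZ => ?_⟩
  have hlR := Real.log_nonneg hR
  set N := ⌊R⌋₊ with hN
  have hRN : R < N + 1 := Nat.lt_floor_add_one R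
  have hN1 : 1 ≤ N := Nat.one_le_floor_iff _ |>.mpr hR
  have hNZ : N < Z := by
    have : (N : ℝ) < Z := lt_of_le_of_lt (Nat.floor_le (by linarith)) hZ
    exact_mod_cast this
  set m := 3 / 4 * Real.log R ^ 2 with hm
  -- The step at `p` divides each variable by at most `p³`. The growth of exponent `1/18` in the product
  -- of the dilation parameters then costs `p ^ (9/18)`, and `p ^ (1/2) / p²` is summable.
  have main : ∀ (Z : ℕ) (x₁ x₂ x₃ : ℝ), 1 ≤ x₁ → 1 ≤ x₂ → 1 ≤ x₃ →
      |tripleHybrid C N Z (R / x₁) (R / x₂) (R / x₃) - m|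
        ≤ (∏ n ∈ Finset.range Z, (1 + 208 * threeHalves n)) *
          (C₀ * (1 + Real.log R)) * (x₁ * x₂ * x₃) ^ (1 / 18 : ℝ) := by
    intro Z
    induction Z with
    | zero =>
      intro x₁ x₂ x₃ h₁ h₂ h₃
      have := hbase x₁ x₂ x₃ h₁ h₂ h₃ N R hR hRN
      simp only [tripleHybrid, corrIter, primeProd_zero, Finset.range_zero, Finset.prod_empty]
      rw [hm]
      linarith
    | succ Z ih =>
      set B := ∏ n ∈ Finset.range Z, (1 + 208 * threeHalves n) with hB
      have hB0 : 0 ≤ B := Finset.prod_nonneg fun n _ => by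
        have := threeHalves_nonneg n; positivity
      set E := C₀ * (1 + Real.log R) with hE
      have hE0 : 0 ≤ E := by positivity
      rw [Finset.prod_range_succ, ← hB]
      by_cases hZ : Z.Prime
      · have hZ1 : (1 : ℝ) ≤ Z := by exact_mod_cast hZ.one_le
        have hth := threeHalves_nonneg Z
        intro x₁ x₂ x₃ h₁ h₂ h₃
        have hbox : ∀ {x : ℝ}, 1 ≤ x → R / x < N + 1 := fun hx =>
          lt_of_le_of_lt (div_le_self (by linarith) hx) hRN
        have hdef : ∀ x₁ x₂ x₃ : ℝ, 1 ≤ x₁ → 1 ≤ x₂ → 1 ≤ x₃ →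
            |eulerOp 1 1 1 Z (fun X Y W => tripleHybrid C N (Z + 1) X Y W
              - tripleHybrid C N Z X Y W) (R / x₁) (R / x₂) (R / x₃)|
            ≤ 52 * threeHalves Z * (B * E) * (x₁ * x₂ * x₃) ^ (1 / 18 : ℝ) := by
          intro x₁ x₂ x₃ h₁ h₂ h₃
          rw [eulerOp_tripleHybrid_succ C N hZ (hbox h₁) (hbox h₂) (hbox h₃),
            ← modelDefect_add_const hC hZ _ m]
          set t := (x₁ * x₂ * x₃) ^ (1 / 18 : ℝ) with ht
          have ht0 : 0 ≤ t := by positivity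
          have hfb := abs_modelDefect_le hC hZ
            (f := fun X Y W => tripleHybrid C N Z X Y W - m) (X := R / x₁) (Y := R / x₂)
            (W := R / x₃) (M := B * E * ((Z : ℝ) ^ (1 / 2 : ℝ) * t)) ?_
          · refine hfb.trans ?_
            have h2 := one_div_sq_le_threeHalves hZ1 (δ := 1 / 2) le_rfl
            calc 52 / (Z : ℝ) ^ 2 * (B * E * ((Z : ℝ) ^ (1 / 2 : ℝ) * t))
                = 52 * ((Z : ℝ) ^ (1 / 2 : ℝ) / (Z : ℝ) ^ 2) * (B * E) * t := by ring
              _ ≤ 52 * threeHalves Z * (B * E) * t := by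
                gcongr
                exact h2
          · intro i j k hi hj hk
            simp only [div_div]
            have hge : ∀ {x : ℝ} (i : ℕ), 1 ≤ x → 1 ≤ x * (Z : ℝ) ^ i := fun i hx =>
              one_le_mul_of_one_le_of_one_le hx (one_le_pow₀ hZ1)
            refine (ih _ _ _ (hge i h₁) (hge j h₂) (hge k h₃)).trans ?_
            refine mul_le_mul_of_nonneg_left ?_ (by positivity)
            have e1 : x₁ * (Z : ℝ) ^ i * (x₂ * (Z : ℝ) ^ j) * (x₃ * (Z : ℝ) ^ k)
                = (Z : ℝ) ^ (i + j + k) * (x₁ * x₂ * x₃) := by ring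
            have e2 : (Z : ℝ) ^ (i + j + k) ≤ (Z : ℝ) ^ 9 := pow_le_pow_right₀ hZ1 (by omega)
            rw [e1, Real.mul_rpow (by positivity) (by positivity)]
            refine mul_le_mul_of_nonneg_right ?_ ht0
            calc ((Z : ℝ) ^ (i + j + k)) ^ (1 / 18 : ℝ) ≤ ((Z : ℝ) ^ 9) ^ (1 / 18 : ℝ) := by gcongr
              _ = (Z : ℝ) ^ (1 / 2 : ℝ) := by
                rw [← Real.rpow_natCast, ← Real.rpow_mul (by positivity)]
                norm_num
        have hv : VanishesBelowOne fun X Y W => tripleHybrid C N (Z + 1) X Y W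
            - tripleHybrid C N Z X Y W := fun X Y W h => by
          simp only [vanishesBelowOne_tripleHybrid C N _ X Y W h, sub_zero]
        have hinv := abs_le_of_abs_eulerOp_le hv hZ (by positivity) hdef h₁ h₂ h₃
        have h0 := ih x₁ x₂ x₃ h₁ h₂ h₃
        set t := (x₁ * x₂ * x₃) ^ (1 / 18 : ℝ)
        rw [show tripleHybrid C N (Z + 1) (R / x₁) (R / x₂) (R / x₃) - m
          = (tripleHybrid C N (Z + 1) (R / x₁) (R / x₂) (R / x₃)
            - tripleHybrid C N Z (R / x₁) (R / x₂) (R / x₃))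
            + (tripleHybrid C N Z (R / x₁) (R / x₂) (R / x₃) - m) by ring]
        refine (abs_add_le _ _).trans ((add_le_add hinv h0).trans (le_of_eq ?_))
        ring
      · intro x₁ x₂ x₃ h₁ h₂ h₃
        rw [tripleHybrid_succ_of_not_prime hCP N hZ]
        refine (ih x₁ x₂ x₃ h₁ h₂ h₃).trans ?_
        have hth := threeHalves_nonneg Z
        have : B ≤ B * (1 + 208 * threeHalves Z) := le_mul_of_one_le_right hB0 (by linarith)
        gcongr
  have h1 := main Z 1 1 1 le_rfl le_rfl le_rfl
  simp only [div_one, mul_one, Real.one_rpow] at h1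
  rw [tripleHybrid_eq_corrIter_geOne₃ C hN1 hNZ R R R hRN hRN hRN] at h1
  refine h1.trans ?_
  rw [mul_assoc K]
  exact mul_le_mul_of_nonneg_right (hK Z) (by positivity)

/-! ### The local factors of the singular series -/

theorem dvdInd_eq_zero_or_one (d : ℕ) (n : ℤ) : dvdInd d n = 0 ∨ dvdInd d n = 1 := by
  unfold dvdInd
  split_ifs <;> simp

theorem dvdInd_zero (d : ℕ) : dvdInd d 0 = 1 := if_pos (dvd_zero _)

theorem dvdInd_sub_comm (d : ℕ) (m n : ℤ) : dvdInd d (m - n) = dvdInd d (n - m) := by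
  simp only [dvdInd, dvd_sub_comm]

theorem dvdInd_sub_eq_ite (p : ℕ) (m n : ℤ) :
    dvdInd p (m - n) = if (m : ZMod p) = n then 1 else 0 := by
  simp only [dvdInd, ZMod.intCast_eq_intCast_iff_dvd_sub, dvd_sub_comm]

theorem residueCount_one (j : Fin 1 → ℤ) (p : ℕ) : residueCount j p = 1 := by
  simp [residueCount]

theorem residueCount_two (j : Fin 2 → ℤ) (p : ℕ) :
    (residueCount j p : ℝ) = 2 - dvdInd p (j 0 - j 1) := by
  rw [dvdInd_sub_eq_ite]
  have : (Finset.univ.image fun i => (j i : ZMod p)) = {(j 0 : ZMod p), (j 1 : ZMod p)} := by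
    ext x; simp [Fin.exists_fin_two, eq_comm]
  rw [residueCount, this]
  by_cases h : (j 0 : ZMod p) = j 1
  · simp [h]; norm_num
  · simp [h, Finset.card_pair h]

theorem residueCount_three (j : Fin 3 → ℤ) (p : ℕ) :
    (residueCount j p : ℝ) = 3 - dvdInd p (j 0 - j 1) - dvdInd p (j 0 - j 2) - dvdInd p (j 1 - j 2)
      + dvdInd p (j 0 - j 1) * dvdInd p (j 0 - j 2) := by
  simp only [dvdInd_sub_eq_ite]
  have : (Finset.univ.image fun i => (j i : ZMod p))
      = {(j 0 : ZMod p), (j 1 : ZMod p), (j 2 : ZMod p)} := by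
    ext x; simp [Fin.exists_fin_succ, eq_comm]
  rw [residueCount, this]
  by_cases h : (j 0 : ZMod p) = j 1
  · by_cases h2 : (j 0 : ZMod p) = j 2
    · simp [← h, ← h2]; norm_num
    · have h3 : ¬ (j 1 : ZMod p) = j 2 := h ▸ h2
      simp [h, h3, Finset.card_pair h3]; norm_num
  · by_cases h2 : (j 0 : ZMod p) = j 2
    · have h3 : ¬ (j 1 : ZMod p) = j 2 := fun h3 => h (h2.trans h3.symm)
      simp [← h2, h, Ne.symm h]; norm_num
    · by_cases h3 : (j 1 : ZMod p) = j 2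
      · simp [h2, h3, Finset.card_pair h2]; norm_num
      · rw [Finset.card_eq_three.mpr ⟨_, _, _, h, h2, h3, rfl⟩]
        simp [h, h2, h3]

theorem singularFactor_one (j : Fin 1 → ℤ) {p : ℕ} (hp : p.Prime) : singularFactor j p = 1 := by
  have hp2 : (2 : ℝ) ≤ p := by exact_mod_cast hp.two_le
  have : 1 - 1 / (p : ℝ) ≠ 0 := by
    have : 1 / (p : ℝ) ≤ 1 / 2 := one_div_le_one_div_of_le (by norm_num) hp2
    linarith
  rw [singularFactor, residueCount_one]
  simp [inv_mul_cancel₀ (by simpa using this)]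

theorem singularSeries_one (j : Fin 1 → ℤ) : singularSeries j = 1 := by
  rw [singularSeries, tprod_congr fun p => singularFactor_one j p.2, tprod_one]

/-! ### The coefficients for given shifts -/

theorem factor_shiftCoeff_one (i₁ i₂ i₃ : ℤ) (j : Fin 1 → ℤ) {p : ℕ} (hp : p.Prime) :
    (shiftCoeff 1 0 0 i₁ i₂ i₃).factor p = singularFactor j p := by
  rw [singularFactor_one j hp]
  simp [CorrCoeff.factor, shiftCoeff, pairCoeff, tripleCoeff]

theorem factor_shiftCoeff_two (j : Fin 2 → ℤ) (i : ℤ) {p : ℕ} (hp : p.Prime) :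
    (shiftCoeff 1 1 0 (j 0) (j 1) i).factor p = singularFactor j p := by
  have hp2 : (2 : ℝ) ≤ p := by exact_mod_cast hp.two_le
  have h0 : (p : ℝ) ≠ 0 := by linarith
  have h1 : (p : ℝ) - 1 ≠ 0 := by linarith
  rw [singularFactor, residueCount_two, one_sub_div h0]
  simp only [CorrCoeff.factor, shiftCoeff, pairCoeff, tripleCoeff, hp, if_true]
  field_simp
  ring

theorem factor_shiftCoeff_three (j : Fin 3 → ℤ) {p : ℕ} (hp : p.Prime) :
    (shiftCoeff 1 1 1 (j 0) (j 1) (j 2)).factor p = singularFactor j p := by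
  have hp2 : (2 : ℝ) ≤ p := by exact_mod_cast hp.two_le
  have h0 : (p : ℝ) ≠ 0 := by linarith
  have h1 : (p : ℝ) - 1 ≠ 0 := by linarith
  rw [singularFactor, residueCount_three, one_sub_div h0]
  simp only [CorrCoeff.factor, shiftCoeff, pairCoeff, tripleCoeff, hp, if_true]
  field_simp
  ring

theorem pairFactor_shiftCoeff_one (i i₃ : ℤ) (j : Fin 1 → ℤ) {p : ℕ} (hp : p.Prime) :
    (shiftCoeff 1 1 0 i i i₃).pairFactor p = singularFactor j p := by
  rw [singularFactor_one j hp]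
  simp [CorrCoeff.pairFactor, shiftCoeff, pairCoeff, tripleCoeff]

theorem pairFactor_shiftCoeff_two (i₁ i₂ : ℤ) (j : Fin 2 → ℤ)
    (hj : (j 0 = i₁ ∧ j 1 = i₂) ∨ (j 0 = i₂ ∧ j 1 = i₁)) {p : ℕ} (hp : p.Prime) :
    (shiftCoeff 1 1 1 i₁ i₁ i₂).pairFactor p = singularFactor j p := by
  have hp2 : (2 : ℝ) ≤ p := by exact_mod_cast hp.two_le
  have h0 : (p : ℝ) ≠ 0 := by linarith
  have h1 : (p : ℝ) - 1 ≠ 0 := by linarith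
  have hd : dvdInd p (j 0 - j 1) = dvdInd p (i₁ - i₂) := by
    rcases hj with ⟨h, h'⟩ | ⟨h, h'⟩
    · rw [h, h']
    · rw [h, h', dvdInd_sub_comm]
  rw [singularFactor, residueCount_two, hd, one_sub_div h0]
  simp only [CorrCoeff.pairFactor, shiftCoeff, pairCoeff, tripleCoeff, hp, if_true, sub_self,
    dvdInd_zero]
  field_simp
  ring

theorem c12_shiftCoeff_eq_phiInv (s₃ : ℝ) (i i₃ : ℤ) :
    (shiftCoeff 1 1 s₃ i i i₃).c12 = phiInv := by
  funext p
  by_cases hp : p.Prime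
  · have hp2 : (2 : ℝ) ≤ p := by exact_mod_cast hp.two_le
    have h1 : (p : ℝ) - 1 ≠ 0 := by linarith
    simp only [shiftCoeff, pairCoeff, phiInv, hp, if_true, sub_self, dvdInd_zero]
    field_simp
    ring
  · simp [shiftCoeff, pairCoeff, phiInv, hp]

theorem equalShifts_shiftCoeff (i : ℤ) : (shiftCoeff 1 1 1 i i i).EqualShifts := by
  intro p hp
  have hp2 : (2 : ℝ) ≤ p := by exact_mod_cast hp.two_le
  have h1 : (p : ℝ) - 1 ≠ 0 := by linarith
  have hpair : (1 : ℝ) * 1 * ((-1 + p * 1) / ((p : ℝ) - 1) ^ 2) = 1 / ((p : ℝ) - 1) := by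
    field_simp
    ring
  simp only [shiftCoeff, pairCoeff, tripleCoeff, hp, if_true, sub_self, dvdInd_zero, hpair,
    true_and]
  field_simp
  ring

theorem abs_pairCoeff_le (i₁ i₂ : ℤ) {p : ℕ} (hp : p.Prime) :
    |pairCoeff 1 1 i₁ i₂ p| ≤ 2 / p := by
  have hp2 : (2 : ℝ) ≤ p := by exact_mod_cast hp.two_le
  rw [pairCoeff, if_pos hp, one_mul, one_mul, abs_div, abs_of_nonneg (sq_nonneg ((p : ℝ) - 1)),
    div_le_div_iff₀ (by nlinarith) (by linarith)]
  rcases dvdInd_eq_zero_or_one p (i₁ - i₂) with h | h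
  · rw [h, mul_zero, add_zero, abs_neg, abs_one]; nlinarith
  · rw [h, mul_one, abs_of_nonneg (by linarith)]; nlinarith

theorem abs_pairCoeff_le_of_not_dvd {i₁ i₂ : ℤ} {p : ℕ} (hp : p.Prime)
    (hd : ¬ (p : ℤ) ∣ i₁ - i₂) : |pairCoeff 1 1 i₁ i₂ p| ≤ 4 / (p : ℝ) ^ 2 := by
  have hp2 : (2 : ℝ) ≤ p := by exact_mod_cast hp.two_le
  rw [pairCoeff, if_pos hp, one_mul, one_mul, abs_div, abs_of_nonneg (sq_nonneg ((p : ℝ) - 1)),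
    div_le_div_iff₀ (by nlinarith) (by nlinarith), dvdInd, if_neg hd, mul_zero, add_zero, abs_neg,
    abs_one]
  nlinarith

theorem abs_tripleCoeff_le (i₁ i₂ i₃ : ℤ) {p : ℕ} (hp : p.Prime) :
    |tripleCoeff 1 1 1 i₁ i₂ i₃ p| ≤ 24 / p := by
  have hp2 : (2 : ℝ) ≤ p := by exact_mod_cast hp.two_le
  have h3 : 0 < ((p : ℝ) - 1) ^ 3 := pow_pos (by linarith) 3
  have hcube : (p : ℝ) ^ 3 ≤ 8 * ((p : ℝ) - 1) ^ 3 := by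
    calc (p : ℝ) ^ 3 ≤ (2 * ((p : ℝ) - 1)) ^ 3 := by gcongr; linarith
      _ = 8 * ((p : ℝ) - 1) ^ 3 := by ring
  have hnum : ∀ a b c : ℝ, (a = 0 ∨ a = 1) → (b = 0 ∨ b = 1) → (c = 0 ∨ c = 1) →
      |-2 + p * (a + b + c) - (p : ℝ) ^ 2 * (a * b)| ≤ 3 * (p : ℝ) ^ 2 := by
    intro a b c ha hb hc
    rcases ha with rfl | rfl <;> rcases hb with rfl | rfl <;> rcases hc with rfl | rfl <;>
      rw [abs_le] <;> constructor <;> nlinarith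
  rw [tripleCoeff, if_pos hp, one_mul, one_mul, one_mul, abs_div, abs_of_pos h3,
    div_le_div_iff₀ h3 (by linarith)]
  have := hnum _ _ _ (dvdInd_eq_zero_or_one p (i₁ - i₂)) (dvdInd_eq_zero_or_one p (i₁ - i₃))
    (dvdInd_eq_zero_or_one p (i₂ - i₃))
  calc _ ≤ 3 * (p : ℝ) ^ 2 * p := mul_le_mul_of_nonneg_right this (by linarith)
    _ = 3 * (p : ℝ) ^ 3 := by ring
    _ ≤ _ := by linarith

theorem abs_tripleCoeff_le_of_not_dvd {i₁ i₂ i₃ : ℤ} {p : ℕ} (hp : p.Prime)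
    (hd₁ : ¬ (p : ℤ) ∣ i₁ - i₃) (hd₂ : ¬ (p : ℤ) ∣ i₂ - i₃) :
    |tripleCoeff 1 1 1 i₁ i₂ i₃ p| ≤ 16 / (p : ℝ) ^ 2 := by
  have hp2 : (2 : ℝ) ≤ p := by exact_mod_cast hp.two_le
  have h3 : 0 < ((p : ℝ) - 1) ^ 3 := pow_pos (by linarith) 3
  have hcube : (p : ℝ) ^ 3 ≤ 8 * ((p : ℝ) - 1) ^ 3 := by
    calc (p : ℝ) ^ 3 ≤ (2 * ((p : ℝ) - 1)) ^ 3 := by gcongr; linarith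
      _ = 8 * ((p : ℝ) - 1) ^ 3 := by ring
  rw [tripleCoeff, if_pos hp, one_mul, one_mul, one_mul, abs_div, abs_of_pos h3,
    div_le_div_iff₀ h3 (by nlinarith)]
  have h13 : dvdInd p (i₁ - i₃) = 0 := if_neg hd₁
  have h23 : dvdInd p (i₂ - i₃) = 0 := if_neg hd₂
  rw [h13, h23]
  have hnum : |-2 + (p : ℝ) * (dvdInd p (i₁ - i₂) + 0 + 0)
      - (p : ℝ) ^ 2 * (dvdInd p (i₁ - i₂) * 0)| ≤ (p : ℝ) := by
    rcases dvdInd_eq_zero_or_one p (i₁ - i₂) with h | h <;> rw [h, abs_le] <;>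
      constructor <;> nlinarith
  calc _ ≤ (p : ℝ) * (p : ℝ) ^ 2 := mul_le_mul_of_nonneg_right hnum (by positivity)
    _ = (p : ℝ) ^ 3 := by ring
    _ ≤ _ := by linarith

theorem not_dvd_sub_of_not_dvd_natAbs {D : ℕ} {n : ℤ} (hn : n.natAbs ∣ D) {p : ℕ} (hp : ¬ p ∣ D) :
    ¬ (p : ℤ) ∣ n :=
  fun h => hp ((Int.natCast_dvd.mp h).trans hn)

theorem massBound_shiftCoeff_one (i₁ i₂ i₃ : ℤ) : (shiftCoeff 1 0 0 i₁ i₂ i₃).MassBound 40 1 := by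
  intro p hp
  have : (shiftCoeff 1 0 0 i₁ i₂ i₃).mass p = 0 := by
    simp [CorrCoeff.mass, shiftCoeff, pairCoeff, tripleCoeff]
  rw [this]
  exact ⟨by positivity, fun _ => by positivity⟩

theorem massBound_shiftCoeff_two (i₁ i₂ i₃ : ℤ) :
    (shiftCoeff 1 1 0 i₁ i₂ i₃).MassBound 40 (i₁ - i₂).natAbs := by
  intro p hp
  have : (shiftCoeff 1 1 0 i₁ i₂ i₃).mass p = |pairCoeff 1 1 i₁ i₂ p| := by
    simp [CorrCoeff.mass, shiftCoeff, pairCoeff, tripleCoeff]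
  rw [this]
  refine ⟨(abs_pairCoeff_le i₁ i₂ hp).trans (by gcongr; norm_num), fun hd => ?_⟩
  exact (abs_pairCoeff_le_of_not_dvd hp (not_dvd_sub_of_not_dvd_natAbs dvd_rfl hd)).trans
    (by gcongr; norm_num)

theorem massBound_shiftCoeff_three (i₁ i₂ i₃ : ℤ) :
    (shiftCoeff 1 1 1 i₁ i₂ i₃).MassBound 40
      ((i₁ - i₂).natAbs * (i₁ - i₃).natAbs * (i₂ - i₃).natAbs) := by
  intro p hp
  have hp0 : (0 : ℝ) < p := by exact_mod_cast hp.pos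
  have e : (shiftCoeff 1 1 1 i₁ i₂ i₃).mass p = |pairCoeff 1 1 i₁ i₂ p| + |pairCoeff 1 1 i₁ i₃ p|
      + |pairCoeff 1 1 i₂ i₃ p| + |tripleCoeff 1 1 1 i₁ i₂ i₃ p| := rfl
  rw [e]
  refine ⟨?_, fun hd => ?_⟩
  · calc _ ≤ 2 / (p : ℝ) + 2 / p + 2 / p + 24 / p := by
          gcongr <;> first | exact abs_pairCoeff_le _ _ hp | exact abs_tripleCoeff_le _ _ _ hp
      _ = 30 / p := by ring
      _ ≤ 40 / p := by gcongr; norm_num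
  · have h12 := not_dvd_sub_of_not_dvd_natAbs
      (D := (i₁ - i₂).natAbs * (i₁ - i₃).natAbs * (i₂ - i₃).natAbs) (n := i₁ - i₂)
      ((dvd_mul_right _ _).mul_right _) hd
    have h13 := not_dvd_sub_of_not_dvd_natAbs
      (D := (i₁ - i₂).natAbs * (i₁ - i₃).natAbs * (i₂ - i₃).natAbs) (n := i₁ - i₃)
      ((dvd_mul_left _ _).mul_right _) hd
    have h23 := not_dvd_sub_of_not_dvd_natAbs
      (D := (i₁ - i₂).natAbs * (i₁ - i₃).natAbs * (i₂ - i₃).natAbs) (n := i₂ - i₃)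
      (dvd_mul_left _ _) hd
    calc _ ≤ 4 / (p : ℝ) ^ 2 + 4 / (p : ℝ) ^ 2 + 4 / (p : ℝ) ^ 2 + 16 / (p : ℝ) ^ 2 := by
          gcongr
          · exact abs_pairCoeff_le_of_not_dvd hp h12
          · exact abs_pairCoeff_le_of_not_dvd hp h13
          · exact abs_pairCoeff_le_of_not_dvd hp h23
          · exact abs_tripleCoeff_le_of_not_dvd hp h13 h23
      _ = 28 / (p : ℝ) ^ 2 := by ring
      _ ≤ 40 / (p : ℝ) ^ 2 := by gcongr; norm_num

theorem abs_coeff_shiftCoeff_repeated_eq_zero (i i₃ : ℤ) {p : ℕ} :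
    |(shiftCoeff 1 1 0 i i i₃).c13 p| + |(shiftCoeff 1 1 0 i i i₃).c23 p|
      + |(shiftCoeff 1 1 0 i i i₃).c123 p| = 0 := by
  simp [shiftCoeff, pairCoeff, tripleCoeff]

theorem abs_coeff_shiftCoeff_repeated_le (i i₃ : ℤ) {p : ℕ} (hp : p.Prime) :
    |(shiftCoeff 1 1 1 i i i₃).c13 p| + |(shiftCoeff 1 1 1 i i i₃).c23 p|
        + |(shiftCoeff 1 1 1 i i i₃).c123 p| ≤ 40 / p ∧
      (¬ p ∣ (i - i₃).natAbs → |(shiftCoeff 1 1 1 i i i₃).c13 p|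
        + |(shiftCoeff 1 1 1 i i i₃).c23 p| + |(shiftCoeff 1 1 1 i i i₃).c123 p|
          ≤ 40 / (p : ℝ) ^ 2) := by
  have hp0 : (0 : ℝ) < p := by exact_mod_cast hp.pos
  have e : |(shiftCoeff 1 1 1 i i i₃).c13 p| + |(shiftCoeff 1 1 1 i i i₃).c23 p|
      + |(shiftCoeff 1 1 1 i i i₃).c123 p| = |pairCoeff 1 1 i i₃ p| + |pairCoeff 1 1 i i₃ p|
      + |tripleCoeff 1 1 1 i i i₃ p| := rfl
  rw [e]
  refine ⟨?_, fun hd => ?_⟩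
  · calc _ ≤ 2 / (p : ℝ) + 2 / p + 24 / p := by
          gcongr <;> first | exact abs_pairCoeff_le _ _ hp | exact abs_tripleCoeff_le _ _ _ hp
      _ = 28 / p := by ring
      _ ≤ 40 / p := by gcongr; norm_num
  · have h := not_dvd_sub_of_not_dvd_natAbs dvd_rfl hd
    calc _ ≤ 4 / (p : ℝ) ^ 2 + 4 / (p : ℝ) ^ 2 + 16 / (p : ℝ) ^ 2 := by
          gcongr
          · exact abs_pairCoeff_le_of_not_dvd hp h
          · exact abs_pairCoeff_le_of_not_dvd hp h
          · exact abs_tripleCoeff_le_of_not_dvd hp h h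
      _ = 24 / (p : ℝ) ^ 2 := by ring
      _ ≤ 40 / (p : ℝ) ^ 2 := by gcongr; norm_num

/-! ### Removal of the vanishing terms -/

/-- The products `∏_i λ_R(m + j_i)^{a_i}` have mean value `T` on intervals on which all arguments
are positive, with error at most `E`. -/
def HasLambdaMean (R E : ℝ) {r : ℕ} (j : Fin r → ℤ) (a : Fin r → ℕ) (T : ℝ) : Prop :=
  ∀ M : ℤ, (∀ i, 0 ≤ M + j i) → ∀ n : ℕ,
    |∑ m ∈ Finset.Ioc M (M + n), ∏ i, lambdaR R (m + j i) ^ a i - n * T| ≤ E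

theorem HasLambdaMean.abs_correlation_sub_le {R E : ℝ} {r : ℕ} {j : Fin r → ℤ} {a : Fin r → ℕ}
    {T : ℝ} (h : HasLambdaMean R E j a T) (ha : ∀ i, 1 ≤ a i) {N : ℕ} {J : ℝ} (hJ0 : 0 ≤ J)
    (hJN : J ≤ N) (hj : ∀ i, |(j i : ℝ)| ≤ J) :
    |correlation N R j a - N * T| ≤ J * |T| + E := by
  -- All arguments are positive for `n > M`, and one of them is not for `n ≤ M`.
  set M : ℕ := Finset.univ.sup fun i => (-(j i)).toNat with hM
  have hMJ : (M : ℝ) ≤ J := by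
    refine (Nat.le_floor_iff hJ0).mp (Finset.sup_le fun i _ => Nat.le_floor ?_)
    have h1 : ((((-(j i)).toNat : ℕ) : ℤ) : ℝ) ≤ J := by
      rw [Int.toNat_eq_max]
      push_cast
      exact max_le ((neg_le_abs _).trans (hj i)) hJ0
    exact_mod_cast h1
  have hMN : M ≤ N := by exact_mod_cast hMJ.trans hJN
  have hM1 : ∀ i, 0 ≤ (M : ℤ) + j i := by
    intro i
    have h1 : (-(j i)).toNat ≤ M :=
      Finset.le_sup (f := fun i => (-(j i)).toNat) (Finset.mem_univ i)
    omega
  have hsum : correlation N R j a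
      = ∑ m ∈ Finset.Ioc (M : ℤ) (M + ((N - M : ℕ) : ℤ)), ∏ i, lambdaR R (m + j i) ^ a i := by
    have h1 : correlation N R j a
        = ∑ n ∈ Finset.Ioc M N, ∏ i, lambdaR R ((n : ℤ) + j i) ^ a i := by
      rw [correlation]
      refine (Finset.sum_subset (fun n hn => ?_) fun n hn hn' => ?_).symm
      · simp only [Finset.mem_Ioc, Finset.mem_Icc] at hn ⊢
        omega
      · simp only [Finset.mem_Ioc, Finset.mem_Icc, not_and_or] at hn hn'
        have h2 : n - 1 < Finset.univ.sup fun i => (-(j i)).toNat := by omega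
        obtain ⟨i, -, hi⟩ := (Finset.lt_sup_iff).mp h2
        refine Finset.prod_eq_zero (Finset.mem_univ i) ?_
        rw [lambdaR, if_pos (by omega), zero_pow (by have := ha i; omega)]
    rw [h1]
    refine Finset.sum_nbij (fun n : ℕ => (n : ℤ)) (fun n hn => ?_) (fun _ _ _ _ h => by simpa using h)
      (fun m hm => ?_) fun _ _ => rfl
    · simp only [Finset.mem_Ioc] at hn ⊢
      omega
    · simp only [Finset.coe_Ioc, Set.mem_Ioc, Set.mem_image] at hm ⊢
      exact ⟨m.toNat, by omega, by omega⟩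
  have hmain := h M hM1 (N - M)
  rw [← hsum, Nat.cast_sub hMN] at hmain
  have e : correlation N R j a - N * T
      = (correlation N R j a - ((N : ℝ) - M) * T) + -(M * T) := by ring
  rw [e]
  refine (abs_add_le _ _).trans ?_
  rw [abs_neg, abs_mul (M : ℝ), abs_of_nonneg (Nat.cast_nonneg M : (0 : ℝ) ≤ M)]
  have := mul_le_mul_of_nonneg_right hMJ (abs_nonneg T)
  linarith

/-! ### Powers and logarithms of comparable size -/

/-- If `R` exceeds a fixed power of `N`, the error terms of the mean values, in which the shifts enter
through an integer of size at most `8 N³`, are eventually negligible. -/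
theorem exists_size_bounds {ε c η B θ : ℝ} (hε : 0 < ε) (hc : 0 < c) (hη : 0 < η) (hB : 0 ≤ B)
    (hθ : θ = ε / 24) : ∃ N₀ : ℕ, ∀ N : ℕ, N₀ ≤ N → 1 ≤ N ∧ ∀ R : ℝ, c * (N : ℝ) ^ ε ≤ R →
      1 ≤ R ∧ B * (8 * (N : ℝ) ^ 3) ^ θ ≤ (N : ℝ) ^ (ε / 2) ∧
      B * (8 * (N : ℝ) ^ 3) ^ θ * (3 / √R) ≤ η ∧
      B * √(1 + Real.log (8 * (N : ℝ) ^ 3)) ≤ η * Real.log R ∧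
      B * (1 + Real.log R) ≤ η * Real.log R ^ 2 := by
  have h1 : ∀ᶠ N : ℕ in Filter.atTop, 1 ≤ N := Filter.eventually_ge_atTop 1
  have hlog : Filter.Tendsto (fun N : ℕ => Real.log N) Filter.atTop Filter.atTop :=
    Real.tendsto_log_atTop.comp tendsto_natCast_atTop_atTop
  have hpow : Filter.Tendsto (fun N : ℕ => (N : ℝ) ^ (3 * ε / 8)) Filter.atTop Filter.atTop :=
    (tendsto_rpow_atTop (by positivity)).comp tendsto_natCast_atTop_atTop
  obtain ⟨N₀, hN₀⟩ := Filter.eventually_atTop.mp ((((((h1.and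
    (hlog.eventually_ge_atTop 1)).and (hlog.eventually_ge_atTop (-Real.log c * 2 / ε))).and
    (hlog.eventually_ge_atTop (44 * B ^ 2 / (η ^ 2 * ε ^ 2)))).and
    (hlog.eventually_ge_atTop ((1 + 2 * B / η) * 2 / ε))).and
    (hpow.eventually_ge_atTop (B * 8 ^ θ))).and
    (hpow.eventually_ge_atTop (3 * (B * 8 ^ θ) / (η * √c))))
  refine ⟨N₀, fun N hN => ?_⟩
  obtain ⟨⟨⟨⟨⟨⟨hN1, hL1⟩, hLc⟩, hLB⟩, hLd⟩, hpa⟩, hpb⟩ := hN₀ N hN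
  refine ⟨hN1, fun R hR => ?_⟩
  have hN0 : (0 : ℝ) < N := by exact_mod_cast hN1
  set L := Real.log N with hL
  have hcN : 0 < c * (N : ℝ) ^ ε := by positivity
  have hR0 : 0 < R := hcN.trans_le hR
  have hlogR : ε / 2 * L ≤ Real.log R := by
    have h2 : Real.log c + ε * L ≤ Real.log R := by
      rw [hL, ← Real.log_rpow hN0, ← Real.log_mul hc.ne' (by positivity)]
      exact Real.log_le_log hcN hR
    rw [div_le_iff₀ hε] at hLc
    linarith
  have hd : 1 + 2 * B / η ≤ Real.log R := by
    rw [div_le_iff₀ hε] at hLd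
    linarith
  have hBη : 0 ≤ 2 * B / η := by positivity
  have hlR1 : 1 ≤ Real.log R := by linarith
  have hR1 : 1 ≤ R := by
    by_contra hlt
    have := Real.log_nonpos hR0.le (not_le.mp hlt).le
    linarith
  have hsplit : (8 * (N : ℝ) ^ 3) ^ θ = 8 ^ θ * (N : ℝ) ^ (ε / 8) := by
    rw [Real.mul_rpow (by norm_num) (by positivity), ← Real.rpow_natCast, ← Real.rpow_mul hN0.le,
      hθ]
    congr 2
    push_cast
    ring
  have hhalf : (N : ℝ) ^ (3 * ε / 8) * (N : ℝ) ^ (ε / 8) = (N : ℝ) ^ (ε / 2) := by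
    rw [← Real.rpow_add hN0]
    congr 1
    ring
  refine ⟨hR1, ?_, ?_, ?_, ?_⟩
  · rw [hsplit, ← mul_assoc, ← hhalf]
    gcongr
  · have hsq : √c * (N : ℝ) ^ (ε / 2) ≤ √R := by
      rw [show (N : ℝ) ^ (ε / 2) = √((N : ℝ) ^ ε) by
        rw [Real.sqrt_eq_rpow, ← Real.rpow_mul hN0.le]
        congr 1
        ring, ← Real.sqrt_mul hc.le]
      exact Real.sqrt_le_sqrt hR
    have hsc : 0 < √c := Real.sqrt_pos.mpr hc
    rw [div_le_iff₀ (by positivity)] at hpb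
    rw [mul_div_assoc', div_le_iff₀ (Real.sqrt_pos.mpr hR0), hsplit]
    calc B * (8 ^ θ * (N : ℝ) ^ (ε / 8)) * 3 = 3 * (B * 8 ^ θ) * (N : ℝ) ^ (ε / 8) := by ring
      _ ≤ ((N : ℝ) ^ (3 * ε / 8) * (η * √c)) * (N : ℝ) ^ (ε / 8) := by gcongr
      _ = η * (√c * ((N : ℝ) ^ (3 * ε / 8) * (N : ℝ) ^ (ε / 8))) := by ring
      _ ≤ η * √R := by rw [hhalf]; gcongr
  · have hlog8 : Real.log (8 * (N : ℝ) ^ 3) ≤ 7 + 3 * L := by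
      rw [Real.log_mul (by norm_num) (by positivity), Real.log_pow]
      have := Real.log_le_sub_one_of_pos (show (0 : ℝ) < 8 by norm_num)
      push_cast
      linarith
    rw [div_le_iff₀ (by positivity)] at hLB
    have h2 : B * √(1 + Real.log (8 * (N : ℝ) ^ 3)) ≤ η * (ε / 2 * L) := by
      refine abs_le_of_sq_le_sq' ?_ (by positivity) |>.2
      rw [mul_pow, Real.sq_sqrt (add_nonneg zero_le_one (Real.log_nonneg (by
        have : (1 : ℝ) ≤ (N : ℝ) ^ 3 := one_le_pow₀ (by exact_mod_cast hN1)
        linarith)))]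
      calc B ^ 2 * (1 + Real.log (8 * (N : ℝ) ^ 3)) ≤ B ^ 2 * (11 * L) := by
            gcongr
            linarith
        _ = 44 * B ^ 2 * (L / 4) := by ring
        _ ≤ L * (η ^ 2 * ε ^ 2) * (L / 4) := by gcongr
        _ = (η * (ε / 2 * L)) ^ 2 := by ring
    exact h2.trans (by gcongr)
  · have h2 : 2 * B / η ≤ Real.log R := by linarith
    rw [div_le_iff₀ hη] at h2
    calc B * (1 + Real.log R) ≤ B * (Real.log R + Real.log R) := by gcongr
      _ = 2 * B * Real.log R := by ring
      _ ≤ Real.log R * η * Real.log R := by gcongr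
      _ = η * Real.log R ^ 2 := by ring

/-! ### The mean values of the correlations -/

theorem natAbs_sub_le {i₁ i₂ : ℤ} {N : ℕ} (h₁ : |(i₁ : ℝ)| ≤ N) (h₂ : |(i₂ : ℝ)| ≤ N) :
    ((i₁ - i₂).natAbs : ℝ) ≤ 2 * N := by
  rw [Nat.cast_natAbs]
  push_cast
  exact (abs_sub _ _).trans (by linarith)

theorem two_mul_le_eight_mul_cube {N : ℕ} (hN : 1 ≤ N) : 2 * (N : ℝ) ≤ 8 * (N : ℝ) ^ 3 := by
  have h1 : (1 : ℝ) ≤ N := by exact_mod_cast hN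
  have : (N : ℝ) ^ 1 ≤ (N : ℝ) ^ 3 := pow_le_pow_right₀ h1 (by norm_num)
  linarith [pow_one (N : ℝ)]

theorem eq_vecCons_one (a : Fin 1 → ℕ) : a = ![a 0] := by
  funext i
  fin_cases i
  rfl

/-- The mean value in all the cases of the theorem, together with the bound for the singular series
that absorbs the shortening of the range of summation. -/
theorem exists_hasLambdaMean : ∃ K : ℝ, 1 ≤ K ∧ ∀ ε : ℝ, 0 < ε → ∀ c : ℝ, 0 < c → ∀ η : ℝ, 0 < η →
    ∃ N₀ : ℕ, ∀ N : ℕ, N₀ ≤ N → 1 ≤ N ∧ ∀ R : ℝ, c * (N : ℝ) ^ ε ≤ R → 1 ≤ R ∧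
      ∀ (k r : ℕ) (j : Fin r → ℤ) (a : Fin r → ℕ), 1 ≤ k → k ≤ 3 → Function.Injective j →
        (∀ i, 1 ≤ a i) → ∑ i, a i = k → (∀ i, |(j i : ℝ)| ≤ N) →
        |corrConst (List.ofFn a)| ≤ 1 ∧ |singularSeries j| ≤ (N : ℝ) ^ (ε / 2) ∧
        ∃ T : ℝ, HasLambdaMean R ((K * R) ^ k) j a T ∧
          |T - corrConst (List.ofFn a) * singularSeries j * Real.log R ^ (k - r)|
            ≤ η * Real.log R ^ (k - r) := by
  obtain ⟨K, hK1, hK⟩ := exists_abs_sum_activeLambda_sub_le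
  refine ⟨K, hK1, fun ε hε c hc η hη => ?_⟩
  obtain ⟨B₁, hB1, hdist⟩ := exists_abs_corrIter_sub_singularSeries_le (K := 40) (η := ε / 24)
    (by norm_num) (by positivity)
  obtain ⟨B₂, hB2, hpair⟩ := exists_abs_corrIter_sub_singularSeries_mul_log_le (K := 40)
    (by norm_num)
  obtain ⟨B₃, hB3, htriple⟩ := exists_abs_corrIter_equalShifts_sub_le
  obtain ⟨N₀, hN₀⟩ := exists_size_bounds (B := B₁ + B₂ + B₃) hε hc hη (by linarith)
    (rfl : ε / 24 = ε / 24)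
  refine ⟨N₀, fun N hN => ?_⟩
  obtain ⟨hN1, hN₀⟩ := hN₀ N hN
  refine ⟨hN1, fun R hR => ?_⟩
  obtain ⟨hR1, hsa, hsb, hsc, hsd⟩ := hN₀ R hR
  refine ⟨hR1, fun k r j a hk1 hk3 hj ha hak hjN => ?_⟩
  have hNr : (1 : ℝ) ≤ N := by exact_mod_cast hN1
  have hlR := Real.log_nonneg hR1
  have hZ : R < ((⌊R⌋₊ + 1 : ℕ) : ℝ) := by exact_mod_cast Nat.lt_floor_add_one R
  have hne : ∀ i l, i ≠ l → 0 < (j i - j l).natAbs := fun i l hil =>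
    Int.natAbs_pos.mpr (sub_ne_zero.mpr fun h => hil (hj h))
  -- The bounds in terms of `D` in terms of `N`.
  have hpow : ∀ D : ℕ, (D : ℝ) ≤ 8 * (N : ℝ) ^ 3 →
      B₁ * (D : ℝ) ^ (ε / 24) ≤ (N : ℝ) ^ (ε / 2) ∧ B₁ * (D : ℝ) ^ (ε / 24) * (3 / √R) ≤ η := by
    intro D hD
    have h1 : B₁ * (D : ℝ) ^ (ε / 24) ≤ (B₁ + B₂ + B₃) * (8 * (N : ℝ) ^ 3) ^ (ε / 24) := by
      gcongr
      linarith
    exact ⟨h1.trans hsa, le_trans (by gcongr) hsb⟩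
  have hsqrt : ∀ D : ℕ, 0 < D → (D : ℝ) ≤ 8 * (N : ℝ) ^ 3 →
      B₂ * √(1 + Real.log D) ≤ η * Real.log R := by
    intro D hD0 hD
    refine le_trans ?_ hsc
    have : Real.log D ≤ Real.log (8 * (N : ℝ) ^ 3) :=
      Real.log_le_log (by exact_mod_cast hD0) hD
    gcongr
    linarith
  have hone : ((1 : ℕ) : ℝ) ≤ 8 * (N : ℝ) ^ 3 := by
    have := two_mul_le_eight_mul_cube hN1
    push_cast
    linarith
  have hr3 : r ≤ 3 := by
    have : ∑ _i : Fin r, 1 ≤ ∑ i, a i := Finset.sum_le_sum fun i _ => ha i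
    simp at this
    omega
  have hr0 : r ≠ 0 := by
    rintro rfl
    simp at hak
    omega
  have hr : r = 1 ∨ r = 2 ∨ r = 3 := by omega
  -- The shift of an inactive factor is immaterial and is chosen among the others.
  rcases hr with rfl | rfl | rfl
  · have hS := singularSeries_one j
    have hSN : |singularSeries j| ≤ (N : ℝ) ^ (ε / 2) := by
      rw [hS, abs_one]
      exact Real.one_le_rpow hNr (by positivity)
    rw [Fin.sum_univ_one] at hak
    have hcase : a = ![1] ∧ k = 1 ∨ a = ![2] ∧ k = 2 ∨ a = ![3] ∧ k = 3 := by
      rw [eq_vecCons_one a, ← hak]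
      have : a 0 = 1 ∨ a 0 = 2 ∨ a 0 = 3 := by omega
      rcases this with h | h | h <;> simp [h]
    rcases hcase with ⟨rfl, rfl⟩ | ⟨rfl, rfl⟩ | ⟨rfl, rfl⟩
    · refine ⟨by simp [corrConst], hSN,
      corrIter (shiftCoeff 1 0 0 (j 0) (j 0) (j 0)) (⌊R⌋₊ + 1) geOne₃ R R R, fun M hM n => ?_, ?_⟩
      rotate_left
      · have := (hdist _ 1 (shiftCoeff_onPrimes 1 0 0 (j 0) (j 0) (j 0)) one_pos
          (massBound_shiftCoeff_one _ _ _) 1 j hj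
          fun p hp => factor_shiftCoeff_one _ _ _ j hp).2 R hR1 _ hZ
        simpa [corrConst] using this.trans (hpow 1 hone).2
      · have := hK true false false (j 0) (j 0) (j 0) R hR1 _ hZ M (hM 0) (hM 0) (hM 0) n
        simpa [activeLambda, act] using this
    · refine ⟨by simp [corrConst], hSN,
      corrIter (shiftCoeff 1 1 0 (j 0) (j 0) (j 0)) (⌊R⌋₊ + 1) geOne₃ R R R, fun M hM n => ?_, ?_⟩
      rotate_left
      · have := hpair _ 1 (shiftCoeff_onPrimes 1 1 0 (j 0) (j 0) (j 0))
          (c12_shiftCoeff_eq_phiInv 0 _ _) one_pos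
          (fun p _ => by
            rw [abs_coeff_shiftCoeff_repeated_eq_zero]
            exact ⟨by positivity, fun _ => by positivity⟩) 1 j hj
          (fun p hp => pairFactor_shiftCoeff_one _ _ j hp) R hR1 _ hZ
        simpa [corrConst] using this.trans (hsqrt 1 one_pos hone)
      · have := hK true true false (j 0) (j 0) (j 0) R hR1 _ hZ M (hM 0) (hM 0) (hM 0) n
        simpa [activeLambda, act, pow_two] using this
    · refine ⟨by simp [corrConst]; rw [abs_of_pos] <;> norm_num, hSN,
      corrIter (shiftCoeff 1 1 1 (j 0) (j 0) (j 0)) (⌊R⌋₊ + 1) geOne₃ R R R, fun M hM n => ?_, ?_⟩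
      rotate_left
      · have := htriple _ (shiftCoeff_onPrimes 1 1 1 (j 0) (j 0) (j 0))
          (equalShifts_shiftCoeff _) R hR1 _ hZ
        have h2 : B₃ * (1 + Real.log R) ≤ η * Real.log R ^ 2 :=
          le_trans (by gcongr; linarith) hsd
        simpa [corrConst, hS] using this.trans h2
      · have := hK true true true (j 0) (j 0) (j 0) R hR1 _ hZ M (hM 0) (hM 0) (hM 0) n
        simpa [activeLambda, act, pow_three', mul_assoc] using this
  · have hD0 := hne 0 1 (by decide)
    have hD : ((j 0 - j 1).natAbs : ℝ) ≤ 8 * (N : ℝ) ^ 3 :=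
      (natAbs_sub_le (hjN 0) (hjN 1)).trans (two_mul_le_eight_mul_cube hN1)
    -- For `r = 2` the bound for `𝔖(j)` comes from the mean value with `a = (1, 1)`, whatever `a` is.
    have hS := hdist _ _ (shiftCoeff_onPrimes 1 1 0 (j 0) (j 1) (j 0)) hD0
      (massBound_shiftCoeff_two _ _ _) 2 j hj fun p hp => factor_shiftCoeff_two j _ hp
    have hSN : |singularSeries j| ≤ (N : ℝ) ^ (ε / 2) := hS.1.trans (hpow _ hD).1
    rw [Fin.sum_univ_two] at hak
    have h0 := ha 0
    have h1 := ha 1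
    have hcase : a = ![1, 1] ∧ k = 2 ∨ a = ![2, 1] ∧ k = 3 ∨ a = ![1, 2] ∧ k = 3 := by
      have e : a = ![a 0, a 1] := by funext i; fin_cases i <;> rfl
      rw [e, ← hak]
      have : a 0 = 1 ∧ a 1 = 1 ∨ a 0 = 2 ∧ a 1 = 1 ∨ a 0 = 1 ∧ a 1 = 2 := by omega
      rcases this with ⟨h, h'⟩ | ⟨h, h'⟩ | ⟨h, h'⟩ <;> simp [h, h']
    rcases hcase with ⟨rfl, rfl⟩ | ⟨rfl, rfl⟩ | ⟨rfl, rfl⟩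
    · refine ⟨by simp [corrConst], hSN,
      corrIter (shiftCoeff 1 1 0 (j 0) (j 1) (j 0)) (⌊R⌋₊ + 1) geOne₃ R R R, fun M hM n => ?_, ?_⟩
      rotate_left
      · simpa [corrConst] using (hS.2 R hR1 _ hZ).trans (hpow _ hD).2
      · have := hK true true false (j 0) (j 1) (j 0) R hR1 _ hZ M (hM 0) (hM 1) (hM 0) n
        simpa [activeLambda, act, pow_two] using this
    · refine ⟨by simp [corrConst], hSN,
      corrIter (shiftCoeff 1 1 1 (j 0) (j 0) (j 1)) (⌊R⌋₊ + 1) geOne₃ R R R, fun M hM n => ?_, ?_⟩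
      rotate_left
      · have := hpair _ _ (shiftCoeff_onPrimes 1 1 1 (j 0) (j 0) (j 1))
          (c12_shiftCoeff_eq_phiInv 1 _ _) hD0
          (fun p hp => abs_coeff_shiftCoeff_repeated_le _ _ hp) 2 j hj
          (fun p hp => pairFactor_shiftCoeff_two _ _ j (Or.inl ⟨rfl, rfl⟩) hp) R hR1 _ hZ
        simpa [corrConst] using this.trans (hsqrt _ hD0 hD)
      · have := hK true true true (j 0) (j 0) (j 1) R hR1 _ hZ M (hM 0) (hM 0) (hM 1) n
        simpa [activeLambda, act, pow_two, pow_three', mul_assoc] using this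
    · refine ⟨by simp [corrConst], hSN,
      corrIter (shiftCoeff 1 1 1 (j 1) (j 1) (j 0)) (⌊R⌋₊ + 1) geOne₃ R R R, fun M hM n => ?_, ?_⟩
      rotate_left
      · have := hpair _ _ (shiftCoeff_onPrimes 1 1 1 (j 1) (j 1) (j 0))
          (c12_shiftCoeff_eq_phiInv 1 _ _) (hne 1 0 (by decide))
          (fun p hp => abs_coeff_shiftCoeff_repeated_le _ _ hp) 2 j hj
          (fun p hp => pairFactor_shiftCoeff_two _ _ j (Or.inr ⟨rfl, rfl⟩) hp) R hR1 _ hZ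
        rw [← Int.natAbs_neg, neg_sub] at this
        simpa [corrConst] using this.trans (hsqrt _ hD0 hD)
      · have := hK true true true (j 1) (j 1) (j 0) R hR1 _ hZ M (hM 1) (hM 1) (hM 0) n
        simpa [activeLambda, act, pow_two, pow_three', mul_assoc, mul_comm, mul_left_comm]
          using this
  · rw [Fin.sum_univ_three] at hak
    have h0 := ha 0
    have h1 := ha 1
    have h2 := ha 2
    obtain ⟨rfl, rfl⟩ : a = ![1, 1, 1] ∧ k = 3 := by
      refine ⟨?_, by omega⟩
      funext i
      fin_cases i <;> simp <;> omega
    have hD : (((j 0 - j 1).natAbs * (j 0 - j 2).natAbs * (j 1 - j 2).natAbs : ℕ) : ℝ)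
        ≤ 8 * (N : ℝ) ^ 3 := by
      push_cast
      calc _ ≤ (2 * (N : ℝ)) * (2 * N) * (2 * N) := by
            have := natAbs_sub_le (hjN 0) (hjN 1)
            have := natAbs_sub_le (hjN 0) (hjN 2)
            have := natAbs_sub_le (hjN 1) (hjN 2)
            push_cast at *
            gcongr
        _ = _ := by ring
    have hD0 := Nat.mul_pos (Nat.mul_pos (hne 0 1 (by decide)) (hne 0 2 (by decide)))
      (hne 1 2 (by decide))
    have hS := hdist _ _ (shiftCoeff_onPrimes 1 1 1 (j 0) (j 1) (j 2)) hD0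
      (massBound_shiftCoeff_three _ _ _) 3 j hj fun p hp => factor_shiftCoeff_three j hp
    refine ⟨by simp [corrConst], hS.1.trans (hpow _ hD).1,
      corrIter (shiftCoeff 1 1 1 (j 0) (j 1) (j 2)) (⌊R⌋₊ + 1) geOne₃ R R R, fun M hM n => ?_, ?_⟩
    rotate_left
    · simpa [corrConst] using (hS.2 R hR1 _ hZ).trans (hpow _ hD).2
    · have := hK true true true (j 0) (j 1) (j 2) R hR1 _ hZ M (hM 0) (hM 1) (hM 2) n
      simpa [activeLambda, act, pow_three', mul_assoc, Fin.prod_univ_three] using this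

theorem theorem1 (k : ℕ) (hk1 : 1 ≤ k) (hk3 : k ≤ 3) (ε : ℝ) (hε : 0 < ε) :
    ∃ K : ℝ, ∀ c : ℝ, 0 < c → ∀ η : ℝ, 0 < η → ∃ N₀ : ℕ, ∀ N : ℕ, N₀ ≤ N →
      ∀ R : ℝ, c * (N : ℝ) ^ ε ≤ R →
      ∀ (r : ℕ) (j : Fin r → ℤ) (a : Fin r → ℕ), Function.Injective j →
        (∀ i, 1 ≤ a i) → ∑ i, a i = k → (∀ i, |(j i : ℝ)| ≤ (N : ℝ) ^ (1 - ε)) →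
        |correlation N R j a
            - corrConst (List.ofFn a) * singularSeries j * ((N : ℝ) * Real.log R ^ (k - r))|
          ≤ η * ((N : ℝ) * Real.log R ^ (k - r)) + K * R ^ k := by
  obtain ⟨K, hK1, hmean⟩ := exists_hasLambdaMean
  refine ⟨K ^ k, fun c hc η hη => ?_⟩
  obtain ⟨N₁, hN₁⟩ := hmean ε hε c hc (η / 3) (by positivity)
  -- `N₂` makes the shortening of the range, of relative size `N ^ (-ε / 2)`, negligible.
  have hsmall : Filter.Tendsto (fun N : ℕ => (N : ℝ) ^ (-(ε / 2))) Filter.atTop (nhds 0) :=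
    (tendsto_rpow_neg_atTop (by positivity)).comp tendsto_natCast_atTop_atTop
  obtain ⟨N₂, hN₂⟩ := Filter.eventually_atTop.mp
    (hsmall.eventually_le_const (show (0 : ℝ) < η / 3 by positivity))
  refine ⟨max N₁ N₂, fun N hN R hR r j a hj ha hak hjN => ?_⟩
  obtain ⟨hN1, hN₁⟩ := hN₁ N (le_of_max_le_left hN)
  obtain ⟨hR1, hN₁⟩ := hN₁ R hR
  have hNr : (1 : ℝ) ≤ N := by exact_mod_cast hN1
  have hN0 : (0 : ℝ) < N := by linarith
  have hJN : (N : ℝ) ^ (1 - ε) ≤ N := by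
    calc (N : ℝ) ^ (1 - ε) ≤ (N : ℝ) ^ (1 : ℝ) :=
          Real.rpow_le_rpow_of_exponent_le hNr (by linarith)
      _ = N := Real.rpow_one _
  obtain ⟨hC, hS, T, hT, hTS⟩ := hN₁ k r j a hk1 hk3 hj ha hak fun i => (hjN i).trans hJN
  have hcorr := hT.abs_correlation_sub_le ha (by positivity) hJN hjN
  have hL : 0 ≤ Real.log R ^ (k - r) := pow_nonneg (Real.log_nonneg hR1) _
  set L := Real.log R ^ (k - r)
  set C := corrConst (List.ofFn a)
  set S := singularSeries j
  set J := (N : ℝ) ^ (1 - ε) with hJ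
  have hJ0 : 0 ≤ J := by positivity
  have hTabs : |T| ≤ (N : ℝ) ^ (ε / 2) * L + η / 3 * L := by
    have h1 : |C * S * L| ≤ (N : ℝ) ^ (ε / 2) * L := by
      rw [abs_mul, abs_mul, abs_of_nonneg hL]
      have : |C| * |S| ≤ 1 * (N : ℝ) ^ (ε / 2) := by gcongr
      rw [one_mul] at this
      gcongr
    calc |T| = |C * S * L + (T - C * S * L)| := by congr 1; ring
      _ ≤ _ := (abs_add_le _ _).trans (add_le_add h1 hTS)
  have hJpow : J * (N : ℝ) ^ (ε / 2) ≤ N * (η / 3) := by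
    have e : J * (N : ℝ) ^ (ε / 2) = N * (N : ℝ) ^ (-(ε / 2)) := by
      rw [hJ, ← Real.rpow_add hN0]
      nth_rewrite 2 [← Real.rpow_one (N : ℝ)]
      rw [← Real.rpow_add hN0]
      congr 1
      ring
    rw [e]
    exact mul_le_mul_of_nonneg_left (hN₂ N (le_of_max_le_right hN)) hN0.le
  have hJT : J * |T| ≤ 2 * (η / 3) * (N * L) := by
    calc J * |T| ≤ J * ((N : ℝ) ^ (ε / 2) * L + η / 3 * L) := by gcongr
      _ = J * (N : ℝ) ^ (ε / 2) * L + J * (η / 3 * L) := by ring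
      _ ≤ N * (η / 3) * L + N * (η / 3 * L) := by gcongr
      _ = 2 * (η / 3) * (N * L) := by ring
  have hNT : |(N : ℝ) * T - C * S * (N * L)| ≤ η / 3 * (N * L) := by
    have e : (N : ℝ) * T - C * S * (N * L) = N * (T - C * S * L) := by ring
    rw [e, abs_mul, abs_of_pos hN0]
    calc (N : ℝ) * |T - C * S * L| ≤ N * (η / 3 * L) := by gcongr
      _ = η / 3 * (N * L) := by ring
  calc _ ≤ |correlation N R j a - N * T| + |(N : ℝ) * T - C * S * (N * L)| :=
        abs_sub_le _ _ _
    _ ≤ (2 * (η / 3) * (N * L) + (K * R) ^ k) + η / 3 * (N * L) := by gcongr; linarith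
    _ = η * (N * L) + K ^ k * R ^ k := by rw [mul_pow]; ring
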